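/- All vector spaces are over $\mathbb{C}$. A \emph{disk} in a vector space $V$ is a circled convex subset $S\subseteq V$; it is \emph{completant} if its linear span, with the gauge (Minkowski functional) of $S$ as seminorm, is a Banach space. A \emph{convex bornology} on $V$ is a collection $\mathfrak{S}$ of subsets of $V$ (the \emph{small} sets) that contains all singletons and is closed under passing to subsets, sums $S_1+S_2$, and disked hulls (circled convex hulls); $(V,\mathfrak{S})$ is \emph{complete} if every small set is contained in a completant small disk. In that case the completant disked hull $S^{\heartsuit}$ of a small set $S$ is the smallest completant small disk containing $S$. A linear (bilinear) map is \emph{bounded} if it maps small sets (products of two small sets) to small sets, and a \emph{bornological isomorphism} is a bounded linear bijection with bounded inverse. The \emph{completed bornological tensor product} $(V_1,\mathfrak{S}_1)\mathbin{\hat\otimes}(V_2,\mathfrak{S}_2)$ is the universal complete target of bounded bilinear maps on $V_1\times V_2$: it is a complete bornological vector space with a bounded bilinear map from $V_1\times V_2$ through which every bounded bilinear map from $V_1\times V_2$ to a complete bornological vector space factors by a unique bounded linear map. For a locally convex space $V$, $\mathrm{Bound}(V)$ is the bornology of all (von Neumann) bounded subsets and $\mathrm{Comp}(V)$ the bornology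 of all precompact subsets. \textbf{Theorem.} Let $V_1$ and $V_2$ be Fréchet spaces, and let $V_1\mathbin{\hat\otimes_\pi}V_2$ be their completed projective tensor product, that is, the completion of $V_1\otimes V_2$ in the finest locally convex vector space topology for which the canonical bilinear map $V_1\times V_2\to V_1\otimes V_2$ is continuous. The natural bilinear map $\natural\colon V_1\times V_2\to V_1\mathbin{\hat\otimes_\pi}V_2$ induces bornological isomorphisms $$(V_1,\mathrm{Comp}(V_1))\mathbin{\hat\otimes}(V_2,\mathrm{Comp}(V_2))\cong\bigl(V_1\mathbin{\hat\otimes_\pi}V_2,\ \mathrm{Comp}(V_1\mathbin{\hat\otimes_\pi}V_2)\bigr),$$ $$(V_1,\mathrm{Bound}(V_1))\mathbin{\hat\otimes}(V_2,\mathrm{Bound}(V_2))\cong\bigl(V_1\mathbin{\hat\otimes_\pi}V_2,\ \mathfrak{S}\bigr),$$ that is, the right-hand sides together with $\natural$ are completed bornological tensor products of the respective factors. Here $\mathfrak{S}$ is the bornology of all subsets of $V_1\mathbin{\hat\otimes_\pi}V_2$ that are contained in a set of the form $(B_1\otimes B_2)^{\heartsuit}$ with bounded sets $B_1\subseteq V_1$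 and $B_2\subseteq V_2$, where $B_1\otimes B_2=\{\natural(x,y)\mid x\in B_1,\ y\in B_2\}$ and the completant disked hull is taken in $\bigl(V_1\mathbin{\hat\otimes_\pi}V_2,\mathrm{Bound}(V_1\mathbin{\hat\otimes_\pi}V_2)\bigr)$. Moreover, $\mathfrak{S}=\mathrm{Bound}(V_1\mathbin{\hat\otimes_\pi}V_2)$ in each of the following cases: (i) both $V_1$ and $V_2$ are Banach spaces; (ii) one of $V_1,V_2$ is isomorphic to $L^1(M,\mu)$ for a Borel measure $\mu$ on a locally compact space $M$, and the other is an arbitrary Fréchet space; (iii) one of $V_1,V_2$ is nuclear, and the other is an arbitrary Fréchet space. -/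

import Mathlib

open Set Filter Topology MeasureTheory
open scoped Pointwise TensorProduct

universe u₁ u₂ u₃ w

noncomputable section

/-! ### Disks and convex bornologies -/

section Bornologies

variable {V : Type*} [AddCommGroup V] [Module ℂ V]

/-- A disk is a circled (balanced) and convex subset of a complex vector space. -/
def IsDisk (S : Set V) : Prop := Balanced ℂ S ∧ Convex ℝ S

/-- The disked hull: the smallest disk containing `S`. -/
def diskedHull (S : Set V) : Set V := ⋂₀ {T | IsDisk T ∧ S ⊆ T}

/-- A disk `S` is completant if its complex linear span `V_S`, with the seminorm given by the
gauge (Minkowski functional) of `S`, is a Banach space: the gauge is a norm on the span, and every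
sequence of the span that is Cauchy for the gauge converges in the span for the gauge. -/
structure IsCompletantDisk (S : Set V) : Prop where
  isDisk : IsDisk S
  norming : ∀ x ∈ Submodule.span ℂ S, gauge S x = 0 → x = 0
  complete : ∀ u : ℕ → V, (∀ n, u n ∈ Submodule.span ℂ S) →
    (∀ ε > 0, ∃ N, ∀ m ≥ N, ∀ n ≥ N, gauge S (u m - u n) < ε) →
    ∃ x ∈ Submodule.span ℂ S, Tendsto (fun n => gauge S (u n - x)) atTop (𝓝 0)

/-- A convex (vector) bornology on `V`, given by the collection `𝔖` of its small sets. -/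
structure IsConvexBornology (𝔖 : Set (Set V)) : Prop where
  singleton_mem : ∀ v : V, {v} ∈ 𝔖
  subset_mem : ∀ S ∈ 𝔖, ∀ T ⊆ S, T ∈ 𝔖
  add_mem : ∀ S₁ ∈ 𝔖, ∀ S₂ ∈ 𝔖, S₁ + S₂ ∈ 𝔖
  diskedHull_mem : ∀ S ∈ 𝔖, diskedHull S ∈ 𝔖

/-- `(V, 𝔖)` is a complete bornological vector space: `𝔖` is a convex bornology in which every
small set is contained in a completant small disk. -/
structure IsCompleteBornology (𝔖 : Set (Set V)) : Prop where
  isConvexBornology : IsConvexBornology 𝔖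
  completant : ∀ S ∈ 𝔖, ∃ T ∈ 𝔖, S ⊆ T ∧ IsCompletantDisk T

/-- The completant disked hull of `S` in `(V, 𝔖)`: the smallest completant small disk
containing `S` (which exists whenever `(V, 𝔖)` is complete and `S` is small). -/
def completantHull (𝔖 : Set (Set V)) (S : Set V) : Set V :=
  ⋂₀ {T | T ∈ 𝔖 ∧ IsCompletantDisk T ∧ S ⊆ T}

end Bornologies

/-! ### Bounded maps and the completed bornological tensor product -/

section BoundedMaps

variable {V₁ V₂ T : Type*} [AddCommGroup V₁] [Module ℂ V₁] [AddCommGroup V₂] [Module ℂ V₂]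
  [AddCommGroup T] [Module ℂ T]

/-- A linear map is bounded if it maps small sets to small sets. -/
def IsBoundedLin (𝔖₁ : Set (Set V₁)) (𝔖₂ : Set (Set V₂)) (f : V₁ →ₗ[ℂ] V₂) : Prop :=
  ∀ S ∈ 𝔖₁, f '' S ∈ 𝔖₂

/-- For a bilinear map `b`, the image `{b x y | x ∈ S₁, y ∈ S₂}` of `S₁ × S₂`. -/
def bilinImage (b : V₁ →ₗ[ℂ] V₂ →ₗ[ℂ] T) (S₁ : Set V₁) (S₂ : Set V₂) : Set T :=
  image2 (fun x y => b x y) S₁ S₂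

/-- A bilinear map is bounded if it maps products of small sets to small sets. -/
def IsBoundedBilin (𝔖₁ : Set (Set V₁)) (𝔖₂ : Set (Set V₂)) (𝔗 : Set (Set T))
    (b : V₁ →ₗ[ℂ] V₂ →ₗ[ℂ] T) : Prop :=
  ∀ S₁ ∈ 𝔖₁, ∀ S₂ ∈ 𝔖₂, bilinImage b S₁ S₂ ∈ 𝔗

/-- A bornological isomorphism: a bounded linear bijection with bounded inverse. -/
def IsBornologicalIso (𝔖₁ : Set (Set V₁)) (𝔖₂ : Set (Set V₂)) (e : V₁ ≃ₗ[ℂ] V₂) : Prop :=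
  IsBoundedLin 𝔖₁ 𝔖₂ e.toLinearMap ∧ IsBoundedLin 𝔖₂ 𝔖₁ e.symm.toLinearMap

end BoundedMaps

/-- `(T, 𝔗)` with the bilinear map `b` is a completed bornological tensor product of `(V₁, 𝔖₁)` and
`(V₂, 𝔖₂)`: it is a complete bornological vector space, `b` is bounded, and every bounded bilinear
map into a complete bornological vector space `(W, 𝔚)` factors through `b` by a unique bounded
linear map. The targets `W` range over the universe `w`. -/
structure IsCompletedTensorProduct {V₁ : Type u₁} {V₂ : Type u₂} {T : Type u₃}
    [AddCommGroup V₁] [Module ℂ V₁] [AddCommGroup V₂] [Module ℂ V₂] [AddCommGroup T] [Module ℂ T]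
    (𝔖₁ : Set (Set V₁)) (𝔖₂ : Set (Set V₂)) (𝔗 : Set (Set T))
    (b : V₁ →ₗ[ℂ] V₂ →ₗ[ℂ] T) : Prop where
  complete : IsCompleteBornology 𝔗
  bounded : IsBoundedBilin 𝔖₁ 𝔖₂ 𝔗 b
  universal : ∀ (W : Type w) [AddCommGroup W] [Module ℂ W] (𝔚 : Set (Set W)),
    IsCompleteBornology 𝔚 → ∀ c : V₁ →ₗ[ℂ] V₂ →ₗ[ℂ] W, IsBoundedBilin 𝔖₁ 𝔖₂ 𝔚 c →
      ∃! f : T →ₗ[ℂ] W, IsBoundedLin 𝔗 𝔚 f ∧ ∀ x y, f (b x y) = c x y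

/-! ### Topological vector spaces -/

/-- The bounded bornology: all von Neumann bounded subsets. -/
def boundedBornology (V : Type*) [AddCommGroup V] [Module ℂ V] [TopologicalSpace V] :
    Set (Set V) := {S | Bornology.IsVonNBounded ℂ S}

/-- The precompact bornology: all precompact (totally bounded) subsets. -/
def precompactBornology (V : Type*) [UniformSpace V] : Set (Set V) := {S | TotallyBounded S}

/-- The topology of `V` is induced by a single seminorm. For a Fréchet space this says that `V` is
a Banach space. -/
def IsSeminormable (V : Type*) [AddCommGroup V] [Module ℂ V] [TopologicalSpace V] : Prop :=
  ∃ p : Seminorm ℂ V, WithSeminorms (fun _ : Unit => p)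

/-- A nuclear space: for each continuous seminorm `p` there is a continuous seminorm `q` such that
the canonical map between the local Banach spaces of `q` and `p` is a nuclear operator
`x ↦ ∑ₙ fₙ(x) yₙ` with `|fₙ| ≤ q` and `∑ₙ p(yₙ) < ∞`. Since `V` has dense image in its local
Banach space at `p`, the vectors `yₙ` can be taken in `V`. -/
def IsNuclearSpace (V : Type*) [AddCommGroup V] [Module ℂ V] [TopologicalSpace V] : Prop :=
  ∀ p : Seminorm ℂ V, Continuous p → ∃ q : Seminorm ℂ V, Continuous q ∧
    ∃ (f : ℕ → V →ₗ[ℂ] ℂ) (y : ℕ → V), (∀ n x, ‖f n x‖ ≤ q x) ∧ Summable (fun n => p (y n)) ∧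
      ∀ x, Tendsto (fun N => p (x - ∑ n ∈ Finset.range N, f n x • y n)) atTop (𝓝 0)

/-! ### The completed projective tensor product -/

/-- The algebraic tensor product over `ℂ`, to be given the projective topology. -/
def ProjTensor (V₁ V₂ : Type*) [AddCommGroup V₁] [Module ℂ V₁] [AddCommGroup V₂] [Module ℂ V₂] :=
  V₁ ⊗[ℂ] V₂

namespace ProjTensor

variable (V₁ V₂ : Type*) [AddCommGroup V₁] [Module ℂ V₁] [AddCommGroup V₂] [Module ℂ V₂]

instance : AddCommGroup (ProjTensor V₁ V₂) := inferInstanceAs (AddCommGroup (V₁ ⊗[ℂ] V₂))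

instance : Module ℂ (ProjTensor V₁ V₂) := inferInstanceAs (Module ℂ (V₁ ⊗[ℂ] V₂))

/-- The canonical bilinear map `(x, y) ↦ x ⊗ y`. -/
def mk : V₁ →ₗ[ℂ] V₂ →ₗ[ℂ] ProjTensor V₁ V₂ := TensorProduct.mk ℂ V₁ V₂

variable [TopologicalSpace V₁] [TopologicalSpace V₂]

/-- The locally convex vector space topologies on `V₁ ⊗ V₂` for which the canonical bilinear map
`V₁ × V₂ → V₁ ⊗ V₂` is (jointly) continuous. -/
def admissibleTopologies : Set (TopologicalSpace (ProjTensor V₁ V₂)) :=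
  {t | @IsTopologicalAddGroup _ t _ ∧ @ContinuousSMul ℂ _ _ _ t ∧
    @LocallyConvexSpace ℝ _ _ _ _ _ t ∧
    @Continuous (V₁ × V₂) _ _ t (fun z => mk V₁ V₂ z.1 z.2)}

/-- The projective topology: the finest locally convex vector space topology for which the
canonical bilinear map is continuous. -/
instance : TopologicalSpace (ProjTensor V₁ V₂) := sInf (admissibleTopologies V₁ V₂)

instance : IsTopologicalAddGroup (ProjTensor V₁ V₂) := topologicalAddGroup_sInf fun _ h => h.1

instance : ContinuousSMul ℂ (ProjTensor V₁ V₂) := continuousSMul_sInf fun _ h => h.2.1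

/-- The projective topology is itself one of the topologies of which it is the finest. -/
theorem projective_mem_admissible :
    (inferInstance : TopologicalSpace (ProjTensor V₁ V₂)) ∈ admissibleTopologies V₁ V₂ :=
  ⟨inferInstance, inferInstance, LocallyConvexSpace.sInf fun _ h => h.2.2.1,
    continuous_sInf_rng.2 fun _ h => h.2.2.2⟩

instance : UniformSpace (ProjTensor V₁ V₂) := IsTopologicalAddGroup.rightUniformSpace _

instance : IsUniformAddGroup (ProjTensor V₁ V₂) := isUniformAddGroup_of_addCommGroup

instance : UniformContinuousConstSMul ℂ (ProjTensor V₁ V₂) :=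
  uniformContinuousConstSMul_of_continuousConstSMul _ _

end ProjTensor

/-- The completed projective tensor product of `V₁` and `V₂`: the Hausdorff completion of the
algebraic tensor product with the projective topology. -/
abbrev CompletedProjTensor (V₁ V₂ : Type*) [AddCommGroup V₁] [Module ℂ V₁] [AddCommGroup V₂]
    [Module ℂ V₂] [TopologicalSpace V₁] [TopologicalSpace V₂] :=
  UniformSpace.Completion (ProjTensor V₁ V₂)

namespace CompletedProjTensor

variable (V₁ V₂ : Type*) [AddCommGroup V₁] [Module ℂ V₁] [AddCommGroup V₂] [Module ℂ V₂]
  [TopologicalSpace V₁] [TopologicalSpace V₂]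

/-- The canonical linear map of the tensor product into its completion. -/
def incl : ProjTensor V₁ V₂ →ₗ[ℂ] CompletedProjTensor V₁ V₂ where
  toFun z := (z : UniformSpace.Completion (ProjTensor V₁ V₂))
  map_add' := UniformSpace.Completion.coe_add
  map_smul' c z := UniformSpace.Completion.coe_smul c z

/-- The natural bilinear map `V₁ × V₂ → V₁ ⊗̂_π V₂`. -/
def natural : V₁ →ₗ[ℂ] V₂ →ₗ[ℂ] CompletedProjTensor V₁ V₂ :=
  (ProjTensor.mk V₁ V₂).compr₂ (incl V₁ V₂)

/-- The collection of all subsets of `V₁ ⊗̂_π V₂` that are contained in the completant disked hull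
of `B₁ ⊗ B₂` for some bounded sets `B₁ ⊆ V₁` and `B₂ ⊆ V₂`. -/
def bismallBornology : Set (Set (CompletedProjTensor V₁ V₂)) :=
  {S | ∃ B₁ ∈ boundedBornology V₁, ∃ B₂ ∈ boundedBornology V₂,
    S ⊆ completantHull (boundedBornology (CompletedProjTensor V₁ V₂))
      (bilinImage (natural V₁ V₂) B₁ B₂)}

end CompletedProjTensor

end

noncomputable section

/-! ### Disks -/

section Disks

variable {V : Type*} [AddCommGroup V] [Module ℂ V] {S T : Set V} {x y : V}

/-! The projective topology of two Fréchet spaces is given by the seminorms `p k ⊗ q k`, the gauges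
of the disked hulls of products of unit balls; each is the largest seminorm bounded by `p k x * q k
y` on `x ⊗ y`. So a tensor with small seminorm lies in the disked hull of `A ⊗ B` for finite sets
`A`, `B` of small vectors, and a sequence of finite sets of tensors that tends to zero lies in the
hull of a single `A ⊗ B` with `A`, `B` precompact (`ProjTensor.exists_totallyBounded`). A precompact
subset of the completion consists of sums `∑ 2⁻ⁿ⁻² aₙ` with `aₙ` in such finite sets
(`TotallyBounded.exists_series`). This is Grothendieck's description of precompact sets of tensors.
A bounded bilinear map therefore extends by summing the image series in the Banach space of one
small completant disk. That the extension is well defined and unique rests on one fact: a null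
sequence has a subsequence that stays null after multiplication by `2ⁿ`, so its image tends to zero
for the gauge of a small disk (`BoundedOnNull.exists_gaugeTendsto`).

For the bounded bornologies the extension `f` is the one from the precompact case, and only its
boundedness is at stake. If `H = (B₁ ⊗ B₂)^♥` and `T` is a small completant disk containing the
image of `B₁ × B₂`, a closed graph argument (`IsBoundedLin.isCompletantDisk_inter`) shows that `H ∩
f⁻¹(T)` is completant. Minimality of `H` then gives `f(H) ⊆ T`.

For `𝔖 = Bound`, a bounded set of tensors must be lifted to bounded sets in the factors. For two
Banach spaces this is density of algebraic tensors and the iteration from the open mapping theorem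
(`IsCompletantDisk.mem_of_approx`). For `L¹`, conditional expectations approximate the identity by
contractions through finite-dimensional `ℓ¹`. On `ℓ¹ ⊗ V₂` the projective seminorms are sums `∑ᵢ q k
(wᵢ)`, so a weighted sum over `k` of these seminorms can be handled as if it were one seminorm, and
the same iteration applies. A nuclear factor admits expansions `x = ∑ Jⱼ(x) zⱼ` with decay
prescribed in advance (`IsNuclearSpace.exists_coefficients`); then `u = ∑ zⱼ ⊗ (Jⱼ ⊗ id) u`, and the
decay can be adapted to the given bounded set. -/

theorem isDisk_sInter {F : Set (Set V)} (h : ∀ T ∈ F, IsDisk T) : IsDisk (⋂₀ F) := by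
  refine ⟨?_, convex_sInter fun T hT => (h T hT).2⟩
  rintro a ha _ ⟨x, hx, rfl⟩ T hT
  exact (h T hT).1 a ha (smul_mem_smul_set (hx T hT))

theorem isDisk_diskedHull (S : Set V) : IsDisk (diskedHull S) := isDisk_sInter fun _ h => h.1

theorem subset_diskedHull (S : Set V) : S ⊆ diskedHull S := subset_sInter fun _ h => h.2

theorem diskedHull_min (hT : IsDisk T) (h : S ⊆ T) : diskedHull S ⊆ T := sInter_subset_of_mem ⟨hT, h⟩

theorem diskedHull_mono (h : S ⊆ T) : diskedHull S ⊆ diskedHull T :=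
  diskedHull_min (isDisk_diskedHull T) (h.trans (subset_diskedHull T))

namespace IsDisk

theorem smul_mem (hT : IsDisk T) {a : ℂ} (ha : ‖a‖ ≤ 1) (hx : x ∈ T) : a • x ∈ T :=
  hT.1 a ha (smul_mem_smul_set hx)

theorem real_smul_mem (hT : IsDisk T) {a : ℝ} (ha : |a| ≤ 1) (hx : x ∈ T) : a • x ∈ T := by
  rw [← Complex.coe_smul]
  exact hT.smul_mem (by simpa using ha) hx

theorem neg_mem (hT : IsDisk T) (hx : x ∈ T) : -x ∈ T := by
  simpa using hT.smul_mem (a := -1) (by simp) hx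

theorem zero_mem (hT : IsDisk T) (h : T.Nonempty) : (0 : V) ∈ T := by
  obtain ⟨x, hx⟩ := h
  simpa using hT.smul_mem (a := 0) (by simp) hx

theorem smul_subset_smul (hT : IsDisk T) {a b : ℝ} (h : |a| ≤ |b|) : a • T ⊆ b • T := by
  rintro _ ⟨x, hx, rfl⟩
  rcases eq_or_ne b 0 with rfl | hb
  · have : a = 0 := by simpa using h
    exact ⟨x, hx, by simp [this]⟩
  · refine ⟨(a / b) • x, hT.real_smul_mem ?_ hx, ?_⟩
    · rw [abs_div]
      exact div_le_one_of_le₀ h (abs_nonneg _)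
    · simp only [smul_smul, mul_div_cancel₀ a hb]

theorem smul_mono (hT : IsDisk T) {a b : ℝ} (ha : 0 ≤ a) (h : a ≤ b) : a • T ⊆ b • T :=
  hT.smul_subset_smul (by rwa [abs_of_nonneg ha, abs_of_nonneg (ha.trans h)])

theorem real_smul (hT : IsDisk T) (a : ℝ) : IsDisk (a • T) := by
  refine ⟨?_, hT.2.smul a⟩
  have : a • T = (a : ℂ) • T := by ext; simp [mem_smul_set]
  rw [this]
  exact hT.1.smul _

theorem add_mem_smul (hT : IsDisk T) {a b : ℝ} (ha : 0 ≤ a) (hb : 0 ≤ b) (hx : x ∈ a • T)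
    (hy : y ∈ b • T) : x + y ∈ (a + b) • T := by
  rw [hT.2.add_smul ha hb]
  exact add_mem_add hx hy

theorem neg_mem_smul (hT : IsDisk T) {a : ℝ} (hx : x ∈ a • T) : -x ∈ a • T :=
  (hT.real_smul a).neg_mem hx

theorem sub_mem_smul (hT : IsDisk T) {a b : ℝ} (ha : 0 ≤ a) (hb : 0 ≤ b) (hx : x ∈ a • T)
    (hy : y ∈ b • T) : x - y ∈ (a + b) • T := by
  rw [sub_eq_add_neg]
  exact hT.add_mem_smul ha hb hx (hT.neg_mem_smul hy)

theorem sum_mem_smul (hT : IsDisk T) (hne : T.Nonempty) {ι : Type*} (s : Finset ι) {l : ι → ℝ}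
    (hl : ∀ i ∈ s, 0 ≤ l i) {v : ι → V} (hv : ∀ i ∈ s, v i ∈ l i • T) :
    ∑ i ∈ s, v i ∈ (∑ i ∈ s, l i) • T := by
  classical
  induction s using Finset.induction_on with
  | empty => exact ⟨0, hT.zero_mem hne, by simp⟩
  | insert i s hi ih =>
    rw [Finset.sum_insert hi, Finset.sum_insert hi]
    exact hT.add_mem_smul (hl i (by simp)) (Finset.sum_nonneg fun j hj => hl j (by simp [hj]))
      (hv i (by simp)) (ih (fun j hj => hl j (by simp [hj])) fun j hj => hv j (by simp [hj]))

theorem image {W : Type*} [AddCommGroup W] [Module ℂ W] (hT : IsDisk T) (f : V →ₗ[ℂ] W) :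
    IsDisk (f '' T) := by
  refine ⟨?_, hT.2.is_linear_image (f.restrictScalars ℝ).isLinear⟩
  rintro a ha _ ⟨_, ⟨x, hx, rfl⟩, rfl⟩
  exact ⟨a • x, hT.smul_mem ha hx, by simp⟩

theorem preimage {W : Type*} [AddCommGroup W] [Module ℂ W] {T : Set W} (hT : IsDisk T)
    (f : V →ₗ[ℂ] W) : IsDisk (f ⁻¹' T) := by
  refine ⟨?_, hT.2.is_linear_preimage (f.restrictScalars ℝ).isLinear⟩
  rintro a ha _ ⟨x, hx, rfl⟩
  simpa using hT.smul_mem ha hx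

theorem inter (hS : IsDisk S) (hT : IsDisk T) : IsDisk (S ∩ T) :=
  ⟨hS.1.inter hT.1, hS.2.inter hT.2⟩

theorem exists_mem_smul_of_mem_span (hT : IsDisk T) (hne : T.Nonempty)
    (hx : x ∈ Submodule.span ℂ T) : ∃ r : ℝ, 0 < r ∧ x ∈ r • T := by
  induction hx using Submodule.span_induction with
  | mem x hx => exact ⟨1, one_pos, by simpa using hx⟩
  | zero => exact ⟨1, one_pos, by simpa using hT.zero_mem hne⟩
  | add x y _ _ hx hy =>
    obtain ⟨r, hr, hx⟩ := hx
    obtain ⟨s, hs, hy⟩ := hy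
    exact ⟨r + s, by positivity, hT.add_mem_smul hr.le hs.le hx hy⟩
  | smul a x _ hx =>
    obtain ⟨r, hr, y, hy, rfl⟩ := hx
    have ha : (0 : ℝ) < ‖a‖ + 1 := by positivity
    refine ⟨(‖a‖ + 1) * r, by positivity, (((‖a‖ + 1 : ℝ) : ℂ)⁻¹ * a) • y, hT.smul_mem ?_ hy, ?_⟩
    · rw [norm_mul, norm_inv, Complex.norm_real, Real.norm_of_nonneg ha.le, inv_mul_le_iff₀ ha]
      linarith
    · simp only [← Complex.coe_smul, smul_smul]
      congr 1
      have : ((‖a‖ + 1 : ℝ) : ℂ) ≠ 0 := by exact_mod_cast ha.ne'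
      push_cast at this ⊢
      field_simp

/-- Off the span the gauge is the infimum of the empty set, with value `0`; hence the hypothesis on
`x`. -/
theorem mem_smul_of_gauge_lt (hT : IsDisk T) (hne : T.Nonempty) (hx : x ∈ Submodule.span ℂ T)
    {a : ℝ} (h : gauge T x < a) : x ∈ a • T := by
  obtain ⟨r, hr, hrx⟩ := hT.exists_mem_smul_of_mem_span hne hx
  obtain ⟨b, ⟨hb, hbx⟩, hba⟩ := exists_lt_of_csInf_lt (s := {r ∈ Ioi (0 : ℝ) | x ∈ r • T})
    ⟨r, hr, hrx⟩ h
  exact hT.smul_mono (le_of_lt hb) hba.le hbx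

end IsDisk

theorem real_smul_set_subset_span (a : ℝ) : a • T ⊆ Submodule.span ℂ T := by
  rintro _ ⟨x, hx, rfl⟩
  simp only [← Complex.coe_smul]
  exact Submodule.smul_mem _ _ (Submodule.subset_span hx)

/-- Convergence of `u` to `x` for the gauge of `T`. -/
def GaugeTendsto (T : Set V) (u : ℕ → V) (x : V) : Prop :=
  ∀ ε : ℝ, 0 < ε → ∀ᶠ n in atTop, u n - x ∈ ε • T

/-- Membership in dilates replaces values of the gauge. This removes the span from all later
arguments and makes inclusions of disks act by monotonicity. -/
theorem isCompletantDisk_iff : IsCompletantDisk T ↔ IsDisk T ∧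
    (∀ x, (∀ ε : ℝ, 0 < ε → x ∈ ε • T) → x = 0) ∧
    ∀ u : ℕ → V, (∀ ε : ℝ, 0 < ε → ∃ N, ∀ m ≥ N, ∀ n ≥ N, u m - u n ∈ ε • T) →
      ∃ x, GaugeTendsto T u x := by
  constructor
  · intro h
    refine ⟨h.isDisk, fun x hx => ?_, fun u hu => ?_⟩
    · refine h.norming x (real_smul_set_subset_span 1 (hx 1 one_pos)) (le_antisymm ?_ (gauge_nonneg _))
      exact le_of_forall_pos_le_add fun ε hε => by
        simpa using gauge_le_of_mem hε.le (hx ε hε)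
    · obtain ⟨N, hN⟩ := hu 1 one_pos
      have hne : T.Nonempty := smul_set_nonempty.1 ⟨_, hN N le_rfl N le_rfl⟩
      -- Only differences of terms need lie in the span, so completeness is applied to the translate
      -- by `u N`.
      have hmem : ∀ n, u (n + N) - u N ∈ Submodule.span ℂ T := fun n =>
        real_smul_set_subset_span 1 (hN _ (by omega) _ le_rfl)
      obtain ⟨x, hx, hlim⟩ := h.complete (fun n => u (n + N) - u N) hmem fun ε hε => by
        obtain ⟨M, hM⟩ := hu (ε / 2) (by positivity)
        refine ⟨M, fun m hm n hn => ?_⟩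
        rw [sub_sub_sub_cancel_right]
        exact (gauge_le_of_mem (by positivity) (hM _ (by omega) _ (by omega))).trans_lt
          (by linarith)
      refine ⟨x + u N, fun ε hε => ?_⟩
      have h1 := (tendsto_sub_atTop_nat N).eventually (hlim.eventually (gt_mem_nhds hε))
      filter_upwards [h1, eventually_ge_atTop N] with n hn hNn
      rw [Nat.sub_add_cancel hNn] at hn
      have := h.isDisk.mem_smul_of_gauge_lt hne (by
        have := Submodule.sub_mem _ (hmem (n - N)) hx
        rwa [Nat.sub_add_cancel hNn] at this) hn
      convert this using 1
      abel
  · rintro ⟨hd, h1, h2⟩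
    rcases T.eq_empty_or_nonempty with rfl | hne
    · exact ⟨hd, by simp, fun u hu _ => ⟨0, by simp, by simp [gauge_empty]⟩⟩
    refine ⟨hd, fun x hx h0 => h1 x fun ε hε => hd.mem_smul_of_gauge_lt hne hx (h0 ▸ hε),
      fun u hu hc => ?_⟩
    obtain ⟨x, hx⟩ := h2 u fun ε hε => by
      obtain ⟨N, hN⟩ := hc ε hε
      exact ⟨N, fun m hm n hn => hd.mem_smul_of_gauge_lt hne (Submodule.sub_mem _ (hu m) (hu n))
        (hN m hm n hn)⟩
    refine ⟨x, ?_, ?_⟩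
    · obtain ⟨n, hn⟩ := (hx 1 one_pos).exists
      have := Submodule.sub_mem _ (hu n) (real_smul_set_subset_span 1 hn)
      simpa using this
    · rw [Metric.tendsto_atTop']
      intro ε hε
      obtain ⟨N, hN⟩ := eventually_atTop.1 (hx (ε / 2) (by positivity))
      refine ⟨N, fun n hn => ?_⟩
      rw [Real.dist_0_eq_abs, abs_of_nonneg (gauge_nonneg _)]
      exact (gauge_le_of_mem (by positivity) (hN n hn.le)).trans_lt (by linarith)

namespace GaugeTendsto

variable {u v : ℕ → V}

theorem mono (h : GaugeTendsto S u x) (hST : S ⊆ T) : GaugeTendsto T u x := fun ε hε =>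
  (h ε hε).mono fun _ hn => smul_set_mono hST hn

theorem comp (h : GaugeTendsto T u x) {φ : ℕ → ℕ} (hφ : Tendsto φ atTop atTop) :
    GaugeTendsto T (u ∘ φ) x := fun ε hε => hφ.eventually (h ε hε)

theorem add (hT : IsDisk T) (hu : GaugeTendsto T u x) (hv : GaugeTendsto T v y) :
    GaugeTendsto T (fun n => u n + v n) (x + y) := fun ε hε => by
  filter_upwards [hu (ε / 2) (by positivity), hv (ε / 2) (by positivity)] with n h1 h2
  have := hT.add_mem_smul (by positivity) (by positivity) h1 h2
  rwa [add_halves, ← add_sub_add_comm] at this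

theorem smul (hT : IsDisk T) (hu : GaugeTendsto T u x) (a : ℂ) :
    GaugeTendsto T (fun n => a • u n) (a • x) := fun ε hε => by
  have ha : (0 : ℝ) < ‖a‖ + 1 := by positivity
  filter_upwards [hu (ε / (‖a‖ + 1)) (by positivity)] with n hn
  obtain ⟨y, hy, hyn⟩ := hn
  refine ⟨(((‖a‖ + 1 : ℝ) : ℂ)⁻¹ * a) • y, hT.smul_mem ?_ hy, ?_⟩
  · rw [norm_mul, norm_inv, Complex.norm_real, Real.norm_of_nonneg ha.le, inv_mul_le_iff₀ ha]
    linarith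
  · rw [← smul_sub, ← hyn]
    simp only [← Complex.coe_smul, smul_smul]
    congr 1
    push_cast
    ring

theorem neg (hT : IsDisk T) (hu : GaugeTendsto T u x) :
    GaugeTendsto T (fun n => - u n) (-x) := by simpa using hu.smul hT (-1)

theorem sub (hT : IsDisk T) (hu : GaugeTendsto T u x) (hv : GaugeTendsto T v y) :
    GaugeTendsto T (fun n => u n - v n) (x - y) := by
  simpa [sub_eq_add_neg] using hu.add hT (hv.neg hT)

theorem unique (hT : IsCompletantDisk T) (hu : GaugeTendsto T u x) (hv : GaugeTendsto T u y) :
    x = y := by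
  refine (sub_eq_zero.1 ((isCompletantDisk_iff.1 hT).2.1 (y - x) fun ε hε => ?_)).symm
  obtain ⟨n, h⟩ := ((hu.sub hT.isDisk hv) ε hε).exists
  simpa using h

/-- A completant disk need not be closed for its own gauge (an open unit ball is not), so the
dilation factor has to grow strictly. -/
theorem mem_smul (hT : IsDisk T) (hu : GaugeTendsto T u x) {a b : ℝ} (ha : 0 ≤ a) (hab : a < b)
    (h : ∃ᶠ n in atTop, u n ∈ a • T) : x ∈ b • T := by
  obtain ⟨n, hn, hn'⟩ := (h.and_eventually (hu (b - a) (by linarith))).exists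
  have := hT.sub_mem_smul ha (by linarith) hn hn'
  rwa [sub_sub_cancel, add_sub_cancel] at this

end GaugeTendsto

/-- Absolutely convergent series in the Banach space spanned by a completant disk. -/
theorem IsCompletantDisk.exists_gaugeTendsto_sum (hT : IsCompletantDisk T) {l : ℕ → ℝ}
    (hl : ∀ n, 0 ≤ l n) (hs : Summable l) (h1 : ∑' n, l n < 1) {v : ℕ → V}
    (hv : ∀ n, v n ∈ l n • T) :
    ∃ x ∈ T, GaugeTendsto T (fun N => ∑ n ∈ Finset.range N, v n) x := by
  have hne : T.Nonempty := smul_set_nonempty.1 ⟨_, hv 0⟩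
  have hd := hT.isDisk
  have key : ∀ m n, m ≤ n → (∑ i ∈ Finset.range n, v i) - ∑ i ∈ Finset.range m, v i ∈
      (∑ i ∈ Finset.range n, l i - ∑ i ∈ Finset.range m, l i) • T := fun m n hmn => by
    rw [← Finset.sum_Ico_eq_sub _ hmn, ← Finset.sum_Ico_eq_sub _ hmn]
    exact hd.sum_mem_smul hne _ (fun i _ => hl i) fun i _ => hv i
  have mono : ∀ m n, m ≤ n → ∑ i ∈ Finset.range m, l i ≤ ∑ i ∈ Finset.range n, l i := fun m n h =>
    Finset.sum_le_sum_of_subset_of_nonneg (Finset.range_mono h) fun i _ _ => hl i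
  obtain ⟨x, hx⟩ := (isCompletantDisk_iff.1 hT).2.2 (fun N => ∑ n ∈ Finset.range N, v n)
    fun ε hε => by
      obtain ⟨N, hN⟩ := Metric.cauchySeq_iff.1 hs.hasSum.tendsto_sum_nat.cauchySeq ε hε
      refine ⟨N, fun m hm n hn => ?_⟩
      have hd' := hN m hm n hn
      rw [Real.dist_eq] at hd'
      rcases le_total n m with h | h
      · have := mono n m h
        exact hd.smul_mono (by linarith) ((le_abs_self _).trans hd'.le) (key n m h)
      · have := mono m n h
        rw [abs_sub_comm] at hd'
        rw [← neg_sub]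
        exact hd.neg_mem_smul
          (hd.smul_mono (by linarith) ((le_abs_self _).trans hd'.le) (key m n h))
  refine ⟨x, ?_, hx⟩
  -- The strict bound `∑ l < 1` places the limit in `T` itself, although `T` need not be gauge
  -- closed.
  have := hx.mem_smul hd (tsum_nonneg hl) h1 (Frequently.of_forall fun n =>
    hd.smul_mono (Finset.sum_nonneg fun i _ => hl i) (hs.sum_le_tsum _ fun i _ => hl i)
      (hd.sum_mem_smul hne _ (fun i _ => hl i) fun i _ => hv i))
  simpa using this

theorem IsCompletantDisk.real_smul (hT : IsCompletantDisk T) {a : ℝ} (ha : 0 < a) :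
    IsCompletantDisk (a • T) := by
  obtain ⟨hd, h1, h2⟩ := isCompletantDisk_iff.1 hT
  have aux : ∀ x, ∀ ε : ℝ, x ∈ ε • a • T ↔ x ∈ (ε * a) • T := fun x ε => by rw [smul_smul]
  refine isCompletantDisk_iff.2 ⟨hd.real_smul a, fun x hx => h1 x fun ε hε => ?_,
    fun u hu => ?_⟩
  · have := (aux _ _).1 (hx (ε / a) (by positivity))
    rwa [div_mul_cancel₀ _ ha.ne'] at this
  · obtain ⟨x, hx⟩ := h2 u fun ε hε => by
      obtain ⟨N, hN⟩ := hu (ε / a) (by positivity)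
      refine ⟨N, fun m hm n hn => ?_⟩
      have := (aux _ _).1 (hN m hm n hn)
      rwa [div_mul_cancel₀ _ ha.ne'] at this
    refine ⟨x, fun ε hε => ?_⟩
    filter_upwards [hx (ε * a) (by positivity)] with n hn
    exact (aux _ _).2 hn

theorem IsCompletantDisk.image_equiv {W : Type*} [AddCommGroup W] [Module ℂ W]
    (hT : IsCompletantDisk T) (e : V ≃ₗ[ℂ] W) : IsCompletantDisk (e '' T) := by
  obtain ⟨hd, h1, h2⟩ := isCompletantDisk_iff.1 hT
  have aux : ∀ (x : V) (ε : ℝ), e x ∈ ε • (e '' T) ↔ x ∈ ε • T := fun x ε => by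
    have : ε • (e '' T) = e '' (ε • T) := by
      ext y
      simp only [mem_smul_set, mem_image, exists_exists_and_eq_and, ← Complex.coe_smul, map_smul]
    rw [this, e.injective.mem_set_image]
  refine isCompletantDisk_iff.2 ⟨hd.image e.toLinearMap, fun x hx => ?_, fun u hu => ?_⟩
  · rw [← e.symm.map_eq_zero_iff]
    exact h1 _ fun ε hε => by simpa [← aux] using hx ε hε
  · obtain ⟨x, hx⟩ := h2 (fun n => e.symm (u n)) fun ε hε => by
      obtain ⟨N, hN⟩ := hu ε hε
      exact ⟨N, fun m hm n hn => by simpa [← aux] using hN m hm n hn⟩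
    exact ⟨e x, fun ε hε => (hx ε hε).mono fun n hn => by simpa [← aux] using hn⟩

end Disks

/-! ### Disks and bornologies in locally convex spaces -/

section TopologicalDisks

variable {X : Type*} [AddCommGroup X] [Module ℂ X] {S T H : Set X}

/-- A subdisk of a completant disk whose gauge has the Fatou property is completant. -/
theorem IsCompletantDisk.of_subset (hH : IsCompletantDisk H) (hT : IsDisk T) (hTH : T ⊆ H)
    (h : ∀ u x, (∀ ε : ℝ, 0 < ε → ∃ N, ∀ m ≥ N, ∀ n ≥ N, u m - u n ∈ ε • T) →
      GaugeTendsto H u x → GaugeTendsto T u x) : IsCompletantDisk T := by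
  obtain ⟨-, h1, h2⟩ := isCompletantDisk_iff.1 hH
  refine isCompletantDisk_iff.2 ⟨hT, fun x hx => h1 x fun ε hε => smul_set_mono hTH (hx ε hε),
    fun u hu => ?_⟩
  obtain ⟨x, hx⟩ := h2 u fun ε hε => by
    obtain ⟨N, hN⟩ := hu ε hε
    exact ⟨N, fun m hm n hn => smul_set_mono hTH (hN m hm n hn)⟩
  exact ⟨x, h u x hu hx⟩

/-- Uniform Cauchy control passes to the limit, with the same threshold. -/
theorem exists_forall_sub_mem_smul (hT : IsCompletantDisk T) {u : ℕ → X} {N : ℕ} {ε : ℝ} (hε : 0 < ε)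
    (hN : ∀ m ≥ N, ∀ n ≥ N, u m - u n ∈ (ε / 2) • T) {x : X}
    (hx : GaugeTendsto T (u) x) : ∀ n ≥ N, u n - x ∈ ε • T := by
  intro n hn
  obtain ⟨m, hm, hmN⟩ := ((hx (ε / 2) (by positivity)).and (eventually_ge_atTop N)).exists
  have := hT.isDisk.add_mem_smul (by positivity) (by positivity) (hN n hn m hmN) hm
  rwa [add_halves, sub_add_sub_cancel] at this

theorem subset_completantHull (𝔖 : Set (Set X)) : S ⊆ completantHull 𝔖 S :=
  subset_sInter fun _ h => h.2.2

theorem completantHull_subset {𝔖 : Set (Set X)} (hT : T ∈ 𝔖) (hT' : IsCompletantDisk T)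
    (hS : S ⊆ T) : completantHull 𝔖 S ⊆ T := sInter_subset_of_mem ⟨hT, hT', hS⟩

theorem exists_pos_real_smul_subset [TopologicalSpace X] (hT : Bornology.IsVonNBounded ℂ T) {U : Set X}
    (hU : U ∈ 𝓝 (0 : X)) : ∃ ε : ℝ, 0 < ε ∧ ε • T ⊆ U := by
  obtain ⟨r, hr, h⟩ := (hT hU).exists_pos
  refine ⟨r⁻¹, inv_pos.2 hr, ?_⟩
  rintro _ ⟨x, hx, rfl⟩
  obtain ⟨y, hy, hyx⟩ := h (r : ℂ) (by simp [abs_of_pos hr]) hx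
  have : (r : ℂ) ≠ 0 := by exact_mod_cast hr.ne'
  simp only [← hyx, ← Complex.coe_smul, smul_smul]
  simpa [this] using hy

theorem eq_zero_of_forall_mem_smul [TopologicalSpace X] [T1Space X] (hT : Bornology.IsVonNBounded ℂ T)
    {x : X} (h : ∀ ε : ℝ, 0 < ε → x ∈ ε • T) : x = 0 := by
  by_contra hx
  obtain ⟨ε, hε, hεU⟩ := exists_pos_real_smul_subset hT (isOpen_compl_singleton.mem_nhds (Ne.symm hx))
  exact hεU (h ε hε) rfl

section
variable [TopologicalSpace X] [IsTopologicalAddGroup X]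

theorem GaugeTendsto.tendsto (hT : Bornology.IsVonNBounded ℂ T) {u : ℕ → X} {x : X}
    (h : GaugeTendsto T u x) : Tendsto u atTop (𝓝 x) := by
  rw [← tendsto_sub_nhds_zero_iff]
  intro U hU
  obtain ⟨ε, hε, hεU⟩ := exists_pos_real_smul_subset hT hU
  exact (h ε hε).mono fun n hn => hεU hn

end

theorem smul_sInter {ι : Type*} {a : ℝ} (ha : a ≠ 0) (F : ι → Set X) :
    a • ⋂ i, F i = ⋂ i, a • F i := by
  ext x
  simp only [mem_iInter, mem_smul_set_iff_inv_smul_mem₀ ha]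

section
variable [TopologicalSpace X] [IsTopologicalAddGroup X] [T2Space X]

/-- The completant disked hull in the bounded bornology is itself a completant disk. -/
theorem isCompletantDisk_completantHull (hT : T ∈ boundedBornology X) (hT' : IsCompletantDisk T)
    (hS : S ⊆ T) : IsCompletantDisk (completantHull (boundedBornology X) S) := by
  have hsub : completantHull (boundedBornology X) S ⊆ T := sInter_subset_of_mem ⟨hT, hT', hS⟩
  refine hT'.of_subset (isDisk_sInter fun _ h => h.2.1.isDisk) hsub fun u x hu hx => ?_
  intro ε hε
  obtain ⟨N, hN⟩ := hu (ε / 2) (by positivity)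
  refine eventually_atTop.2 ⟨N, fun n hn => ?_⟩
  rw [completantHull, sInter_eq_iInter, smul_sInter hε.ne', mem_iInter]
  rintro ⟨T', hT'b, hT'c, hST'⟩
  have hsub' : completantHull (boundedBornology X) S ⊆ T' := sInter_subset_of_mem ⟨hT'b, hT'c, hST'⟩
  -- Every competing disk `T'` provides its own limit. Both limits are limits in the Hausdorff
  -- topology of `X`, since the disks are bounded, so they agree.
  obtain ⟨y, hy⟩ := (isCompletantDisk_iff.1 hT'c).2.2 u fun δ hδ => by
    obtain ⟨M, hM⟩ := hu δ hδ
    exact ⟨M, fun m hm n hn => smul_set_mono hsub' (hM m hm n hn)⟩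
  have hxy : y = x := tendsto_nhds_unique (hy.tendsto hT'b) (hx.tendsto hT)
  subst hxy
  exact exists_forall_sub_mem_smul hT'c hε
    (fun m hm n hn => smul_set_mono hsub' (hN m hm n hn)) hy n hn

end

end TopologicalDisks

theorem continuousSMul_real (X : Type*) [AddCommGroup X] [Module ℂ X] [TopologicalSpace X]
    [ContinuousSMul ℂ X] : ContinuousSMul ℝ X := ⟨by
  have : Continuous fun p : ℝ × X => (p.1 : ℂ) • p.2 :=
    (Complex.continuous_ofReal.comp continuous_fst).smul continuous_snd
  simpa only [Complex.coe_smul] using this⟩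

/-! ### Completant disks in complete locally convex spaces -/

section Complete

variable {X : Type*} [AddCommGroup X] [Module ℂ X] [UniformSpace X] [IsUniformAddGroup X]
  [ContinuousSMul ℂ X] [T2Space X] [CompleteSpace X] {S T : Set X}

/-- A closed bounded disk in a complete space is completant. -/
theorem isCompletantDisk_of_isClosed (hd : IsDisk T) (hT : Bornology.IsVonNBounded ℂ T)
    (hc : IsClosed T) : IsCompletantDisk T := by
  have := continuousSMul_real X
  refine isCompletantDisk_iff.2 ⟨hd, fun x => eq_zero_of_forall_mem_smul hT, fun u hu => ?_⟩
  -- Boundedness of `T` turns gauge Cauchy into Cauchy; closedness of the dilates of `T` turns the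
  -- topological limit back into a gauge limit.
  have hcau : CauchySeq u := by
    rw [cauchySeq_iff]
    intro V hV
    rw [uniformity_eq_comap_nhds_zero X] at hV
    obtain ⟨U, hU, hUV⟩ := hV
    obtain ⟨ε, hε, hεU⟩ := exists_pos_real_smul_subset hT hU
    obtain ⟨N, hN⟩ := hu ε hε
    exact ⟨N, fun m hm n hn => hUV (hεU (hN n hn m hm))⟩
  obtain ⟨x, hx⟩ := cauchySeq_tendsto_of_complete hcau
  refine ⟨x, fun ε hε => ?_⟩
  obtain ⟨N, hN⟩ := hu ε hε
  refine eventually_atTop.2 ⟨N, fun n hn => ?_⟩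
  have hcl : IsClosed (ε • T) := hc.smul_of_ne_zero hε.ne'
  exact hcl.mem_of_tendsto (tendsto_const_nhds.sub hx)
    (eventually_atTop.2 ⟨N, fun m hm => hN n hn m hm⟩)

theorem IsDisk.topClosure {X : Type*} [AddCommGroup X] [Module ℂ X] [TopologicalSpace X]
    [IsTopologicalAddGroup X] [ContinuousSMul ℂ X] {T : Set X} (hT : IsDisk T) :
    IsDisk (closure T) := by
  have := continuousSMul_real X
  exact ⟨hT.1.closure, hT.2.closure⟩

/-- The circled hull of the compact closure is the image of a compact set under scalar
multiplication, and convex hulls preserve total boundedness in a locally convex space. -/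
theorem totallyBounded_closure_diskedHull [LocallyConvexSpace ℝ X] (hS : TotallyBounded S) :
    TotallyBounded (closure (diskedHull S)) := by
  have : ContinuousSMul ℝ X := continuousSMul_real X
  set K : Set X := (fun z : ℂ × X => z.1 • z.2) '' (Metric.closedBall 0 1 ×ˢ closure S)
  have hK : IsCompact K :=
    ((isCompact_closedBall 0 1).prod (hS.closure.isCompact_of_isClosed isClosed_closure)).image
      continuous_smul
  have hKd : IsDisk (convexHull ℝ K) := by
    refine ⟨?_, convex_convexHull ℝ K⟩
    intro a ha
    have h1 : a • convexHull ℝ K = convexHull ℝ (a • K) :=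
      (LinearMap.image_convexHull ((LinearMap.lsmul ℂ X a).restrictScalars ℝ) K)
    rw [h1]
    refine convexHull_mono ?_
    rintro _ ⟨_, ⟨⟨b, x⟩, ⟨hb, hx⟩, rfl⟩, rfl⟩
    refine ⟨(a * b, x), ⟨?_, hx⟩, by simp [smul_smul]⟩
    simp only [mem_closedBall_zero_iff] at hb ⊢
    rw [norm_mul]
    exact mul_le_one₀ ha (norm_nonneg _) hb
  refine (hK.totallyBounded.convexHull.subset (diskedHull_min hKd ?_)).closure
  exact fun x hx => subset_convexHull ℝ K ⟨(1, x), ⟨by simp, subset_closure hx⟩, by simp⟩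

theorem isCompleteBornology_precompact [LocallyConvexSpace ℝ X] :
    IsCompleteBornology (precompactBornology X) := by
  refine ⟨⟨fun v => totallyBounded_singleton v, fun S hS T hT => hS.subset hT, fun S hS T hT => ?_,
    fun S hS => (totallyBounded_closure_diskedHull hS).subset subset_closure⟩, fun S hS => ?_⟩
  · have h := ((TotallyBounded.closure hS).isCompact_of_isClosed isClosed_closure).add
      ((TotallyBounded.closure hT).isCompact_of_isClosed isClosed_closure)
    exact h.totallyBounded.subset (add_subset_add subset_closure subset_closure)
  · have h := totallyBounded_closure_diskedHull hS
    exact ⟨_, h, (subset_diskedHull S).trans subset_closure,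
      isCompletantDisk_of_isClosed (isDisk_diskedHull S).topClosure (h.isVonNBounded ℂ)
        isClosed_closure⟩

theorem WithSeminorms.exists_completant {ι : Type*} {P : ι → Seminorm ℂ X} (hP : WithSeminorms P)
    (hS : S ∈ boundedBornology X) : ∃ T ∈ boundedBornology X, S ⊆ T ∧ IsCompletantDisk T := by
  choose r hr h using hP.isVonNBounded_iff_seminorm_bounded.1 hS
  set T : Set X := ⋂ i, (P i).closedBall 0 (r i)
  have hT : T ∈ boundedBornology X :=
    hP.isVonNBounded_iff_seminorm_bounded.2 fun i => ⟨r i + 1, by linarith [hr i], fun x hx => by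
      have := mem_iInter.1 hx i
      rw [Seminorm.mem_closedBall_zero] at this
      linarith⟩
  refine ⟨T, hT, fun x hx => mem_iInter.2 fun i => ?_, isCompletantDisk_of_isClosed ⟨?_, ?_⟩ hT ?_⟩
  · exact (Seminorm.mem_closedBall_zero _).2 (h i x hx).le
  · exact balanced_iInter fun i => Seminorm.balanced_closedBall_zero _ _
  · exact convex_iInter fun i => Seminorm.convex_closedBall _ _ _
  · refine isClosed_iInter fun i => ?_
    simp only [Seminorm.closedBall_zero_eq]
    exact isClosed_le (hP.continuous_seminorm i) continuous_const

end Complete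

/-! ### Defining sequences of seminorms and null sequences -/

section Sequences

variable {X : Type*} [AddCommGroup X] [Module ℂ X]

theorem WithSeminorms.exists_ball_subset [TopologicalSpace X] {P : ℕ → Seminorm ℂ X}
    (hP : WithSeminorms P)
    (hm : Monotone P) {U : Set X} (hU : U ∈ 𝓝 (0 : X)) :
    ∃ k, ∃ r : ℝ, 0 < r ∧ ∀ x, P k x < r → x ∈ U := by
  obtain ⟨⟨s, r⟩, hr, h⟩ := hP.hasBasis_zero_ball.mem_iff.1 hU
  refine ⟨s.sup id, r, hr, fun x hx => h ?_⟩
  rw [Seminorm.mem_ball_zero]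
  exact (Finset.sup_le (fun i hi => hm (Finset.le_sup (f := id) hi)) :
    s.sup P ≤ P (s.sup id)) x |>.trans_lt hx

theorem WithSeminorms.tendsto_zero_iff [TopologicalSpace X] {P : ℕ → Seminorm ℂ X}
    (hP : WithSeminorms P) {u : ℕ → X} :
    Tendsto u atTop (𝓝 0) ↔ ∀ k, Tendsto (fun n => P k (u n)) atTop (𝓝 0) := by
  rw [hP.tendsto_nhds]
  refine forall_congr' fun k => ?_
  simp only [sub_zero, Metric.tendsto_nhds, Real.dist_0_eq_abs, abs_of_nonneg (apply_nonneg (P k) _)]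

/-- A Fréchet space has an increasing sequence of seminorms defining its topology. -/
theorem exists_monotone_withSeminorms [TopologicalSpace X] [IsTopologicalAddGroup X]
    [ContinuousSMul ℂ X] [LocallyConvexSpace ℝ X] [FirstCountableTopology X] :
    ∃ P : ℕ → Seminorm ℂ X, Monotone P ∧ WithSeminorms P := by
  open scoped ComplexOrder in
  have : LocallyConvexSpace ℂ X := by
    refine ⟨fun x => (LocallyConvexSpace.convex_basis (𝕜 := ℝ) x).to_hasBasis
      (fun s hs => ⟨s, ⟨hs.1, ?_⟩, le_rfl⟩) fun s hs => ⟨s, ⟨hs.1, ?_⟩, le_rfl⟩⟩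
    · exact (convex_RCLike_iff_convex_real (K := ℂ)).2 hs.2
    · exact (convex_RCLike_iff_convex_real (K := ℂ)).1 hs.2
  have : ContinuousSMul ℝ X := continuousSMul_real X
  have hQ := with_gaugeSeminormFamily (𝕜 := ℂ) (E := X)
  set Q := gaugeSeminormFamily ℂ X
  obtain ⟨U, hU⟩ := (𝓝 (0 : X)).exists_antitone_basis
  have h1 : ∀ n, ∃ s : Finset (AbsConvexOpenSets ℂ X), ∃ r : ℝ, 0 < r ∧ (s.sup Q).ball 0 r ⊆ U n :=
    fun n => by
      obtain ⟨⟨s, r⟩, hr, h⟩ := hQ.hasBasis_zero_ball.mem_iff.1 (hU.mem n)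
      exact ⟨s, r, hr, h⟩
  choose s r hr h using h1
  -- Each neighbourhood in the countable basis contains a ball of one finite supremum, so these
  -- countably many suprema suffice. Partial suprema then make the sequence increasing.
  have h2 : WithSeminorms (fun n => (s n).sup Q) := by
    refine hQ.congr (fun n => ⟨s n, 1, by simp⟩) fun i => ?_
    have hb : (Q i).ball 0 1 ∈ 𝓝 (0 : X) := (hQ.hasBasis_zero_ball.mem_iff).2
      ⟨({i}, 1), one_pos, by simp⟩
    obtain ⟨n, -, hn⟩ := hU.1.mem_iff.1 hb
    refine ⟨{n}, ⟨(r n)⁻¹, (inv_pos.2 (hr n)).le⟩, ?_⟩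
    rw [Finset.sup_singleton]
    intro x
    change Q i x ≤ (r n)⁻¹ * ((s n).sup Q) x
    refine le_of_forall_gt_imp_ge_of_dense fun a ha => ?_
    have hnn : 0 ≤ (r n)⁻¹ * ((s n).sup Q) x := by
      have := (hr n).le
      positivity
    have ha0 : 0 < a := hnn.trans_lt ha
    have hmem : ((a : ℂ)⁻¹ • x) ∈ (Q i).ball 0 1 := hn (h n (by
      rw [Seminorm.mem_ball_zero, map_smul_eq_mul, norm_inv, Complex.norm_real,
        Real.norm_of_nonneg ha0.le, inv_mul_lt_iff₀ ha0]
      rwa [inv_mul_lt_iff₀ (hr n), mul_comm] at ha))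
    rw [Seminorm.mem_ball_zero, map_smul_eq_mul, norm_inv, Complex.norm_real,
        Real.norm_of_nonneg ha0.le, inv_mul_lt_iff₀ ha0, mul_one] at hmem
    exact hmem.le
  exact ⟨_, fun m n hmn => Finset.sup_mono (Finset.Iic_subset_Iic.2 hmn), h2.partial_sups⟩

variable [UniformSpace X] [IsUniformAddGroup X] {P : ℕ → Seminorm ℂ X}

/-- All but finitely many of the finite sets lie in any given neighbourhood of zero, since `P k ≤ P
n` for `n ≥ k`. -/
theorem totallyBounded_iUnion_finite (hP : WithSeminorms P) (hm : Monotone P) {G : ℕ → Set X}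
    (hG : ∀ n, (G n).Finite) {ρ : ℕ → ℝ} (hρ : Tendsto ρ atTop (𝓝 0))
    (h : ∀ᶠ n in atTop, ∀ x ∈ G n, P n x ≤ ρ n) : TotallyBounded (⋃ n, G n) := by
  rw [totallyBounded_iff_subset_finite_iUnion_nhds_zero]
  intro U hU
  obtain ⟨k, r, hr, hk⟩ := hP.exists_ball_subset hm hU
  obtain ⟨N, hN⟩ := eventually_atTop.1 ((h.and (hρ.eventually (gt_mem_nhds hr))).and
    (eventually_ge_atTop k))
  refine ⟨insert 0 (⋃ n ∈ Finset.range N, G n),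
    ((Finset.range N).finite_toSet.biUnion fun n _ => hG n).insert 0, ?_⟩
  intro x hx
  obtain ⟨n, hn⟩ := mem_iUnion.1 hx
  rw [mem_iUnion₂]
  by_cases hnN : n < N
  · refine ⟨x, Or.inr (mem_biUnion (by simpa using hnN) hn), 0, mem_of_mem_nhds hU, by simp⟩
  · obtain ⟨⟨h1, h2⟩, h3⟩ := hN n (not_lt.1 hnN)
    exact ⟨0, Or.inl rfl, x, hk x (((hm h3 x).trans (h1 x hn)).trans_lt h2), by simp⟩

/-- A null sequence has a subsequence that remains precompact after multiplication by `2 ^ n`. -/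
theorem exists_subseq_totallyBounded {X : Type*} [AddCommGroup X] [Module ℂ X]
    {P : ℕ → Seminorm ℂ X} {X₀ : Type*} {f : X₀ → X} {u : ℕ → X₀}
    (hu : ∀ k, Tendsto (fun n => P k (f (u n))) atTop (𝓝 0)) :
    ∃ φ : ℕ → ℕ, StrictMono φ ∧ ∀ n, P n ((2 : ℂ) ^ n • f (u (φ n))) ≤ (1 / 2) ^ n := by
  -- A diagonal choice: the `n`-th term is controlled for `P n`, and the bound `4⁻ⁿ` leaves `2⁻ⁿ`
  -- after multiplication by `2ⁿ`.
  obtain ⟨φ, hφ, h⟩ := extraction_forall_of_eventually' (P := fun n k => P n (f (u k)) ≤ (1 / 4) ^ n)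
    fun n => by
      obtain ⟨N, hN⟩ := eventually_atTop.1 ((hu n).eventually (gt_mem_nhds
        (show (0 : ℝ) < (1 / 4) ^ n by positivity)))
      exact ⟨N, fun m hm => (hN m hm).le⟩
  refine ⟨φ, hφ, fun n => ?_⟩
  rw [map_smul_eq_mul, norm_pow, Complex.norm_ofNat]
  calc _ ≤ (2 : ℝ) ^ n * (1 / 4) ^ n := by gcongr; exact h n
    _ = (1 / 2) ^ n := by rw [← mul_pow]; norm_num

end Sequences

/-! ### Series representations of precompact sets -/

section Series

variable {X : Type*} [AddCommGroup X] [Module ℂ X]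

theorem Seminorm.map_real_smul (P : Seminorm ℂ X) (a : ℝ) (x : X) : P (a • x) = |a| * P x := by
  rw [← Complex.coe_smul, map_smul_eq_mul, Complex.norm_real, Real.norm_eq_abs]

variable [UniformSpace X] [IsUniformAddGroup X] {P : ℕ → Seminorm ℂ X}
  {X₀ : Type*} [AddCommGroup X₀] [Module ℂ X₀] {i : X₀ →ₗ[ℂ] X} {S : Set X}

theorem TotallyBounded.exists_finite_approx (hS : TotallyBounded S) (hi : DenseRange i)
    {p : Seminorm ℂ X} (hp : Continuous p) {ε : ℝ} (hε : 0 < ε) :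
    ∃ F : Set X₀, F.Finite ∧ ∀ x ∈ S, ∃ f ∈ F, p (x - i f) < ε := by
  have hU : {x | p x < ε / 2} ∈ 𝓝 (0 : X) :=
    (isOpen_lt hp continuous_const).mem_nhds (by simpa using half_pos hε)
  obtain ⟨t, ht, hSt⟩ := totallyBounded_iff_subset_finite_iUnion_nhds_zero.1 hS _ hU
  have h1 : ∀ y : X, ∃ f : X₀, p (y - i f) < ε / 2 := fun y => by
    have ho : IsOpen {z | p (y - z) < ε / 2} :=
      isOpen_lt (hp.comp (continuous_const.sub continuous_id)) continuous_const
    obtain ⟨f, hf⟩ := hi.exists_mem_open ho ⟨y, by simpa using half_pos hε⟩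
    exact ⟨f, hf⟩
  choose g hg using h1
  refine ⟨g '' t, ht.image g, fun x hx => ?_⟩
  obtain ⟨y, hy, u, hu, rfl⟩ := mem_iUnion₂.1 (hSt hx)
  refine ⟨g y, mem_image_of_mem g hy, ?_⟩
  have h2 : y + u - i (g y) = u + (y - i (g y)) := by abel
  simp only [vadd_eq_add, h2]
  calc p (u + (y - i (g y))) ≤ p u + p (y - i (g y)) := map_add_le_add p _ _
    _ < ε / 2 + ε / 2 := add_lt_add hu (hg y)
    _ = ε := add_halves ε

/-- The elements of a precompact set are sums of series `∑ 2⁻ⁿ⁻² aₙ`, with `aₙ` in finite subsets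
`F n` of a dense subspace that tend to zero. -/
theorem TotallyBounded.exists_series (hS : TotallyBounded S) (hi : DenseRange i)
    (hP : WithSeminorms P) (hm : Monotone P) :
    ∃ F : ℕ → Set X₀, (∀ n, (F n).Finite) ∧ (∀ n, ∀ a ∈ F (n + 1), P n (i a) ≤ (1 / 2) ^ n) ∧
      ∀ x ∈ S, ∃ a : ℕ → X₀, (∀ n, a n ∈ F n) ∧
        Tendsto (fun N => ∑ n ∈ Finset.range N, (1 / 2 : ℝ) ^ (n + 2) • i (a n)) atTop (𝓝 x) := by
  -- The accuracy `2⁻²ⁿ⁻⁴` beats the later rescaling of the corrections by `2ⁿ⁺²`.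
  have hε : ∀ n : ℕ, (0 : ℝ) < (1 / 2) ^ (2 * n + 4) := fun n => by positivity
  choose F' hF'f hF' using fun (n : ℕ) (S : {S : Set X // TotallyBounded S}) =>
    S.2.exists_finite_approx hi (hP.continuous_seminorm n) (hε n)
  -- The set of remainders after one correction is a finite union of translates of the previous one,
  -- hence again precompact.
  let next (n : ℕ) (S : {S : Set X // TotallyBounded S}) : {S : Set X // TotallyBounded S} :=
    ⟨⋃ f ∈ F' n S, (fun x => x - i f) '' S.1, (totallyBounded_biUnion (hF'f n S)).2 fun f _ =>
      S.2.image (uniformContinuous_id.sub uniformContinuous_const)⟩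
  let 𝒮 : ℕ → {S : Set X // TotallyBounded S} := fun n => Nat.rec ⟨S, hS⟩ next n
  have h𝒮 : ∀ n, 𝒮 (n + 1) = next n (𝒮 n) := fun n => rfl
  have hstep : ∀ n x, ∃ f, x ∈ (𝒮 n).1 → f ∈ F' n (𝒮 n) ∧ P n (x - i f) < (1 / 2) ^ (2 * n + 4) :=
    fun n x => by
      by_cases hx : x ∈ (𝒮 n).1
      · obtain ⟨f, hf⟩ := hF' n (𝒮 n) x hx
        exact ⟨f, fun _ => hf⟩
      · exact ⟨0, fun h => absurd h hx⟩
  choose g hg using hstep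
  -- For `n = m + 1` only approximants already small for `P m` are kept. The ones chosen below
  -- survive, being differences of consecutive remainders. No smallness is available for `n = 0`.
  refine ⟨fun n => (fun f => (2 : ℝ) ^ (n + 2) • f) ''
    {f ∈ F' n (𝒮 n) | ∀ m, n = m + 1 → P m (i f) ≤ 2 * (1 / 2) ^ (2 * m + 4)},
    fun n => ((hF'f n _).subset (sep_subset _ _)).image _, ?_, fun x hx => ?_⟩
  · rintro n _ ⟨f, ⟨-, hf⟩, rfl⟩
    have h1 := hf n rfl
    simp only [LinearMap.map_smul_of_tower, Seminorm.map_real_smul]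
    rw [abs_of_pos (by positivity)]
    calc (2 : ℝ) ^ (n + 1 + 2) * P n (i f) ≤ 2 ^ (n + 1 + 2) * (2 * (1 / 2) ^ (2 * n + 4)) := by
          gcongr
      _ = (1 / 2) ^ n * (2 ^ n * (1 / 2) ^ n) := by ring
      _ = (1 / 2) ^ n := by rw [← mul_pow]; norm_num
  · let y : ℕ → X := fun n => Nat.rec x (fun n y => y - i (g n y)) n
    have hy0 : ∀ n, y (n + 1) = y n - i (g n (y n)) := fun n => rfl
    have hy : ∀ n, y n ∈ (𝒮 n).1 := fun n => by
      induction n with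
      | zero => exact hx
      | succ n ih =>
        rw [h𝒮]
        exact mem_biUnion (hg n _ ih).1 (mem_image_of_mem _ ih)
    have hys : ∀ n, P n (y (n + 1)) < (1 / 2) ^ (2 * n + 4) := fun n => (hg n _ (hy n)).2
    refine ⟨fun n => (2 : ℝ) ^ (n + 2) • g n (y n), fun n => ⟨_, ⟨(hg n _ (hy n)).1, ?_⟩, rfl⟩, ?_⟩
    · rintro m rfl
      have h1 : i (g (m + 1) (y (m + 1))) = y (m + 1) - y (m + 1 + 1) := by rw [hy0 (m + 1)]; abel
      rw [h1]
      calc _ ≤ P m (y (m + 1)) + P m (y (m + 1 + 1)) := map_sub_le_add _ _ _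
        _ ≤ (1 / 2) ^ (2 * m + 4) + (1 / 2) ^ (2 * m + 4) := by
          refine add_le_add (hys m).le (((hm m.le_succ _).trans (hys (m + 1)).le).trans ?_)
          exact pow_le_pow_of_le_one (by norm_num) (by norm_num) (by omega)
        _ = _ := by ring
    · have hsum : ∀ N, ∑ n ∈ Finset.range N, (1 / 2 : ℝ) ^ (n + 2) • i ((2 : ℝ) ^ (n + 2) • g n (y n))
          = x - y N := fun N => by
        induction N with
        | zero => simp [y]
        | succ N ih =>
          rw [Finset.sum_range_succ, ih, LinearMap.map_smul_of_tower, smul_smul, ← mul_pow, hy0]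
          norm_num
          abel
      simp only [hsum]
      have hlim : Tendsto y atTop (𝓝 0) := by
        rw [← tendsto_add_atTop_iff_nat 1, hP.tendsto_zero_iff]
        intro k
        have h0 : Tendsto (fun n : ℕ => (1 / 2 : ℝ) ^ (2 * n + 4)) atTop (𝓝 0) :=
          (tendsto_pow_atTop_nhds_zero_of_lt_one (by norm_num) (by norm_num)).comp
            (tendsto_atTop_mono (fun n : ℕ => show n ≤ 2 * n + 4 by omega) tendsto_id)
        exact squeeze_zero' (Eventually.of_forall fun n => apply_nonneg _ _)
          ((eventually_ge_atTop k).mono fun n hn => (hm hn _).trans (hys n).le) h0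
      simpa using tendsto_const_nhds.sub hlim

end Series

/-! ### Disked neighbourhoods of zero -/

section LocallyConvex

variable {E : Type*} [AddCommGroup E] [Module ℂ E] [TopologicalSpace E]

theorem withSeminorms_of_basis [IsTopologicalAddGroup E] {P : ℕ → Seminorm ℂ E} (hc : ∀ k, Continuous (P k))
    (h : ∀ U ∈ 𝓝 (0 : E), ∃ k, ∃ r : ℝ, 0 < r ∧ ∀ x, P k x < r → x ∈ U) : WithSeminorms P := by
  refine (SeminormFamily.withSeminorms_iff_nhds_eq_iInf P).2 (le_antisymm ?_ ?_)
  · refine le_iInf fun k => ?_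
    rw [← tendsto_iff_comap]
    simpa using (hc k).tendsto 0
  · intro U hU
    obtain ⟨k, r, hr, hk⟩ := h U hU
    exact mem_iInf_of_mem k ⟨{a | a < r}, gt_mem_nhds hr, hk⟩

/-- The convex hull of the balanced core of a convex neighbourhood stays inside that neighbourhood
and remains balanced. -/
theorem exists_isDisk_nhds [ContinuousSMul ℂ E] [LocallyConvexSpace ℝ E] {U : Set E}
    (hU : U ∈ 𝓝 (0 : E)) : ∃ D ∈ 𝓝 (0 : E), IsDisk D ∧ D ⊆ U := by
  obtain ⟨C, ⟨hC, hCc⟩, hCU⟩ := (LocallyConvexSpace.convex_basis_zero ℝ E).mem_iff.1 hU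
  refine ⟨convexHull ℝ (balancedCore ℂ C), mem_of_superset (balancedCore_mem_nhds_zero hC)
    (subset_convexHull ℝ _), ⟨?_, convex_convexHull ℝ _⟩,
    (convexHull_min (balancedCore_subset C) hCc).trans hCU⟩
  intro a ha
  have h1 : a • convexHull ℝ (balancedCore ℂ C) = convexHull ℝ (a • balancedCore ℂ C) :=
    (LinearMap.image_convexHull ((LinearMap.lsmul ℂ E a).restrictScalars ℝ) _)
  rw [h1]
  exact convexHull_mono (balancedCore_balanced C a ha)

end LocallyConvex

theorem IsDisk.absorbent {E : Type*} [AddCommGroup E] [Module ℂ E] {T : Set E} (hT : IsDisk T)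
    (h : ∀ x, ∃ r : ℝ, 0 < r ∧ x ∈ r • T) : Absorbent ℝ T := fun x => by
  obtain ⟨r, hr, hx⟩ := h x
  filter_upwards [eventually_cobounded_le_norm (E := ℝ) r] with a ha
  exact singleton_subset_iff.2 (hT.smul_subset_smul (by rwa [abs_of_pos hr]) hx)

/-! ### The projective seminorms -/

namespace ProjTensor

variable {V₁ V₂ : Type*} [AddCommGroup V₁] [Module ℂ V₁] [AddCommGroup V₂] [Module ℂ V₂]

theorem induction {C : ProjTensor V₁ V₂ → Prop} (zero : C 0) (mk : ∀ x y, C (mk V₁ V₂ x y))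
    (add : ∀ z w, C z → C w → C (z + w)) (z : ProjTensor V₁ V₂) : C z :=
  TensorProduct.induction_on (motive := C) z zero mk add

/-- Bounds strictly above `p x` and `q y` are positive, so one can rescale even where a seminorm
vanishes. -/
theorem mem_smul_diskedHull (p : Seminorm ℂ V₁) (q : Seminorm ℂ V₂) {x : V₁} {y : V₂} {a b : ℝ}
    (ha : p x < a) (hb : q y < b) :
    mk V₁ V₂ x y ∈ (a * b) • diskedHull (bilinImage (mk V₁ V₂) (p.ball 0 1) (q.ball 0 1)) := by
  have ha0 : 0 < a := (apply_nonneg p x).trans_lt ha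
  have hb0 : 0 < b := (apply_nonneg q y).trans_lt hb
  refine ⟨mk V₁ V₂ ((a : ℂ)⁻¹ • x) ((b : ℂ)⁻¹ • y), subset_diskedHull _ (mem_image2_of_mem ?_ ?_), ?_⟩
  · rw [Seminorm.mem_ball_zero, map_smul_eq_mul, norm_inv, Complex.norm_real,
        Real.norm_of_nonneg ha0.le, inv_mul_lt_iff₀ ha0, mul_one]
    exact ha
  · rw [Seminorm.mem_ball_zero, map_smul_eq_mul, norm_inv, Complex.norm_real,
        Real.norm_of_nonneg hb0.le, inv_mul_lt_iff₀ hb0, mul_one]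
    exact hb
  · have : (a : ℂ) ≠ 0 := by exact_mod_cast ha0.ne'
    have : (b : ℂ) ≠ 0 := by exact_mod_cast hb0.ne'
    simp only [map_smul, LinearMap.smul_apply, ← Complex.coe_smul, smul_smul]
    convert one_smul ℂ _
    push_cast
    field_simp

theorem absorbent_diskedHull (p : Seminorm ℂ V₁) (q : Seminorm ℂ V₂) :
    Absorbent ℝ (diskedHull (bilinImage (mk V₁ V₂) (p.ball 0 1) (q.ball 0 1))) := by
  refine (isDisk_diskedHull _).absorbent fun z => ?_
  induction z using induction with
  | zero =>
    exact ⟨1, one_pos, by simpa using mem_smul_diskedHull p q (x := 0) (y := 0) (a := 1) (b := 1)⟩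
  | mk x y =>
    exact ⟨_, mul_pos ((apply_nonneg p x).trans_lt (lt_add_one _))
      ((apply_nonneg q y).trans_lt (lt_add_one _)),
      mem_smul_diskedHull p q (lt_add_one _) (lt_add_one _)⟩
  | add z w hz hw =>
    obtain ⟨r, hr, hz⟩ := hz
    obtain ⟨s, hs, hw⟩ := hw
    exact ⟨r + s, by positivity, (isDisk_diskedHull _).add_mem_smul hr.le hs.le hz hw⟩

/-- The projective tensor product of two seminorms. -/
def seminorm (p : Seminorm ℂ V₁) (q : Seminorm ℂ V₂) : Seminorm ℂ (ProjTensor V₁ V₂) :=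
  gaugeSeminorm (isDisk_diskedHull _).1 (isDisk_diskedHull _).2 (absorbent_diskedHull p q)

variable {p p' : Seminorm ℂ V₁} {q q' : Seminorm ℂ V₂}

theorem mem_of_seminorm_lt {z : ProjTensor V₁ V₂} {r : ℝ} (h : seminorm p q z < r) :
    z ∈ r • diskedHull (bilinImage (mk V₁ V₂) (p.ball 0 1) (q.ball 0 1)) := by
  obtain ⟨s, hs, hsr, hz⟩ := exists_lt_of_gauge_lt (absorbent_diskedHull p q) h
  exact (isDisk_diskedHull _).smul_mono hs.le hsr.le hz

theorem seminorm_mk_le (x : V₁) (y : V₂) : seminorm p q (mk V₁ V₂ x y) ≤ p x * q y := by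
  have h1 : ∀ n : ℕ, seminorm p q (mk V₁ V₂ x y) ≤ (p x + 1 / (n + 1)) * (q y + 1 / (n + 1)) :=
    fun n => by
      have hn : (0 : ℝ) < 1 / (n + 1) := Nat.one_div_pos_of_nat
      have := apply_nonneg p x
      have := apply_nonneg q y
      exact gauge_le_of_mem (by positivity)
        (mem_smul_diskedHull p q (lt_add_of_pos_right _ hn) (lt_add_of_pos_right _ hn))
  have h2 := tendsto_one_div_add_atTop_nhds_zero_nat (𝕜 := ℝ)
  have h3 := (tendsto_const_nhds (x := p x).add h2).mul (tendsto_const_nhds (x := q y).add h2)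
  simpa using ge_of_tendsto' h3 h1

/-- The closed unit ball of `g` is a disk containing the tensor product of the two unit balls, hence
its disked hull. All later estimates on general tensors are reduced to simple tensors in this way.
-/
theorem le_seminorm (g : Seminorm ℂ (ProjTensor V₁ V₂)) (h : ∀ x y, g (mk V₁ V₂ x y) ≤ p x * q y) :
    g ≤ seminorm p q := fun z => by
  refine le_of_forall_gt_imp_ge_of_dense (fun r hr => ?_)
  have hr0 : 0 < r := (apply_nonneg (seminorm p q) z).trans_lt hr
  have hd : IsDisk {z | g z ≤ 1} := by
    rw [← Seminorm.closedBall_zero_eq]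
    exact ⟨Seminorm.balanced_closedBall_zero _ _, Seminorm.convex_closedBall _ _ _⟩
  obtain ⟨w, hw, hwz⟩ := mem_of_seminorm_lt hr
  have hw1 : g w ≤ 1 := diskedHull_min hd (by
    rintro _ ⟨x, hx, y, hy, rfl⟩
    rw [Seminorm.mem_ball_zero] at hx hy
    exact (h x y).trans (mul_le_one₀ hx.le (apply_nonneg _ _) hy.le)) hw
  rw [← hwz]
  change g (r • w) ≤ r
  rw [Seminorm.map_real_smul, abs_of_pos hr0]
  exact mul_le_of_le_one_right hr0.le hw1

theorem seminorm_mono (hp : p ≤ p') (hq : q ≤ q') : seminorm p q ≤ seminorm p' q' :=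
  le_seminorm _ fun x y => (seminorm_mk_le x y).trans
    (mul_le_mul (hp x) (hq y) (apply_nonneg _ _) (apply_nonneg _ _))

variable [TopologicalSpace V₁] [TopologicalSpace V₂]

theorem continuous_mk : Continuous fun z : V₁ × V₂ => mk V₁ V₂ z.1 z.2 :=
  (projective_mem_admissible V₁ V₂).2.2.2

instance : LocallyConvexSpace ℝ (ProjTensor V₁ V₂) := (projective_mem_admissible V₁ V₂).2.2.1

/-- The projective topology is finer than every admissible one, so it is enough that the topology of
this single seminorm is admissible. Joint continuity of `⊗` comes from `x ⊗ y - x₀ ⊗ y₀ = (x - x₀) ⊗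
y + x₀ ⊗ (y - y₀)`. -/
theorem continuous_seminorm [IsTopologicalAddGroup V₁] [IsTopologicalAddGroup V₂]
    (hp : Continuous p) (hq : Continuous q) :
    Continuous (seminorm p q) := by
  let t : TopologicalSpace (ProjTensor V₁ V₂) :=
    SeminormFamily.moduleFilterBasis (fun _ : Unit => seminorm p q) |>.topology
  have ht : @WithSeminorms ℂ (ProjTensor V₁ V₂) Unit _ _ _ (fun _ => seminorm p q) t :=
    @WithSeminorms.mk _ _ _ _ _ _ _ t rfl
  refine continuous_sInf_dom (t := t) ⟨@WithSeminorms.topologicalAddGroup _ _ _ _ _ _ t _ ht,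
    @WithSeminorms.continuousSMul _ _ _ _ _ _ t _ ht,
    @WithSeminorms.toLocallyConvexSpace _ _ _ _ _ _ _ _ _ t _ ht, ?_⟩
    (@WithSeminorms.continuous_seminorm _ _ _ _ _ _ t _ ht ())
  refine @continuous_iff_continuousAt _ _ _ t _ |>.2 fun z₀ => ?_
  refine (@WithSeminorms.tendsto_nhds _ _ _ _ _ _ _ t _ ht _ _ _).2 fun _ ε hε => ?_
  have h1 : Tendsto (fun z : V₁ × V₂ => p (z.1 - z₀.1) * q z.2 + p z₀.1 * q (z.2 - z₀.2)) (𝓝 z₀)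
      (𝓝 (p (z₀.1 - z₀.1) * q z₀.2 + p z₀.1 * q (z₀.2 - z₀.2))) :=
    Continuous.tendsto (by fun_prop) z₀
  simp only [sub_self, map_zero, zero_mul, mul_zero, add_zero] at h1
  filter_upwards [h1.eventually (gt_mem_nhds hε)] with z hz
  refine lt_of_le_of_lt ?_ hz
  have : mk V₁ V₂ z.1 z.2 - mk V₁ V₂ z₀.1 z₀.2 =
      mk V₁ V₂ (z.1 - z₀.1) z.2 + mk V₁ V₂ z₀.1 (z.2 - z₀.2) := by
    simp
  rw [this]
  exact (map_add_le_add _ _ _).trans (add_le_add (seminorm_mk_le _ _) (seminorm_mk_le _ _))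

/-- By joint continuity a disked neighbourhood contains all `x ⊗ y` with `x`, `y` in balls of radii
`r`, `s`. Being a disk, it contains `r * s` times the disked hull that defines the projective
seminorm. -/
theorem withSeminorms [IsTopologicalAddGroup V₁] [IsTopologicalAddGroup V₂]
    {p : ℕ → Seminorm ℂ V₁} {q : ℕ → Seminorm ℂ V₂} (hp : WithSeminorms p)
    (hq : WithSeminorms q) (hpm : Monotone p) (hqm : Monotone q) :
    WithSeminorms (fun k => seminorm (p k) (q k)) := by
  refine withSeminorms_of_basis (fun k =>
    continuous_seminorm (hp.continuous_seminorm k) (hq.continuous_seminorm k)) fun U hU => ?_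
  obtain ⟨D, hD, hDd, hDU⟩ := exists_isDisk_nhds hU
  have h1 : (fun z : V₁ × V₂ => mk V₁ V₂ z.1 z.2) ⁻¹' D ∈ 𝓝 (0 : V₁ × V₂) :=
    continuous_mk.continuousAt.preimage_mem_nhds (by simpa using hD)
  rw [Prod.zero_eq_mk, nhds_prod_eq, mem_prod_iff] at h1
  obtain ⟨A, hA, B, hB, hAB⟩ := h1
  obtain ⟨k, r, hr, hk⟩ := hp.exists_ball_subset hpm hA
  obtain ⟨l, s, hs, hl⟩ := hq.exists_ball_subset hqm hB
  refine ⟨max k l, r * s, by positivity, fun z hz => hDU ?_⟩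
  obtain ⟨w, hw, rfl⟩ := mem_of_seminorm_lt hz
  refine diskedHull_min (hDd.preimage
    ((((r * s : ℝ) : ℂ) • LinearMap.id : ProjTensor V₁ V₂ →ₗ[ℂ] ProjTensor V₁ V₂))) ?_ hw
  rintro _ ⟨x, hx, y, hy, rfl⟩
  rw [Seminorm.mem_ball_zero] at hx hy
  have := hAB (mk_mem_prod (hk ((r : ℂ) • x) ?_) (hl ((s : ℂ) • y) ?_))
  · simpa [smul_smul, mul_comm, -Complex.coe_smul] using this
  · rw [map_smul_eq_mul, Complex.norm_real, Real.norm_of_nonneg hr.le]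
    exact mul_lt_of_lt_one_right hr ((hpm (le_max_left k l) x).trans_lt hx)
  · rw [map_smul_eq_mul, Complex.norm_real, Real.norm_of_nonneg hs.le]
    exact mul_lt_of_lt_one_right hs ((hqm (le_max_right k l) y).trans_lt hy)

end ProjTensor

/-! ### Seminorms on completions -/

section Completion

open UniformSpace

variable {E : Type*} [AddCommGroup E] [Module ℂ E] [UniformSpace E] [IsUniformAddGroup E]
  [UniformContinuousConstSMul ℂ E]

theorem Seminorm.uniformContinuous_of_continuous {E : Type*} [AddCommGroup E] [Module ℂ E]
    [UniformSpace E] [IsUniformAddGroup E] {p : Seminorm ℂ E} (hp : Continuous p) :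
    UniformContinuous p :=
  Seminorm.uniformContinuous_of_continuousAt_zero hp.continuousAt

/-- The extension of a continuous seminorm to the completion. -/
def Seminorm.completion (p : Seminorm ℂ E) (hp : Continuous p) : Seminorm ℂ (Completion E) :=
  Seminorm.of (Completion.extension p)
    (fun x y => by
      refine Completion.induction_on₂ x y ?_ fun x y => ?_
      · exact isClosed_le (Completion.continuous_extension.comp continuous_add)
          ((Completion.continuous_extension.comp continuous_fst).add
            (Completion.continuous_extension.comp continuous_snd))
      · have h := Completion.extension_coe (Seminorm.uniformContinuous_of_continuous hp)
        rw [← Completion.coe_add, h, h, h]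
        exact map_add_le_add p x y)
    (fun a x => by
      refine Completion.induction_on x ?_ fun x => ?_
      · exact isClosed_eq (Completion.continuous_extension.comp (continuous_const_smul a))
          (continuous_const.mul Completion.continuous_extension)
      · have h := Completion.extension_coe (Seminorm.uniformContinuous_of_continuous hp)
        rw [← Completion.coe_smul, h, h, map_smul_eq_mul])

theorem Seminorm.completion_coe {p : Seminorm ℂ E} (hp : Continuous p) (x : E) :
    p.completion hp (x : Completion E) = p x :=
  Completion.extension_coe (Seminorm.uniformContinuous_of_continuous hp) x

theorem Seminorm.continuous_completion {p : Seminorm ℂ E} (hp : Continuous p) :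
    Continuous (p.completion hp) := Completion.continuous_extension

theorem Seminorm.le_completion {p : Seminorm ℂ E} (hp : Continuous p)
    {g : Seminorm ℂ (Completion E)} (hg : Continuous g) (h : ∀ x : E, g x ≤ p x) :
    g ≤ p.completion hp := fun x => by
  induction x using Completion.induction_on with
  | hp => exact isClosed_le hg (Seminorm.continuous_completion hp)
  | ih x => exact (h x).trans_eq (Seminorm.completion_coe hp x).symm

/-- Neighbourhoods may be taken closed, and an open ball of an extended seminorm lies in the closure
of its trace on the dense subspace. -/
theorem WithSeminorms.completion {P : ℕ → Seminorm ℂ E} (hP : WithSeminorms P) (hm : Monotone P) :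
    WithSeminorms fun k => (P k).completion (hP.continuous_seminorm k) := by
  refine withSeminorms_of_basis (fun k => Seminorm.continuous_completion _) fun U hU => ?_
  obtain ⟨C, hC, hCc, hCU⟩ := exists_mem_nhds_isClosed_subset hU
  have h1 : (fun x : E => (x : Completion E)) ⁻¹' C ∈ 𝓝 (0 : E) :=
    (Completion.continuous_coe E).continuousAt.preimage_mem_nhds (by simpa [Completion.coe_zero] using hC)
  obtain ⟨k, r, hr, hk⟩ := hP.exists_ball_subset hm h1
  refine ⟨k, r, hr, fun x hx => hCU ?_⟩
  have hop : IsOpen {x | (P k).completion (hP.continuous_seminorm k) x < r} :=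
    isOpen_lt (Seminorm.continuous_completion _) continuous_const
  refine closure_minimal ?_ hCc (Completion.denseRange_coe.open_subset_closure_inter hop hx)
  rintro _ ⟨hy, y, rfl⟩
  rw [mem_ofPred_eq, Seminorm.completion_coe] at hy
  exact hk y hy

end Completion

/-! ### The completed projective tensor product -/

namespace CompletedProjTensor

variable {V₁ V₂ : Type*} [AddCommGroup V₁] [Module ℂ V₁] [AddCommGroup V₂] [Module ℂ V₂]
  [TopologicalSpace V₁] [TopologicalSpace V₂]

theorem denseRange_incl : DenseRange (incl V₁ V₂) := UniformSpace.Completion.denseRange_coe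

theorem continuous_natural : Continuous fun z : V₁ × V₂ => natural V₁ V₂ z.1 z.2 :=
  (UniformSpace.Completion.continuous_coe _).comp ProjTensor.continuous_mk

theorem map_ext {G : Type*} [AddCommGroup G] [Module ℂ G] [TopologicalSpace G] [T2Space G]
    {f g : CompletedProjTensor V₁ V₂ →L[ℂ] G}
    (h : ∀ x y, f (natural V₁ V₂ x y) = g (natural V₁ V₂ x y)) : f = g := by
  refine DFunLike.coe_injective (denseRange_incl.equalizer f.continuous g.continuous ?_)
  ext z
  induction z using ProjTensor.induction with
  | zero => simp
  | mk x y => exact h x y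
  | add z w hz hw =>
    simp only [Function.comp_apply, map_add] at hz hw ⊢
    rw [hz, hw]

/-- A continuous bilinear map into a Fréchet space extends to the completed tensor product. -/
theorem exists_lift {G : Type*} [AddCommGroup G] [Module ℂ G] [UniformSpace G]
    [IsUniformAddGroup G] [ContinuousSMul ℂ G] [LocallyConvexSpace ℝ G] [T2Space G]
    [CompleteSpace G] (b : V₁ →ₗ[ℂ] V₂ →ₗ[ℂ] G) (hb : Continuous fun z : V₁ × V₂ => b z.1 z.2) :
    ∃ B : CompletedProjTensor V₁ V₂ →L[ℂ] G, ∀ x y, B (natural V₁ V₂ x y) = b x y := by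
  let b' : ProjTensor V₁ V₂ →ₗ[ℂ] G := TensorProduct.lift b
  have hb' : ∀ x y, b' (ProjTensor.mk V₁ V₂ x y) = b x y := fun x y => TensorProduct.lift.tmul x y
  have hc : Continuous b' := by
    -- The topology pulled back along `b'` is admissible, so the projective topology is finer.
    refine continuous_sInf_dom (t := TopologicalSpace.induced b' inferInstance)
      ⟨topologicalAddGroup_induced b', continuousSMul_induced b',
        LocallyConvexSpace.induced (b'.restrictScalars ℝ), ?_⟩ continuous_induced_dom
    refine continuous_induced_rng.2 ?_
    simpa only [Function.comp_def, hb'] using hb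
  let i : ProjTensor V₁ V₂ →L[ℂ] CompletedProjTensor V₁ V₂ :=
    ⟨incl V₁ V₂, UniformSpace.Completion.continuous_coe _⟩
  refine ⟨ContinuousLinearMap.extend ⟨b', hc⟩ i, fun x y => ?_⟩
  exact (ContinuousLinearMap.extend_eq (e := i) ⟨b', hc⟩ denseRange_incl
    (UniformSpace.Completion.isUniformInducing_coe _) _).trans (hb' x y)

variable [IsTopologicalAddGroup V₁] [IsTopologicalAddGroup V₂]

/-- The projective tensor product of two continuous seminorms on the completed tensor product. -/
def seminorm {p : Seminorm ℂ V₁} {q : Seminorm ℂ V₂} (hp : Continuous p) (hq : Continuous q) :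
    Seminorm ℂ (CompletedProjTensor V₁ V₂) :=
  (ProjTensor.seminorm p q).completion (ProjTensor.continuous_seminorm hp hq)

variable {p p' : Seminorm ℂ V₁} {q q' : Seminorm ℂ V₂} (hp : Continuous p) (hq : Continuous q)
  (hp' : Continuous p') (hq' : Continuous q')

theorem seminorm_incl (z : ProjTensor V₁ V₂) :
    seminorm hp hq (incl V₁ V₂ z) = ProjTensor.seminorm p q z := Seminorm.completion_coe _ z

theorem seminorm_natural_le (x : V₁) (y : V₂) :
    seminorm hp hq (natural V₁ V₂ x y) ≤ p x * q y :=
  (seminorm_incl hp hq _).trans_le (ProjTensor.seminorm_mk_le x y)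

theorem continuous_seminorm : Continuous (seminorm hp hq) := Seminorm.continuous_completion _

theorem le_seminorm {g : Seminorm ℂ (CompletedProjTensor V₁ V₂)} (hg : Continuous g)
    (h : ∀ x y, g (natural V₁ V₂ x y) ≤ p x * q y) : g ≤ seminorm hp hq :=
  Seminorm.le_completion _ hg (ProjTensor.le_seminorm (g.comp (incl V₁ V₂)) h)

theorem seminorm_mono (h : p ≤ p') (h' : q ≤ q') : seminorm hp hq ≤ seminorm hp' hq' :=
  le_seminorm _ _ (continuous_seminorm hp hq) fun x y => (seminorm_natural_le hp hq x y).trans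
    (mul_le_mul (h x) (h' y) (apply_nonneg _ _) (apply_nonneg _ _))

theorem withSeminorms {p : ℕ → Seminorm ℂ V₁} {q : ℕ → Seminorm ℂ V₂} (hp : WithSeminorms p)
    (hq : WithSeminorms q) (hpm : Monotone p) (hqm : Monotone q) :
    WithSeminorms fun k => seminorm (hp.continuous_seminorm k) (hq.continuous_seminorm k) :=
  (ProjTensor.withSeminorms hp hq hpm hqm).completion
    fun _ _ h => ProjTensor.seminorm_mono (hpm h) (hqm h)

end CompletedProjTensor

/-! ### Finite and precompact sets whose hulls contain given tensors -/

section FiniteSubsets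

variable {V₁ V₂ T : Type*} [AddCommGroup V₁] [Module ℂ V₁] [AddCommGroup V₂] [Module ℂ V₂]
  [AddCommGroup T] [Module ℂ T]

theorem bilinImage_mono (b : V₁ →ₗ[ℂ] V₂ →ₗ[ℂ] T) {A A' : Set V₁} {B B' : Set V₂} (hA : A ⊆ A')
    (hB : B ⊆ B') : bilinImage b A B ⊆ bilinImage b A' B' := image2_subset hA hB

/-- The union of the hulls over finite `A'`, `B'` is directed, hence itself a disk. -/
theorem exists_finite_mem_diskedHull (b : V₁ →ₗ[ℂ] V₂ →ₗ[ℂ] T) {A : Set V₁} {B : Set V₂} {z : T}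
    (hz : z ∈ diskedHull (bilinImage b A B)) : ∃ A' ⊆ A, ∃ B' ⊆ B, A'.Finite ∧ B'.Finite ∧
      z ∈ diskedHull (bilinImage b A' B') := by
  refine diskedHull_min (T := {z | ∃ A' ⊆ A, ∃ B' ⊆ B, A'.Finite ∧ B'.Finite ∧
      z ∈ diskedHull (bilinImage b A' B')}) ⟨?_, ?_⟩ ?_ hz
  · rintro a ha _ ⟨z, ⟨A', hA, B', hB, hAf, hBf, h⟩, rfl⟩
    exact ⟨A', hA, B', hB, hAf, hBf, (isDisk_diskedHull _).smul_mem ha h⟩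
  · rintro z ⟨A', hA, B', hB, hAf, hBf, h⟩ w ⟨A'', hA', B'', hB', hAf', hBf', h'⟩ s t hs ht hst
    exact ⟨A' ∪ A'', union_subset hA hA', B' ∪ B'', union_subset hB hB', hAf.union hAf',
      hBf.union hBf', (isDisk_diskedHull _).2
        (diskedHull_mono (bilinImage_mono b subset_union_left subset_union_left) h)
        (diskedHull_mono (bilinImage_mono b subset_union_right subset_union_right) h') hs ht hst⟩
  · rintro _ ⟨x, hx, y, hy, rfl⟩
    exact ⟨{x}, singleton_subset_iff.2 hx, {y}, singleton_subset_iff.2 hy, finite_singleton x,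
      finite_singleton y, subset_diskedHull _ (mem_image2_of_mem rfl rfl)⟩

end FiniteSubsets

namespace ProjTensor

variable {V₁ V₂ : Type*} [AddCommGroup V₁] [Module ℂ V₁] [AddCommGroup V₂] [Module ℂ V₂]

/-- Smallness is split evenly between the two factors, so that both tend to zero with the seminorm
of the tensor. -/
theorem exists_finite_of_seminorm_lt {p : Seminorm ℂ V₁} {q : Seminorm ℂ V₂}
    {z : ProjTensor V₁ V₂} {c : ℝ} (hc : 0 < c) (h : seminorm p q z < c * c) :
    ∃ (A : Set V₁) (B : Set V₂), A.Finite ∧ B.Finite ∧ (∀ x ∈ A, p x ≤ c) ∧ (∀ y ∈ B, q y ≤ c) ∧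
      z ∈ diskedHull (bilinImage (mk V₁ V₂) A B) := by
  obtain ⟨w, hw, hwz⟩ := mem_of_seminorm_lt h
  obtain ⟨A, hA, B, hB, hAf, hBf, hw⟩ := exists_finite_mem_diskedHull _ hw
  refine ⟨(fun x => (c : ℂ) • x) '' A, (fun x => (c : ℂ) • x) '' B, hAf.image _, hBf.image _, ?_, ?_, ?_⟩
  · rintro _ ⟨x, hx, rfl⟩
    have := hA hx
    rw [Seminorm.mem_ball_zero] at this
    rw [map_smul_eq_mul, Complex.norm_real, Real.norm_of_nonneg hc.le]
    exact mul_le_of_le_one_right hc.le this.le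
  · rintro _ ⟨x, hx, rfl⟩
    have := hB hx
    rw [Seminorm.mem_ball_zero] at this
    rw [map_smul_eq_mul, Complex.norm_real, Real.norm_of_nonneg hc.le]
    exact mul_le_of_le_one_right hc.le this.le
  · have h1 := diskedHull_min ((isDisk_diskedHull (bilinImage (mk V₁ V₂)
      ((fun x => (c : ℂ) • x) '' A) ((fun x => (c : ℂ) • x) '' B))).preimage
      ((((c * c : ℝ) : ℂ) • LinearMap.id : ProjTensor V₁ V₂ →ₗ[ℂ] ProjTensor V₁ V₂))) (by
        rintro _ ⟨x, hx, y, hy, rfl⟩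
        refine subset_diskedHull _ ⟨_, mem_image_of_mem _ hx, _, mem_image_of_mem _ hy, ?_⟩
        simp [smul_smul, -Complex.coe_smul]) hw
    rw [← hwz]
    simpa only [mem_preimage, LinearMap.smul_apply, LinearMap.id_apply, Complex.coe_smul] using h1

/-- Finite sets of tensors tending to zero lie in the disked hull of the tensor product of two
precompact sets. -/
theorem exists_totallyBounded {V₁ V₂ : Type*} [AddCommGroup V₁] [Module ℂ V₁] [AddCommGroup V₂]
    [Module ℂ V₂] [UniformSpace V₁] [UniformSpace V₂]
    [IsUniformAddGroup V₁] [IsUniformAddGroup V₂] {p : ℕ → Seminorm ℂ V₁} {q : ℕ → Seminorm ℂ V₂}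
    (hp : WithSeminorms p) (hq : WithSeminorms q) (hpm : Monotone p) (hqm : Monotone q)
    {F : ℕ → Set (ProjTensor V₁ V₂)} (hF : ∀ n, (F n).Finite)
    (h : ∀ n, ∀ a ∈ F (n + 1), seminorm (p n) (q n) a ≤ (1 / 2) ^ n) :
    ∃ A B, TotallyBounded A ∧ TotallyBounded B ∧
      ∀ n, F n ⊆ diskedHull (bilinImage (mk V₁ V₂) A B) := by
  -- The square root splits `2⁻ⁿ` between the factors; the additional `2` turns `≤` into `<`.
  set ρ : ℕ → ℝ := fun n => √(2 * (1 / 2) ^ n)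
  have hρ0 : ∀ n, 0 < ρ n := fun n => Real.sqrt_pos.2 (by positivity)
  have hρ2 : ∀ n, ρ n * ρ n = 2 * (1 / 2) ^ n := fun n => Real.mul_self_sqrt (by positivity)
  have hρ : Tendsto ρ atTop (𝓝 0) := by
    have h1 : Tendsto (fun n : ℕ => 2 * (1 / 2 : ℝ) ^ n) atTop (𝓝 (2 * 0)) :=
      (tendsto_pow_atTop_nhds_zero_of_lt_one (by norm_num) (by norm_num)).const_mul 2
    simpa only [mul_zero, Real.sqrt_zero] using h1.sqrt
  -- The elements of `F 0` carry no bound, but they contribute only finitely many vectors.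
  have h0 : ∀ a : ProjTensor V₁ V₂, ∃ (A : Set V₁) (B : Set V₂), A.Finite ∧ B.Finite ∧
      a ∈ diskedHull (bilinImage (mk V₁ V₂) A B) := fun a => by
    have ha := apply_nonneg (seminorm (p 0) (q 0)) a
    obtain ⟨A, B, hA, hB, -, -, hz⟩ := exists_finite_of_seminorm_lt (p := p 0) (q := q 0) (z := a)
      (c := seminorm (p 0) (q 0) a + 1) (by positivity) (by nlinarith)
    exact ⟨A, B, hA, hB, hz⟩
  have h1 : ∀ n a, ∃ (A : Set V₁) (B : Set V₂), a ∈ F (n + 1) → A.Finite ∧ B.Finite ∧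
      (∀ x ∈ A, p n x ≤ ρ n) ∧ (∀ y ∈ B, q n y ≤ ρ n) ∧
      a ∈ diskedHull (bilinImage (mk V₁ V₂) A B) := fun n a => by
    by_cases ha : a ∈ F (n + 1)
    · obtain ⟨A, B, hAB⟩ := exists_finite_of_seminorm_lt (p := p n) (q := q n) (z := a) (hρ0 n)
        ((h n a ha).trans_lt (by
          rw [hρ2]; linarith [show (0 : ℝ) < (1 / 2) ^ n by positivity]))
      exact ⟨A, B, fun _ => hAB⟩
    · exact ⟨∅, ∅, fun h => absurd h ha⟩
  choose A₀ B₀ hA₀ hB₀ h0 using h0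
  choose A B h1 using h1
  refine ⟨(⋃ n, ⋃ a ∈ F (n + 1), A n a) ∪ ⋃ a ∈ F 0, A₀ a,
    (⋃ n, ⋃ a ∈ F (n + 1), B n a) ∪ ⋃ a ∈ F 0, B₀ a, ?_, ?_, ?_⟩
  · refine (totallyBounded_iUnion_finite hp hpm
      (fun n => (hF (n + 1)).biUnion fun a ha => (h1 n a ha).1) hρ ?_).union
      ((hF 0).biUnion fun a _ => hA₀ a).totallyBounded
    refine Eventually.of_forall fun n x hx => ?_
    obtain ⟨a, ha, hx⟩ := mem_iUnion₂.1 hx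
    exact (h1 n a ha).2.2.1 x hx
  · refine (totallyBounded_iUnion_finite hq hqm
      (fun n => (hF (n + 1)).biUnion fun a ha => (h1 n a ha).2.1) hρ ?_).union
      ((hF 0).biUnion fun a _ => hB₀ a).totallyBounded
    refine Eventually.of_forall fun n x hx => ?_
    obtain ⟨a, ha, hx⟩ := mem_iUnion₂.1 hx
    exact (h1 n a ha).2.2.2.1 x hx
  · rintro (_ | n) a ha
    · exact diskedHull_mono (bilinImage_mono _
        (fun x hx => Or.inr (mem_biUnion ha hx)) fun x hx => Or.inr (mem_biUnion ha hx)) (h0 a)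
    · exact diskedHull_mono (bilinImage_mono _
        (fun x hx => Or.inl (mem_iUnion.2 ⟨n, mem_biUnion ha hx⟩))
        fun x hx => Or.inl (mem_iUnion.2 ⟨n, mem_biUnion ha hx⟩)) (h1 n a ha).2.2.2.2

end ProjTensor

/-! ### Extension of bounded maps from a dense subspace -/

section Bornology

variable {W : Type*} [AddCommGroup W] [Module ℂ W] {𝔚 : Set (Set W)} {T₁ T₂ : Set W}

theorem IsConvexBornology.union_mem (h𝔚 : IsConvexBornology 𝔚) (h₁ : T₁ ∈ 𝔚) (h₂ : T₂ ∈ 𝔚) :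
    T₁ ∪ T₂ ∈ 𝔚 := by
  rcases T₁.eq_empty_or_nonempty with rfl | n₁
  · simpa using h₂
  rcases T₂.eq_empty_or_nonempty with rfl | n₂
  · simpa using h₁
  refine h𝔚.subset_mem _ (h𝔚.add_mem _ (h𝔚.diskedHull_mem _ h₁) _ (h𝔚.diskedHull_mem _ h₂)) _ ?_
  have z₁ := (isDisk_diskedHull T₁).zero_mem (n₁.mono (subset_diskedHull T₁))
  have z₂ := (isDisk_diskedHull T₂).zero_mem (n₂.mono (subset_diskedHull T₂))
  rintro x (hx | hx)
  · exact ⟨x, subset_diskedHull _ hx, 0, z₂, add_zero x⟩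
  · exact ⟨0, z₁, x, subset_diskedHull _ hx, zero_add x⟩

theorem IsCompleteBornology.exists_union (h𝔚 : IsCompleteBornology 𝔚) (h₁ : T₁ ∈ 𝔚)
    (h₂ : T₂ ∈ 𝔚) : ∃ T ∈ 𝔚, IsCompletantDisk T ∧ T₁ ⊆ T ∧ T₂ ⊆ T := by
  obtain ⟨T, hT, hsub, hc⟩ := h𝔚.completant _ (h𝔚.isConvexBornology.union_mem h₁ h₂)
  exact ⟨T, hT, hc, subset_union_left.trans hsub, subset_union_right.trans hsub⟩

end Bornology

section Extension

variable {X₀ X W : Type*} [AddCommGroup X₀] [Module ℂ X₀] [AddCommGroup X] [Module ℂ X]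
  [AddCommGroup W] [Module ℂ W] {𝔚 : Set (Set W)} {P : ℕ → Seminorm ℂ X} {i : X₀ →ₗ[ℂ] X}
  {c : X₀ →ₗ[ℂ] W}

/-- `c` maps every sequence of finite sets that tends to zero, for the seminorms `P` transported
along `i`, into a single small set. -/
def BoundedOnNull (P : ℕ → Seminorm ℂ X) (i : X₀ →ₗ[ℂ] X) (𝔚 : Set (Set W)) (c : X₀ →ₗ[ℂ] W) :
    Prop :=
  ∀ F : ℕ → Set X₀, (∀ n, (F n).Finite) → (∀ n, ∀ a ∈ F (n + 1), P n (i a) ≤ (1 / 2) ^ n) →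
    ∃ T ∈ 𝔚, ∀ n, ∀ a ∈ F n, c a ∈ T

/-- After passing to a subsequence, `2ⁿ • t` is still null, so its image lies in one small disk;
dividing by `2ⁿ` gives gauge convergence. -/
theorem BoundedOnNull.exists_gaugeTendsto (hc : BoundedOnNull P i 𝔚 c)
    (h𝔚 : IsCompleteBornology 𝔚)
    {t : ℕ → X₀} (ht : ∀ k, Tendsto (fun n => P k (i (t n))) atTop (𝓝 0)) :
    ∃ φ : ℕ → ℕ, StrictMono φ ∧ ∃ T ∈ 𝔚, GaugeTendsto T (fun n => c (t (φ n))) 0 := by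
  obtain ⟨φ, hφ, h⟩ := exists_subseq_totallyBounded ht
  -- The empty set at index `0` realizes the shift between `F (n + 1)` and `P n`.
  obtain ⟨T, hT, hcT⟩ := hc (fun n => Nat.casesOn n ∅ fun n => {(2 : ℂ) ^ n • t (φ n)})
    (by rintro (_ | n) <;> simp) (by
      rintro n a rfl
      simpa using h n)
  obtain ⟨T', hT', hTT', hd⟩ := h𝔚.completant T hT
  refine ⟨φ, hφ, T', hT', fun ε hε => ?_⟩
  have h0 : Tendsto (fun n : ℕ => (1 / 2 : ℝ) ^ n) atTop (𝓝 0) :=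
    tendsto_pow_atTop_nhds_zero_of_lt_one (by norm_num) (by norm_num)
  filter_upwards [h0.eventually (gt_mem_nhds hε)] with n hn
  refine hd.isDisk.smul_mono (by positivity) hn.le ⟨_, hTT' (hcT (n + 1) _ rfl), ?_⟩
  simp only [← Complex.coe_smul, map_smul, smul_smul, sub_zero]
  push_cast
  rw [← mul_pow]
  norm_num

variable [UniformSpace X] [IsUniformAddGroup X]

theorem IsBoundedLin.boundedOnNull {f : X →ₗ[ℂ] W}
    (hf : IsBoundedLin (precompactBornology X) 𝔚 f) (hP : WithSeminorms P) (hm : Monotone P) :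
    BoundedOnNull P LinearMap.id 𝔚 f := fun F hF h => by
  refine ⟨_, hf ((⋃ n, F (n + 1)) ∪ F 0) ?_, ?_⟩
  · refine (totallyBounded_iUnion_finite hP hm (fun n => hF (n + 1))
      (tendsto_pow_atTop_nhds_zero_of_lt_one (r := (1 / 2 : ℝ)) (by norm_num) (by norm_num))
      (Eventually.of_forall fun n => h n)).union (hF 0).totallyBounded
  · rintro (_ | n) a ha
    · exact mem_image_of_mem f (Or.inr ha)
    · exact mem_image_of_mem f (Or.inl (mem_iUnion.2 ⟨n, ha⟩))

theorem tendsto_seminorm_sub (hP : WithSeminorms P) {u : ℕ → X} {x : X}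
    (h : Tendsto u atTop (𝓝 x)) (k : ℕ) : Tendsto (fun n => P k (u n - x)) atTop (𝓝 0) :=
  hP.tendsto_zero_iff.1 (tendsto_sub_nhds_zero_iff.2 h) k

/-- Two bounded maps that agree on a dense subspace are equal. -/
theorem eq_of_isBoundedLin_of_dense (hP : WithSeminorms P) (hm : Monotone P) (hi : DenseRange i)
    (h𝔚 : IsCompleteBornology 𝔚) {f g : X →ₗ[ℂ] W}
    (hf : IsBoundedLin (precompactBornology X) 𝔚 f)
    (hg : IsBoundedLin (precompactBornology X) 𝔚 g) (h : ∀ z, f (i z) = g (i z)) : f = g := by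
  have := hP.firstCountableTopology
  ext x
  obtain ⟨t, ht⟩ := mem_closure_iff_seq_limit.1 (hi x)
  choose ht' htx using ht
  choose z hz using ht'
  have h0 := tendsto_seminorm_sub hP htx
  obtain ⟨φ, hφ, T₁, hT₁, h₁⟩ := (hf.boundedOnNull hP hm).exists_gaugeTendsto h𝔚
    (t := fun n => t n - x) h0
  obtain ⟨ψ, hψ, T₂, hT₂, h₂⟩ := (hg.boundedOnNull hP hm).exists_gaugeTendsto h𝔚
    (t := fun n => t (φ n) - x) fun k => (h0 k).comp hφ.tendsto_atTop
  obtain ⟨T, -, hT, hT₁T, hT₂T⟩ := h𝔚.exists_union hT₁ hT₂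
  -- Along the common subsequence `f` and `g` agree on the approximants, so the difference of the
  -- two null sequences is the constant `g x - f x`.
  have h₃ := ((h₁.comp hψ.tendsto_atTop).mono hT₁T).sub hT.isDisk (h₂.mono hT₂T)
  simp only [Function.comp_apply, map_sub, ← hz, h, sub_sub_sub_cancel_left, sub_self] at h₃
  have h₄ : GaugeTendsto T (fun _ => g x - f x) (g x - f x) := fun ε hε =>
    Eventually.of_forall fun _ => by
      rw [sub_self]
      obtain ⟨n, hn⟩ := (h₃ ε hε).exists
      exact (hT.isDisk.real_smul ε).zero_mem ⟨_, hn⟩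
  exact (sub_eq_zero.1 (GaugeTendsto.unique hT h₄ h₃)).symm

/-- The graph of the extension of `c` to the completion. -/
def ExtensionRel {X : Type*} [AddCommGroup X] [Module ℂ X] [TopologicalSpace X] (i : X₀ →ₗ[ℂ] X) (𝔚 : Set (Set W)) (c : X₀ →ₗ[ℂ] W) (x : X) (w : W) : Prop :=
  ∃ t : ℕ → X₀, Tendsto (fun n => i (t n)) atTop (𝓝 x) ∧
    ∃ T ∈ 𝔚, GaugeTendsto T (fun n => c (t n)) w

/-- The difference of two approximating sequences is null in `X`, so a subsequence of its image
tends to `0`, while the full image sequence tends to `w - w'`. -/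
theorem ExtensionRel.unique (hP : WithSeminorms P) (h𝔚 : IsCompleteBornology 𝔚)
    (hc : BoundedOnNull P i 𝔚 c) {x : X} {w w' : W} (h : ExtensionRel i 𝔚 c x w)
    (h' : ExtensionRel i 𝔚 c x w') : w = w' := by
  obtain ⟨t, ht, T₁, hT₁, h₁⟩ := h
  obtain ⟨t', ht', T₂, hT₂, h₂⟩ := h'
  have h0 : Tendsto (fun n => i (t n - t' n)) atTop (𝓝 0) := by
    simpa using ht.sub ht'
  obtain ⟨φ, hφ, T₃, hT₃, h₃⟩ := hc.exists_gaugeTendsto h𝔚 (hP.tendsto_zero_iff.1 h0)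
  obtain ⟨T₄, hT₄, -, h14, h24⟩ := h𝔚.exists_union hT₁ hT₂
  obtain ⟨T, hT, hd, h4, h3⟩ := h𝔚.exists_union hT₄ hT₃
  have h₄ := ((h₁.mono (h14.trans h4)).sub hd.isDisk (h₂.mono (h24.trans h4))).comp hφ.tendsto_atTop
  have h₅ := h₃.mono h3
  simp only [Function.comp_def, ← map_sub] at h₄
  exact sub_eq_zero.1 (GaugeTendsto.unique hd h₄ h₅)

theorem ExtensionRel.add (h𝔚 : IsCompleteBornology 𝔚) {x x' : X} {w w' : W}
    (h : ExtensionRel i 𝔚 c x w) (h' : ExtensionRel i 𝔚 c x' w') :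
    ExtensionRel i 𝔚 c (x + x') (w + w') := by
  obtain ⟨t, ht, T₁, hT₁, h₁⟩ := h
  obtain ⟨t', ht', T₂, hT₂, h₂⟩ := h'
  obtain ⟨T, hT, hd, h1, h2⟩ := h𝔚.exists_union hT₁ hT₂
  refine ⟨fun n => t n + t' n, ?_, T, hT, ?_⟩
  · simpa using ht.add ht'
  · simpa using (h₁.mono h1).add hd.isDisk (h₂.mono h2)

theorem ExtensionRel.smul {X : Type*} [AddCommGroup X] [Module ℂ X] [TopologicalSpace X]
    [ContinuousSMul ℂ X] {i : X₀ →ₗ[ℂ] X} (h𝔚 : IsCompleteBornology 𝔚) {x : X} {w : W}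
    (h : ExtensionRel i 𝔚 c x w) (a : ℂ) : ExtensionRel i 𝔚 c (a • x) (a • w) := by
  obtain ⟨t, ht, T₁, hT₁, h₁⟩ := h
  obtain ⟨T, hT, h1, hd⟩ := h𝔚.completant _ hT₁
  refine ⟨fun n => a • t n, ?_, T, hT, ?_⟩
  · simpa using ht.const_smul a
  · simpa using (h₁.mono h1).smul hd.isDisk a

theorem summable_half_pow : Summable (fun n : ℕ => (1 / 2 : ℝ) ^ (n + 2)) ∧
    ∑' n : ℕ, (1 / 2 : ℝ) ^ (n + 2) < 1 := by
  have h : HasSum (fun n : ℕ => (1 / 2 : ℝ) ^ (n + 2)) (2 * (1 / 2) ^ 2) := by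
    simpa only [pow_add] using hasSum_geometric_two.mul_right ((1 / 2 : ℝ) ^ 2)
  exact ⟨h.summable, by rw [h.tsum_eq]; norm_num⟩

/-- One disk `T` serves all of `S`, because the finite sets in the series representation depend only
on `S`. This gives boundedness of the extension along with its existence. -/
theorem BoundedOnNull.exists_extensionRel (hP : WithSeminorms P) (hm : Monotone P)
    (hi : DenseRange i) (h𝔚 : IsCompleteBornology 𝔚) (hc : BoundedOnNull P i 𝔚 c) {S : Set X}
    (hS : TotallyBounded S) : ∃ T ∈ 𝔚, ∀ x ∈ S, ∃ w ∈ T, ExtensionRel i 𝔚 c x w := by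
  obtain ⟨F, hF, hF', hS⟩ := hS.exists_series hi hP hm
  obtain ⟨T₀, hT₀, hc⟩ := hc F hF hF'
  obtain ⟨T, hT, hsub, hd⟩ := h𝔚.completant _ hT₀
  refine ⟨T, hT, fun x hx => ?_⟩
  obtain ⟨a, ha, hax⟩ := hS x hx
  obtain ⟨w, hw, hlim⟩ := hd.exists_gaugeTendsto_sum (l := fun n => (1 / 2) ^ (n + 2))
    (fun n => by positivity) summable_half_pow.1 summable_half_pow.2
    (v := fun n => (1 / 2 : ℝ) ^ (n + 2) • c (a n)) fun n => ⟨_, hsub (hc n _ (ha n)), rfl⟩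
  refine ⟨w, hw, fun N => ∑ n ∈ Finset.range N, (1 / 2 : ℝ) ^ (n + 2) • a n, ?_, T, hT, ?_⟩
  · simpa only [map_sum, LinearMap.map_smul_of_tower] using hax
  · simpa only [map_sum, LinearMap.map_smul_of_tower] using hlim

theorem BoundedOnNull.exists_extension [ContinuousSMul ℂ X] (hP : WithSeminorms P)
    (hm : Monotone P) (hi : DenseRange i) (h𝔚 : IsCompleteBornology 𝔚)
    (hc : BoundedOnNull P i 𝔚 c) :
    ∃ f : X →ₗ[ℂ] W, IsBoundedLin (precompactBornology X) 𝔚 f ∧ ∀ z, f (i z) = c z := by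
  have h1 : ∀ x, ∃ w, ExtensionRel i 𝔚 c x w := fun x => by
    obtain ⟨T, -, h⟩ := hc.exists_extensionRel hP hm hi h𝔚 (totallyBounded_singleton x)
    obtain ⟨w, -, h⟩ := h x rfl
    exact ⟨w, h⟩
  choose f hf using h1
  refine ⟨⟨⟨f, fun x y => (hf _).unique hP h𝔚 hc ((hf x).add h𝔚 (hf y))⟩,
    fun a x => (hf _).unique hP h𝔚 hc ((hf x).smul h𝔚 a)⟩, fun S hS => ?_, fun z => ?_⟩
  · obtain ⟨T, hT, h⟩ := hc.exists_extensionRel hP hm hi h𝔚 hS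
    refine h𝔚.isConvexBornology.subset_mem T hT _ ?_
    rintro _ ⟨x, hx, rfl⟩
    obtain ⟨w, hw, hxw⟩ := h x hx
    rwa [← (hf x).unique hP h𝔚 hc hxw] at hw
  · refine (hf _).unique hP h𝔚 hc ⟨fun _ => z, tendsto_const_nhds, {0},
      h𝔚.isConvexBornology.singleton_mem 0, fun ε hε => Eventually.of_forall fun _ => ?_⟩
    simp

/-- The preimage of a completant disk under a bounded map, cut down to a completant disk. -/
theorem IsBoundedLin.isCompletantDisk_inter {f : X →ₗ[ℂ] W}
    (hf : IsBoundedLin (precompactBornology X) 𝔚 f) (hP : WithSeminorms P) (hm : Monotone P)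
    (h𝔚 : IsCompleteBornology 𝔚) {H : Set X} {T : Set W} (hH : IsCompletantDisk H)
    (hHb : H ∈ boundedBornology X) (hT : T ∈ 𝔚) (hTc : IsCompletantDisk T) :
    IsCompletantDisk (H ∩ f ⁻¹' T) := by
  refine hH.of_subset (hH.isDisk.inter (hTc.isDisk.preimage f)) inter_subset_left
    fun u x hu hx => ?_
  have hfu : ∀ (ε : ℝ) (y : X), y ∈ ε • (H ∩ f ⁻¹' T) → y ∈ ε • H ∧ f y ∈ ε • T := by
    rintro ε _ ⟨y, ⟨hy, hy'⟩, rfl⟩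
    exact ⟨⟨y, hy, rfl⟩, f y, hy', (LinearMap.map_smul_of_tower f ε y).symm⟩
  obtain ⟨w, hw⟩ := (isCompletantDisk_iff.1 hTc).2.2 (fun n => f (u n)) fun ε hε => by
    obtain ⟨N, hN⟩ := hu ε hε
    exact ⟨N, fun m hm n hn => by simpa using (hfu _ _ (hN m hm n hn)).2⟩
  -- Closed graph step: `f (u n)` has the gauge limit `w`, and boundedness of `f` on null sequences
  -- forces `w = f x`.
  have h0 := tendsto_seminorm_sub hP (hx.tendsto hHb)
  obtain ⟨φ, hφ, T₁, hT₁, h₁⟩ := (hf.boundedOnNull hP hm).exists_gaugeTendsto h𝔚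
    (t := fun n => u n - x) h0
  obtain ⟨T', -, hd, h1, h2⟩ := h𝔚.exists_union hT hT₁
  have h₂ := ((hw.comp hφ.tendsto_atTop).mono h1).sub hd.isDisk (h₁.mono h2)
  simp only [Function.comp_apply, map_sub, sub_sub_cancel, sub_zero] at h₂
  have h₄ : GaugeTendsto T' (fun _ => f x) (f x) := fun ε hε => Eventually.of_forall fun _ => by
    rw [sub_self]
    obtain ⟨n, hn⟩ := (h₂ ε hε).exists
    exact (hd.isDisk.real_smul ε).zero_mem ⟨_, hn⟩
  obtain rfl := GaugeTendsto.unique hd h₂ h₄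
  intro ε hε
  -- The limits in `H` and in `T` are both controlled from the same `N` on, which is convergence for
  -- the gauge of the intersection.
  obtain ⟨N, hN⟩ := hu (ε / 2) (by positivity)
  refine eventually_atTop.2 ⟨N, fun n hn => ?_⟩
  have ha := exists_forall_sub_mem_smul hH hε (fun m hm n hn => (hfu _ _ (hN m hm n hn)).1) hx n hn
  have hb := exists_forall_sub_mem_smul hTc hε
    (fun m hm n hn => by simpa using (hfu _ _ (hN m hm n hn)).2) hw n hn
  refine (mem_smul_set_iff_inv_smul_mem₀ hε.ne' _ _).2
    ⟨(mem_smul_set_iff_inv_smul_mem₀ hε.ne' _ _).1 ha, ?_⟩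
  rw [← map_sub] at hb
  rw [mem_preimage, LinearMap.map_smul_of_tower]
  exact (mem_smul_set_iff_inv_smul_mem₀ hε.ne' _ _).1 hb

end Extension

/-! ### Uniqueness of completed tensor products -/

theorem IsBoundedLin.comp {V W Z : Type*} [AddCommGroup V] [Module ℂ V] [AddCommGroup W]
    [Module ℂ W] [AddCommGroup Z] [Module ℂ Z] {𝔖 : Set (Set V)} {𝔗 : Set (Set W)}
    {𝔘 : Set (Set Z)} {g : W →ₗ[ℂ] Z} {f : V →ₗ[ℂ] W} (hg : IsBoundedLin 𝔗 𝔘 g)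
    (hf : IsBoundedLin 𝔖 𝔗 f) : IsBoundedLin 𝔖 𝔘 (g ∘ₗ f) := fun S hS => by
  rw [LinearMap.coe_comp, image_comp]
  exact hg _ (hf S hS)

theorem IsBoundedLin.id {V : Type*} [AddCommGroup V] [Module ℂ V] (𝔖 : Set (Set V)) :
    IsBoundedLin 𝔖 𝔖 LinearMap.id := fun S hS => by simpa using hS

theorem IsCompletedTensorProduct.comp_eq_id {V₁ : Type u₁} {V₂ : Type u₂} {T X : Type u₃}
    [AddCommGroup V₁] [Module ℂ V₁] [AddCommGroup V₂] [Module ℂ V₂]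
    [AddCommGroup T] [Module ℂ T] [AddCommGroup X] [Module ℂ X]
    {𝔖₁ : Set (Set V₁)} {𝔖₂ : Set (Set V₂)} {𝔗 : Set (Set T)} {𝔛 : Set (Set X)}
    {b : V₁ →ₗ[ℂ] V₂ →ₗ[ℂ] T} {c : V₁ →ₗ[ℂ] V₂ →ₗ[ℂ] X}
    (hT : IsCompletedTensorProduct.{u₁, u₂, u₃, u₃} 𝔖₁ 𝔖₂ 𝔗 b)
    {f : T →ₗ[ℂ] X} {g : X →ₗ[ℂ] T} (hf : IsBoundedLin 𝔗 𝔛 f) (hg : IsBoundedLin 𝔛 𝔗 g)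
    (hfb : ∀ x y, f (b x y) = c x y) (hgc : ∀ x y, g (c x y) = b x y) :
    g ∘ₗ f = LinearMap.id :=
  (hT.universal T 𝔗 hT.complete b hT.bounded).unique
    ⟨hg.comp hf, fun x y => by simp [hfb, hgc]⟩ ⟨IsBoundedLin.id 𝔗, fun _ _ => rfl⟩

theorem IsCompletedTensorProduct.exists_iso {V₁ : Type u₁} {V₂ : Type u₂} {T X : Type u₃}
    [AddCommGroup V₁] [Module ℂ V₁] [AddCommGroup V₂] [Module ℂ V₂]
    [AddCommGroup T] [Module ℂ T] [AddCommGroup X] [Module ℂ X]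
    {𝔖₁ : Set (Set V₁)} {𝔖₂ : Set (Set V₂)} {𝔗 : Set (Set T)} {𝔛 : Set (Set X)}
    {b : V₁ →ₗ[ℂ] V₂ →ₗ[ℂ] T} {c : V₁ →ₗ[ℂ] V₂ →ₗ[ℂ] X}
    (hX : IsCompletedTensorProduct.{u₁, u₂, u₃, u₃} 𝔖₁ 𝔖₂ 𝔛 c)
    (hT : IsCompletedTensorProduct.{u₁, u₂, u₃, u₃} 𝔖₁ 𝔖₂ 𝔗 b) :
    ∃ e : T ≃ₗ[ℂ] X, IsBornologicalIso 𝔗 𝔛 e ∧ ∀ x y, e (b x y) = c x y := by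
  obtain ⟨f, ⟨hf, hfb⟩, -⟩ := hT.universal X 𝔛 hX.complete c hX.bounded
  obtain ⟨g, ⟨hg, hgc⟩, -⟩ := hX.universal T 𝔗 hT.complete b hT.bounded
  exact ⟨LinearEquiv.ofLinearMap f g (hX.comp_eq_id hg hf hgc hfb) (hT.comp_eq_id hf hg hfb hgc),
    ⟨hf, hg⟩, hfb⟩

/-! ### The tensor product of precompact and of bounded bornologies -/

namespace CompletedProjTensor

section

variable {V₁ V₂ : Type*} [AddCommGroup V₁] [Module ℂ V₁] [UniformSpace V₁] [IsUniformAddGroup V₁]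
  [AddCommGroup V₂] [Module ℂ V₂] [UniformSpace V₂] [IsUniformAddGroup V₂]
  {p : ℕ → Seminorm ℂ V₁} {q : ℕ → Seminorm ℂ V₂} {B₁ : Set V₁} {B₂ : Set V₂}
  {S : Set (CompletedProjTensor V₁ V₂)}

theorem monotone_seminorm (hp : WithSeminorms p) (hq : WithSeminorms q) (hpm : Monotone p)
    (hqm : Monotone q) :
    Monotone fun k => seminorm (hp.continuous_seminorm k) (hq.continuous_seminorm k) :=
  fun _ _ h => seminorm_mono _ _ _ _ (hpm h) (hqm h)

/-- A continuous bilinear map need not be uniformly continuous, so the argument passes through the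
compact closures of the two sets. -/
theorem bilinImage_mem_precompact [CompleteSpace V₁] [CompleteSpace V₂]
    (h₁ : B₁ ∈ precompactBornology V₁) (h₂ : B₂ ∈ precompactBornology V₂) :
    bilinImage (natural V₁ V₂) B₁ B₂ ∈ precompactBornology (CompletedProjTensor V₁ V₂) := by
  have h := (((TotallyBounded.closure h₁).isCompact_of_isClosed isClosed_closure).prod
    ((TotallyBounded.closure h₂).isCompact_of_isClosed isClosed_closure)).image continuous_natural
  refine h.totallyBounded.subset ?_
  rintro _ ⟨x, hx, y, hy, rfl⟩
  exact ⟨(x, y), ⟨subset_closure hx, subset_closure hy⟩, rfl⟩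

theorem bilinImage_mem_bounded (hp : WithSeminorms p) (hq : WithSeminorms q) (hpm : Monotone p)
    (hqm : Monotone q)
    (h₁ : B₁ ∈ boundedBornology V₁) (h₂ : B₂ ∈ boundedBornology V₂) :
    bilinImage (natural V₁ V₂) B₁ B₂ ∈ boundedBornology (CompletedProjTensor V₁ V₂) := by
  refine (withSeminorms hp hq hpm hqm).isVonNBounded_iff_seminorm_bounded.2 fun k => ?_
  obtain ⟨r, hr, h₁⟩ := hp.isVonNBounded_iff_seminorm_bounded.1 h₁ k
  obtain ⟨s, hs, h₂⟩ := hq.isVonNBounded_iff_seminorm_bounded.1 h₂ k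
  refine ⟨r * s, by positivity, ?_⟩
  rintro _ ⟨x, hx, y, hy, rfl⟩
  exact (seminorm_natural_le _ _ x y).trans_lt
    (mul_lt_mul'' (h₁ x hx) (h₂ y hy) (apply_nonneg _ _) (apply_nonneg _ _))

theorem exists_completant (hp : WithSeminorms p) (hq : WithSeminorms q) (hpm : Monotone p)
    (hqm : Monotone q)
    (h₁ : B₁ ∈ boundedBornology V₁) (h₂ : B₂ ∈ boundedBornology V₂) :
    ∃ T ∈ boundedBornology (CompletedProjTensor V₁ V₂),
      bilinImage (natural V₁ V₂) B₁ B₂ ⊆ T ∧ IsCompletantDisk T := by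
  have := (withSeminorms hp hq hpm hqm).continuousSMul
  exact (withSeminorms hp hq hpm hqm).exists_completant
    (bilinImage_mem_bounded hp hq hpm hqm h₁ h₂)

theorem isCompletantDisk_hull (hp : WithSeminorms p) (hq : WithSeminorms q) (hpm : Monotone p)
    (hqm : Monotone q)
    (h₁ : B₁ ∈ boundedBornology V₁) (h₂ : B₂ ∈ boundedBornology V₂) :
    IsCompletantDisk (completantHull (boundedBornology (CompletedProjTensor V₁ V₂))
      (bilinImage (natural V₁ V₂) B₁ B₂)) ∧
    completantHull (boundedBornology (CompletedProjTensor V₁ V₂))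
      (bilinImage (natural V₁ V₂) B₁ B₂) ∈ boundedBornology (CompletedProjTensor V₁ V₂) := by
  obtain ⟨T, hT, hsub, hTc⟩ := exists_completant hp hq hpm hqm h₁ h₂
  exact ⟨isCompletantDisk_completantHull hT hTc hsub,
    Bornology.IsVonNBounded.subset (completantHull_subset hT hTc hsub) hT⟩

/-- A criterion for membership in the bornology generated by the hulls `(B₁ ⊗ B₂)^♥`. -/
theorem mem_bismallBornology [ContinuousSMul ℂ V₁]
    (hp : WithSeminorms p) (hq : WithSeminorms q) (hpm : Monotone p)
    (hqm : Monotone q)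
    (h₁ : B₁ ∈ boundedBornology V₁) (h₂ : B₂ ∈ boundedBornology V₂) {r : ℝ} (hr : 0 < r)
    (h : ∀ T ∈ boundedBornology (CompletedProjTensor V₁ V₂), IsCompletantDisk T →
      bilinImage (natural V₁ V₂) B₁ B₂ ⊆ T → S ⊆ r • T) : S ∈ bismallBornology V₁ V₂ := by
  have := (withSeminorms hp hq hpm hqm).continuousSMul
  have hrc : (r : ℂ) ≠ 0 := by exact_mod_cast hr.ne'
  -- The factor `r` is absorbed into `B₁`: a disk `T` contains `r • B₁ ⊗ B₂` exactly when `r⁻¹ • T`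
  -- contains `B₁ ⊗ B₂`.
  refine ⟨_, h₁.image ((r : ℂ) • ContinuousLinearMap.id ℂ V₁), B₂, h₂,
    subset_sInter fun T ⟨hT, hTc, hsub⟩ => ?_⟩
  have hT' : r⁻¹ • T ∈ boundedBornology (CompletedProjTensor V₁ V₂) := by
    have := hT.image ((r : ℂ)⁻¹ • ContinuousLinearMap.id ℂ (CompletedProjTensor V₁ V₂))
    have e : r⁻¹ • T =
        ((r : ℂ)⁻¹ • ContinuousLinearMap.id ℂ (CompletedProjTensor V₁ V₂)) '' T := by
      rw [← Complex.ofReal_inv]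
      exact image_congr fun x _ => (Complex.coe_smul r⁻¹ x).symm
    rwa [e]
  have := h _ hT' (hTc.real_smul (inv_pos.2 hr)) (by
    rintro _ ⟨x, hx, y, hy, rfl⟩
    refine (mem_smul_set_iff_inv_smul_mem₀ (inv_ne_zero hr.ne') _ _).2
      (hsub ⟨_, mem_image_of_mem _ hx, y, hy, ?_⟩)
    simp only [inv_inv, smul_apply, ContinuousLinearMap.id_apply, map_smul,
      LinearMap.smul_apply]
    exact Complex.coe_smul r _)
  rwa [smul_inv_smul₀ hr.ne'] at this

theorem bismallBornology_subset (hp : WithSeminorms p) (hq : WithSeminorms q) (hpm : Monotone p)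
    (hqm : Monotone q) :
    bismallBornology V₁ V₂ ⊆ boundedBornology (CompletedProjTensor V₁ V₂) := by
  rintro S ⟨B₁, h₁, B₂, h₂, hS⟩
  exact (isCompletantDisk_hull hp hq hpm hqm h₁ h₂).2.subset hS

/-- Each bounded completant disk containing `A ⊗ B` also contains the finite sets of the series
representation. It therefore contains the sums of the series, because a gauge limit is also a
topological limit. -/
theorem precompactBornology_subset [ContinuousSMul ℂ V₁] [ContinuousSMul ℂ V₂]
    (hp : WithSeminorms p) (hq : WithSeminorms q) (hpm : Monotone p) (hqm : Monotone q) :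
    precompactBornology (CompletedProjTensor V₁ V₂) ⊆ bismallBornology V₁ V₂ := by
  intro S hS
  obtain ⟨F, hF, hF', hS⟩ := TotallyBounded.exists_series hS denseRange_incl
    (withSeminorms hp hq hpm hqm) (monotone_seminorm hp hq hpm hqm)
  obtain ⟨A, B, hA, hB, hAB⟩ := ProjTensor.exists_totallyBounded hp hq hpm hqm hF
    fun n a ha => by simpa only [seminorm_incl] using hF' n a ha
  refine ⟨A, hA.isVonNBounded ℂ, B, hB.isVonNBounded ℂ, subset_sInter fun T ⟨hT, hTc, hsub⟩ => ?_⟩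
  intro x hx
  obtain ⟨a, ha, hax⟩ := hS x hx
  obtain ⟨w, hw, hlim⟩ := hTc.exists_gaugeTendsto_sum (l := fun n => (1 / 2) ^ (n + 2))
    (fun n => by positivity) summable_half_pow.1 summable_half_pow.2
    (v := fun n => (1 / 2 : ℝ) ^ (n + 2) • incl V₁ V₂ (a n)) fun n => ⟨_,
      diskedHull_min (hTc.isDisk.preimage (incl V₁ V₂)) (by
        rintro _ ⟨x, hx, y, hy, rfl⟩
        exact hsub ⟨x, hx, y, hy, rfl⟩) (hAB n (ha n)), rfl⟩
  rwa [tendsto_nhds_unique hax (hlim.tendsto hT)]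

theorem isCompleteBornology_bismall [ContinuousSMul ℂ V₁] [ContinuousSMul ℂ V₂]
    (hp : WithSeminorms p) (hq : WithSeminorms q) (hpm : Monotone p) (hqm : Monotone q) :
    IsCompleteBornology (bismallBornology V₁ V₂) := by
  refine ⟨⟨fun v => precompactBornology_subset hp hq hpm hqm (totallyBounded_singleton v), ?_, ?_,
    ?_⟩, ?_⟩
  · rintro S ⟨B₁, h₁, B₂, h₂, hS⟩ T hT
    exact ⟨B₁, h₁, B₂, h₂, hT.trans hS⟩
  · rintro S ⟨B₁, h₁, B₂, h₂, hS⟩ S' ⟨B₁', h₁', B₂', h₂', hS'⟩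
    refine mem_bismallBornology hp hq hpm hqm (Bornology.IsVonNBounded.union h₁ h₁')
      (Bornology.IsVonNBounded.union h₂ h₂') two_pos fun T hT hTc hsub => ?_
    have e₁ := hS.trans (completantHull_subset hT hTc
      ((bilinImage_mono _ subset_union_left subset_union_left).trans hsub))
    have e₂ := hS'.trans (completantHull_subset hT hTc
      ((bilinImage_mono _ subset_union_right subset_union_right).trans hsub))
    rintro _ ⟨x, hx, y, hy, rfl⟩
    have := hTc.isDisk.add_mem_smul zero_le_one zero_le_one (x := x) (y := y)
      (by simpa using e₁ hx) (by simpa using e₂ hy)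
    rwa [one_add_one_eq_two] at this
  · rintro S ⟨B₁, h₁, B₂, h₂, hS⟩
    exact ⟨B₁, h₁, B₂, h₂, diskedHull_min (isCompletantDisk_hull hp hq hpm hqm h₁ h₂).1.isDisk hS⟩
  · rintro S ⟨B₁, h₁, B₂, h₂, hS⟩
    exact ⟨_, ⟨B₁, h₁, B₂, h₂, Subset.rfl⟩, hS, (isCompletantDisk_hull hp hq hpm hqm h₁ h₂).1⟩

theorem boundedOnNull_lift {W : Type*} [AddCommGroup W] [Module ℂ W] {𝔚 : Set (Set W)}
    (h𝔚 : IsCompleteBornology 𝔚)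
    (hp : WithSeminorms p) (hq : WithSeminorms q) (hpm : Monotone p) (hqm : Monotone q)
    {c : V₁ →ₗ[ℂ] V₂ →ₗ[ℂ] W}
    (hc : IsBoundedBilin (precompactBornology V₁) (precompactBornology V₂) 𝔚 c) :
    BoundedOnNull (X₀ := ProjTensor V₁ V₂)
      (fun k => seminorm (hp.continuous_seminorm k) (hq.continuous_seminorm k))
      (incl V₁ V₂) 𝔚 (TensorProduct.lift c) := fun F hF hF' => by
  obtain ⟨A, B, hA, hB, hAB⟩ := ProjTensor.exists_totallyBounded hp hq hpm hqm hF
    fun n a ha => by simpa only [seminorm_incl] using hF' n a ha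
  obtain ⟨T, hT, hsub, hTc⟩ := h𝔚.completant _ (hc A hA B hB)
  refine ⟨T, hT, fun n a ha => ?_⟩
  refine diskedHull_min (V := ProjTensor V₁ V₂)
    (hTc.isDisk.preimage (V := ProjTensor V₁ V₂) (TensorProduct.lift c)) ?_ (hAB n ha)
  rintro _ ⟨x, hx, y, hy, rfl⟩
  exact hsub ⟨x, hx, y, hy, (TensorProduct.lift.tmul x y).symm⟩

theorem eq_on_range_incl {W : Type*} [AddCommGroup W] [Module ℂ W]
    {f g : CompletedProjTensor V₁ V₂ →ₗ[ℂ] W}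
    (h : ∀ x y, f (natural V₁ V₂ x y) = g (natural V₁ V₂ x y)) (z : ProjTensor V₁ V₂) :
    f (incl V₁ V₂ z) = g (incl V₁ V₂ z) := by
  induction z using ProjTensor.induction with
  | zero => simp
  | mk x y => exact h x y
  | add z w hz hw => rw [map_add, map_add, map_add, hz, hw]

/-- Bounded bilinear maps for the precompact bornologies extend uniquely. -/
theorem existsUnique_extension {W : Type*} [AddCommGroup W] [Module ℂ W] {𝔚 : Set (Set W)}
    (h𝔚 : IsCompleteBornology 𝔚)
    (hp : WithSeminorms p) (hq : WithSeminorms q) (hpm : Monotone p) (hqm : Monotone q)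
    {c : V₁ →ₗ[ℂ] V₂ →ₗ[ℂ] W}
    (hc : IsBoundedBilin (precompactBornology V₁) (precompactBornology V₂) 𝔚 c) :
    ∃! f : CompletedProjTensor V₁ V₂ →ₗ[ℂ] W,
      IsBoundedLin (precompactBornology (CompletedProjTensor V₁ V₂)) 𝔚 f ∧
        ∀ x y, f (natural V₁ V₂ x y) = c x y := by
  have hP := withSeminorms hp hq hpm hqm
  have hm := monotone_seminorm hp hq hpm hqm
  have := hP.continuousSMul
  obtain ⟨f, hf, hfi⟩ := (boundedOnNull_lift h𝔚 hp hq hpm hqm hc).exists_extension hP hm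
    denseRange_incl h𝔚
  have hfc : ∀ x y, f (natural V₁ V₂ x y) = c x y := fun x y =>
    (hfi (ProjTensor.mk V₁ V₂ x y)).trans (TensorProduct.lift.tmul x y)
  refine ⟨f, ⟨hf, hfc⟩, fun g ⟨hg, hgc⟩ => ?_⟩
  exact eq_of_isBoundedLin_of_dense hP hm denseRange_incl h𝔚 hg hf
    (eq_on_range_incl fun x y => by rw [hgc, hfc])

end

variable (V₁ : Type u₁) [AddCommGroup V₁] [Module ℂ V₁] [UniformSpace V₁] [IsUniformAddGroup V₁]
    [ContinuousSMul ℂ V₁] [LocallyConvexSpace ℝ V₁] [TopologicalSpace.MetrizableSpace V₁]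
    [CompleteSpace V₁]
    (V₂ : Type u₂) [AddCommGroup V₂] [Module ℂ V₂] [UniformSpace V₂] [IsUniformAddGroup V₂]
    [ContinuousSMul ℂ V₂] [LocallyConvexSpace ℝ V₂] [TopologicalSpace.MetrizableSpace V₂]
    [CompleteSpace V₂]

theorem isCompletedTensorProduct_precompact :
    IsCompletedTensorProduct.{u₁, u₂, max u₁ u₂, w}
      (precompactBornology V₁) (precompactBornology V₂)
      (precompactBornology (CompletedProjTensor V₁ V₂)) (natural V₁ V₂) := by
  obtain ⟨p, hpm, hp⟩ := exists_monotone_withSeminorms (X := V₁)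
  obtain ⟨q, hqm, hq⟩ := exists_monotone_withSeminorms (X := V₂)
  have := (withSeminorms hp hq hpm hqm).continuousSMul
  refine ⟨@isCompleteBornology_precompact _ _ _ _ _ _ _ _
    (withSeminorms hp hq hpm hqm).toLocallyConvexSpace,
    fun S₁ h₁ S₂ h₂ => bilinImage_mem_precompact h₁ h₂, ?_⟩
  intro W _ _ 𝔚 h𝔚 c hc
  exact existsUnique_extension h𝔚 hp hq hpm hqm hc

/-- Precompact sets are bounded and, in the tensor product, belong to `𝔖`; so existence and
uniqueness of the linear map come from the precompact case. What remains is its boundedness on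
hulls. -/
theorem isCompletedTensorProduct_bounded :
    IsCompletedTensorProduct.{u₁, u₂, max u₁ u₂, w}
      (boundedBornology V₁) (boundedBornology V₂)
      (bismallBornology V₁ V₂) (natural V₁ V₂) := by
  obtain ⟨p, hpm, hp⟩ := exists_monotone_withSeminorms (X := V₁)
  obtain ⟨q, hqm, hq⟩ := exists_monotone_withSeminorms (X := V₂)
  have hP := withSeminorms hp hq hpm hqm
  have hm := monotone_seminorm hp hq hpm hqm
  refine ⟨isCompleteBornology_bismall hp hq hpm hqm,
    fun S₁ h₁ S₂ h₂ => ⟨S₁, h₁, S₂, h₂, subset_completantHull _⟩, ?_⟩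
  intro W _ _ 𝔚 h𝔚 c hc
  obtain ⟨f, ⟨hf, hfc⟩, huniq⟩ := existsUnique_extension h𝔚 hp hq hpm hqm (c := c)
    fun S₁ h₁ S₂ h₂ => hc S₁ (TotallyBounded.isVonNBounded ℂ h₁) S₂
      (TotallyBounded.isVonNBounded ℂ h₂)
  refine ⟨f, ⟨?_, hfc⟩, fun g ⟨hg, hgc⟩ => huniq g
    ⟨fun S hS => hg S (precompactBornology_subset hp hq hpm hqm hS), hgc⟩⟩
  rintro S ⟨B₁, h₁, B₂, h₂, hS⟩
  obtain ⟨T, hT, hsub, hTc⟩ := h𝔚.completant _ (hc B₁ h₁ B₂ h₂)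
  obtain ⟨hHc, hHb⟩ := isCompletantDisk_hull hp hq hpm hqm h₁ h₂
  -- This disk is bounded, completant and contains `B₁ ⊗ B₂`, so by minimality it contains the hull,
  -- which `f` thus maps into `T`.
  have h := hf.isCompletantDisk_inter hP hm h𝔚 hHc hHb hT hTc
  refine h𝔚.isConvexBornology.subset_mem T hT _ ?_
  rintro _ ⟨x, hx, rfl⟩
  refine (completantHull_subset (hHb.subset inter_subset_left) h ?_ (hS hx)).2
  refine subset_inter (subset_completantHull _) ?_
  rintro _ ⟨x, hx, y, hy, rfl⟩
  exact hsub ⟨x, hx, y, hy, (hfc x y).symm⟩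

end CompletedProjTensor

/-! ### Lifting bounded sets -/

/-- Iterated approximation inside a completant disk: if every `u ∈ D` can be corrected by an
element of `a • T`, for any `a > Q u`, with arbitrarily small error, then `u ∈ 4 • T`
whenever `Q u < 1`. -/
theorem IsCompletantDisk.mem_of_approx {X : Type*} [AddCommGroup X] [Module ℂ X]
    [TopologicalSpace X] [IsTopologicalAddGroup X] [ContinuousSMul ℂ X] [T2Space X] {T D : Set X}
    (hT : IsCompletantDisk T) (hTb : T ∈ boundedBornology X) {Q : X → ℝ}
    (hQ : ∀ u : ℕ → X, (∀ n, u n ∈ D) → (∀ n, Q (u n) < (1 / 2) ^ n) → Tendsto u atTop (𝓝 0))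
    (h : ∀ u ∈ D, ∀ a > Q u, ∀ ε > 0, ∃ w ∈ a • T, u - w ∈ D ∧ Q (u - w) < ε) {u : X} (hu : u ∈ D)
    (hQu : Q u < 1) : u ∈ (4 : ℝ) • T := by
  have hstep : ∀ (n : ℕ) (v : {v // v ∈ D ∧ Q v < (1 / 2) ^ n}),
      ∃ w ∈ ((1 / 2 : ℝ) ^ n) • T, v.1 - w ∈ D ∧ Q (v.1 - w) < (1 / 2) ^ (n + 1) := fun n v =>
    h v.1 v.2.1 _ v.2.2 _ (by positivity)
  choose g hgT hg using hstep
  let v : ∀ n : ℕ, {v // v ∈ D ∧ Q v < (1 / 2) ^ n} := fun n =>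
    Nat.rec ⟨u, hu, by simpa using hQu⟩ (fun n v => ⟨v.1 - g n v, hg n v⟩) n
  have hv : ∀ n, (v (n + 1)).1 = (v n).1 - g n (v n) := fun n => rfl
  have hlim : Tendsto (fun n => (v n).1) atTop (𝓝 0) := hQ _ (fun n => (v n).2.1) fun n => (v n).2.2
  -- The `n`-th correction lies in `2⁻ⁿ • T`. The factor `1 / 4` brings the total of the
  -- coefficients down to `1 / 2`, below the threshold `1` of the summation lemma.
  have hsum : ∀ N, ∑ n ∈ Finset.range N, (1 / 4 : ℝ) • g n (v n) = (1 / 4 : ℝ) • (u - (v N).1) :=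
    fun N => by
      induction N with
      | zero => simp [v]
      | succ N ih =>
        rw [Finset.sum_range_succ, ih, ← smul_add, hv]
        congr 1
        abel
  obtain ⟨x, hx, hgx⟩ := hT.exists_gaugeTendsto_sum (l := fun n => (1 / 2) ^ (n + 2))
    (fun n => by positivity) summable_half_pow.1 summable_half_pow.2
    (v := fun n => (1 / 4 : ℝ) • g n (v n)) fun n => by
      have := smul_mem_smul_set (a := (1 / 4 : ℝ)) (hgT n (v n))
      rw [smul_smul] at this
      convert this using 2
      ring
  have hreal := continuousSMul_real X
  have hlim' : Tendsto (fun N => (1 / 4 : ℝ) • (u - (v N).1)) atTop (𝓝 ((1 / 4 : ℝ) • (u - 0))) :=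
    (tendsto_const_nhds.sub hlim).const_smul _
  have hxu := tendsto_nhds_unique (hgx.tendsto hTb) (by simpa only [hsum] using hlim')
  refine ⟨x, hx, ?_⟩
  rw [hxu]
  norm_num [smul_smul]

theorem exists_pos_weights {C : ℕ → ℝ} (hC : ∀ k, 0 ≤ C k) : ∃ c : ℕ → ℝ, (∀ k, 0 < c k) ∧
    Summable (fun k => c k * C k) ∧ ∑' k, c k * C k < 1 := by
  have hle : ∀ k, (1 / 2 : ℝ) ^ (k + 2) / (C k + 1) * C k ≤ (1 / 2) ^ (k + 2) := fun k => by
    have := hC k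
    rw [div_mul_eq_mul_div, div_le_iff₀ (by linarith)]
    gcongr
    linarith
  have hnn : ∀ k, 0 ≤ (1 / 2 : ℝ) ^ (k + 2) / (C k + 1) * C k := fun k => by
    have := hC k
    positivity
  have hs := Summable.of_nonneg_of_le hnn hle summable_half_pow.1
  exact ⟨fun k => (1 / 2) ^ (k + 2) / (C k + 1), fun k => by have := hC k; positivity, hs,
    (hs.tsum_le_tsum hle summable_half_pow.1).trans_lt summable_half_pow.2⟩

/-- A normed factor thereby fits the statements about increasing sequences of seminorms. -/
theorem WithSeminorms.const_nat {V ι : Type*} [AddCommGroup V] [Module ℂ V] [TopologicalSpace V]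
    [Inhabited ι] {p : Seminorm ℂ V} (hp : WithSeminorms (fun _ : ι => p)) :
    WithSeminorms (fun _ : ℕ => p) :=
  hp.congr (fun _ => ⟨{default}, 1, by simp⟩) fun _ => ⟨{0}, 1, by simp⟩

namespace CompletedProjTensor

/-! ### Exchanging the two factors -/

section Swap

variable {V₁ V₂ : Type*} [AddCommGroup V₁] [Module ℂ V₁] [UniformSpace V₁] [IsUniformAddGroup V₁]
  [AddCommGroup V₂] [Module ℂ V₂] [UniformSpace V₂] [IsUniformAddGroup V₂]
  {p : ℕ → Seminorm ℂ V₁} {q : ℕ → Seminorm ℂ V₂}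

theorem exists_swap (hp : WithSeminorms p) (hq : WithSeminorms q) (hpm : Monotone p)
    (hqm : Monotone q) : ∃ σ : CompletedProjTensor V₁ V₂ →L[ℂ] CompletedProjTensor V₂ V₁,
      ∀ x y, σ (natural V₁ V₂ x y) = natural V₂ V₁ y x := by
  have hP := withSeminorms hq hp hqm hpm
  have := hP.continuousSMul
  exact @exists_lift _ _ _ _ _ _ _ _ _ _ _ _ _ _ hP.toLocallyConvexSpace _ _ (natural V₂ V₁).flip
    (continuous_natural.comp continuous_swap)

/-- The flip is a topological isomorphism, so it carries bounded completant disks to such disks and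
respects the hulls. -/
theorem bismallBornology_eq_of_swap (hp : WithSeminorms p) (hq : WithSeminorms q)
    (hpm : Monotone p) (hqm : Monotone q)
    (h : bismallBornology V₂ V₁ = boundedBornology (CompletedProjTensor V₂ V₁)) :
    bismallBornology V₁ V₂ = boundedBornology (CompletedProjTensor V₁ V₂) := by
  refine (bismallBornology_subset hp hq hpm hqm).antisymm fun S hS => ?_
  obtain ⟨σ, hσ⟩ := exists_swap hp hq hpm hqm
  obtain ⟨τ, hτ⟩ := exists_swap hq hp hqm hpm
  have h1 : τ.comp σ = ContinuousLinearMap.id ℂ _ := map_ext fun x y => by simp [hσ, hτ]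
  have h2 : σ.comp τ = ContinuousLinearMap.id ℂ _ := map_ext fun x y => by simp [hσ, hτ]
  let e : CompletedProjTensor V₁ V₂ ≃ₗ[ℂ] CompletedProjTensor V₂ V₁ :=
    LinearEquiv.ofLinearMap σ.toLinearMap τ.toLinearMap
      (by ext z; exact DFunLike.congr_fun h2 z) (by ext z; exact DFunLike.congr_fun h1 z)
  have hS' : σ '' S ∈ bismallBornology V₂ V₁ := h ▸ hS.image σ
  obtain ⟨B₂, h₂, B₁, h₁, hsub⟩ := hS'
  refine ⟨B₁, h₁, B₂, h₂, subset_sInter fun T ⟨hT, hTc, hBT⟩ => ?_⟩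
  have hT' : e '' T ∈ boundedBornology (CompletedProjTensor V₂ V₁) := hT.image σ
  have := hsub.trans (completantHull_subset hT' (hTc.image_equiv e) (by
    rintro _ ⟨y, hy, x, hx, rfl⟩
    exact ⟨natural V₁ V₂ x y, hBT ⟨x, hx, y, hy, rfl⟩, hσ x y⟩))
  intro x hx
  obtain ⟨y, hy, hyx⟩ := this (mem_image_of_mem σ hx)
  rwa [← e.injective hyx]

end Swap

/-! ### Two Banach factors -/

section Banach

variable {V₁ V₂ : Type*} [AddCommGroup V₁] [Module ℂ V₁] [UniformSpace V₁] [IsUniformAddGroup V₁]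
  [ContinuousSMul ℂ V₁]
  [AddCommGroup V₂] [Module ℂ V₂] [UniformSpace V₂] [IsUniformAddGroup V₂]

/-- An algebraic tensor of projective seminorm below `a` already lies in `a` times the disked hull
of the product of the unit balls. Density supplies the approximations and the iteration reaches the
completion. -/
theorem bismallBornology_eq_of_isSeminormable (h₁ : IsSeminormable V₁) (h₂ : IsSeminormable V₂) :
    bismallBornology V₁ V₂ = boundedBornology (CompletedProjTensor V₁ V₂) := by
  obtain ⟨p, hp⟩ := h₁
  obtain ⟨q, hq⟩ := h₂
  replace hp := hp.const_nat
  replace hq := hq.const_nat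
  have hpm : Monotone fun _ : ℕ => p := monotone_const
  have hqm : Monotone fun _ : ℕ => q := monotone_const
  refine (bismallBornology_subset hp hq hpm hqm).antisymm fun S hS => ?_
  have hP := withSeminorms hp hq hpm hqm
  have := hP.continuousSMul
  obtain ⟨r, hr, hSr⟩ := hP.isVonNBounded_iff_seminorm_bounded.1 hS 0
  have hB₁ : p.ball 0 1 ∈ boundedBornology V₁ :=
    hp.isVonNBounded_iff_seminorm_bounded.2 fun _ => ⟨1, one_pos, fun x hx => by simpa using hx⟩
  have hB₂ : q.ball 0 1 ∈ boundedBornology V₂ :=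
    hq.isVonNBounded_iff_seminorm_bounded.2 fun _ => ⟨1, one_pos, fun x hx => by simpa using hx⟩
  refine mem_bismallBornology hp hq hpm hqm hB₁ hB₂ (r := r * 4) (by positivity)
    fun T hT hTc hsub u hu => ?_
  set Q := seminorm (hp.continuous_seminorm 0) (hq.continuous_seminorm 0)
  have key : r⁻¹ • u ∈ (4 : ℝ) • T := by
    refine hTc.mem_of_approx (D := univ) (Q := Q) hT (fun u _ hu => ?_) (fun u _ a ha ε hε => ?_)
      (mem_univ _) ?_
    · refine hP.tendsto_zero_iff.2 fun k => ?_
      exact squeeze_zero (fun n => apply_nonneg _ _) (fun n => (hu n).le)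
        (tendsto_pow_atTop_nhds_zero_of_lt_one (by norm_num) (by norm_num))
    · have hop : IsOpen {w | Q (u - w) < min ε (a - Q u)} :=
        isOpen_lt ((continuous_seminorm _ _).comp (continuous_const.sub continuous_id))
          continuous_const
      obtain ⟨t, ht⟩ := denseRange_incl.exists_mem_open hop ⟨u, by simpa [hε] using ha⟩
      obtain ⟨ht1, ht2⟩ := lt_min_iff.1 (show Q _ < min ε (a - Q u) from ht)
      have hta : ProjTensor.seminorm p q t < a := by
        rw [← seminorm_incl (hp.continuous_seminorm 0) (hq.continuous_seminorm 0)]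
        have h3 : Q (incl V₁ V₂ t) ≤ Q (u - incl V₁ V₂ t) + Q u := by
          have := map_sub_le_add Q u (u - incl V₁ V₂ t)
          rwa [sub_sub_cancel, add_comm] at this
        linarith
      obtain ⟨w, hw, hwt⟩ := ProjTensor.mem_of_seminorm_lt hta
      refine ⟨incl V₁ V₂ t, ⟨incl V₁ V₂ w, ?_, ?_⟩, mem_univ _, ht1⟩
      · exact diskedHull_min (hTc.isDisk.preimage (incl V₁ V₂)) (by
          rintro _ ⟨x, hx, y, hy, rfl⟩
          exact hsub ⟨x, hx, y, hy, rfl⟩) hw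
      · rw [← hwt]
        exact (LinearMap.map_smul_of_tower (incl V₁ V₂) a w).symm
    · rw [Seminorm.map_real_smul, abs_of_pos (inv_pos.2 hr), inv_mul_lt_iff₀ hr, mul_one]
      exact hSr u hu
  rw [mul_smul]
  exact (mem_smul_set_iff_inv_smul_mem₀ hr.ne' _ _).2 key

end Banach

/-! ### Slice maps -/

section Slices

variable {V₁ V₂ : Type*} [AddCommGroup V₁] [Module ℂ V₁] [UniformSpace V₁] [IsUniformAddGroup V₁]
  [AddCommGroup V₂] [Module ℂ V₂] [UniformSpace V₂] [IsUniformAddGroup V₂]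

theorem exists_slice_left [ContinuousSMul ℂ V₂] [LocallyConvexSpace ℝ V₂] [T2Space V₂]
    [CompleteSpace V₂] (f : V₁ →L[ℂ] ℂ) :
    ∃ B : CompletedProjTensor V₁ V₂ →L[ℂ] V₂, ∀ x y, B (natural V₁ V₂ x y) = f x • y :=
  exists_lift (LinearMap.lsmul ℂ V₂ ∘ₗ f.toLinearMap)
    ((f.continuous.comp continuous_fst).smul continuous_snd)

theorem exists_slice_right [ContinuousSMul ℂ V₁] [LocallyConvexSpace ℝ V₁] [T2Space V₁]
    [CompleteSpace V₁] (g : V₂ →L[ℂ] ℂ) :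
    ∃ B : CompletedProjTensor V₁ V₂ →L[ℂ] V₁, ∀ x y, B (natural V₁ V₂ x y) = g y • x :=
  exists_lift (LinearMap.lsmul ℂ V₁ ∘ₗ g.toLinearMap).flip
    ((g.continuous.comp continuous_snd).smul continuous_fst)

end Slices

end CompletedProjTensor

/-! ### Spaces approximated by finite-dimensional `ℓ¹` spaces -/

/-- On finite sets, the identity of `V` is approximated for `p` by contractions from the
seminorm `p'` to `p` that factor through finite-dimensional `ℓ¹` spaces. -/
def IsEllOneApproximable {V : Type*} [AddCommGroup V] [Module ℂ V] [TopologicalSpace V]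
    (p p' : Seminorm ℂ V) : Prop :=
  ∀ (s : Finset V) (ε : ℝ), 0 < ε → ∃ (ι : Type) (_ : Fintype ι) (f : ι → V →L[ℂ] ℂ) (e : ι → V),
    (∀ i, p (e i) ≤ 1) ∧ (∀ x, ∑ i, ‖f i x‖ ≤ p' x) ∧ ∀ x ∈ s, p (x - ∑ i, f i x • e i) < ε

theorem Seminorm.map_sum_le {V ι : Type*} [AddCommGroup V] [Module ℂ V] (p : Seminorm ℂ V)
    (s : Finset ι) (v : ι → V) : p (∑ i ∈ s, v i) ≤ ∑ i ∈ s, p (v i) :=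
  Finset.le_sum_of_subadditive p (map_zero p).le (map_add_le_add p) s v

namespace CompletedProjTensor

section

variable {V₁ V₂ : Type*} [AddCommGroup V₁] [Module ℂ V₁] [UniformSpace V₁] [IsUniformAddGroup V₁]
  [AddCommGroup V₂] [Module ℂ V₂] [UniformSpace V₂] [IsUniformAddGroup V₂]
  {p p' : Seminorm ℂ V₁} {q : ℕ → Seminorm ℂ V₂}

/-- The left side is a continuous seminorm of `u` bounded by `p x * r y` on simple tensors, and the
projective seminorm is the largest such. -/
theorem sum_slice_le (hp : Continuous p) {r : Seminorm ℂ V₂} (hr : Continuous r) {ι : Type*}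
    [Fintype ι] {f : ι → V₁ →L[ℂ] ℂ} (hf : ∀ x, ∑ i, ‖f i x‖ ≤ p x)
    {B : ι → CompletedProjTensor V₁ V₂ →L[ℂ] V₂}
    (hB : ∀ i x y, B i (natural V₁ V₂ x y) = f i x • y) (u : CompletedProjTensor V₁ V₂) :
    ∑ i, r (B i u) ≤ seminorm hp hr u := by
  have h := le_seminorm hp hr (g := ∑ i, r.comp (B i).toLinearMap) (by
    have : ⇑(∑ i, r.comp (B i).toLinearMap) = fun u => ∑ i, r (B i u) := by
      ext u
      simp [sum_apply]
    rw [this]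
    exact continuous_finsetSum _ fun i _ => hr.comp (B i).continuous) fun x y => by
      simp only [sum_apply, Seminorm.comp_apply, ContinuousLinearMap.coe_coe, hB,
        map_smul_eq_mul, ← Finset.sum_mul]
      exact mul_le_mul_of_nonneg_right (hf x) (apply_nonneg _ _)
  simpa [sum_apply] using h u

theorem seminorm_sum_natural_le (hp : Continuous p) {r : Seminorm ℂ V₂} (hr : Continuous r)
    {ι : Type*} [Fintype ι] {e : ι → V₁} (he : ∀ i, p (e i) ≤ 1) (w : ι → V₂) :
    seminorm hp hr (∑ i, natural V₁ V₂ (e i) (w i)) ≤ ∑ i, r (w i) := by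
  refine (Seminorm.map_sum_le _ Finset.univ fun i => natural V₁ V₂ (e i) (w i)).trans
    (Finset.sum_le_sum fun i _ => ?_)
  exact (seminorm_natural_le _ _ _ _).trans (mul_le_of_le_one_left (apply_nonneg _ _) (he i))

/-- Simultaneous approximation of an element of the completed tensor product. -/
theorem exists_approx (hp : Continuous p) (hp' : Continuous p') (hpp : p ≤ p') {r : Seminorm ℂ V₂}
    (hr : Continuous r) [ContinuousSMul ℂ V₂] [LocallyConvexSpace ℝ V₂] [T2Space V₂]
    [CompleteSpace V₂] (h : IsEllOneApproximable p p') (u : CompletedProjTensor V₁ V₂) {ε : ℝ}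
    (hε : 0 < ε) :
    ∃ (ι : Type) (_ : Fintype ι) (f : ι → V₁ →L[ℂ] ℂ) (e : ι → V₁)
      (B : ι → CompletedProjTensor V₁ V₂ →L[ℂ] V₂), (∀ i, p (e i) ≤ 1) ∧
      (∀ i x y, B i (natural V₁ V₂ x y) = f i x • y) ∧
      (∀ (r : Seminorm ℂ V₂) (hr : Continuous r), ∑ i, r (B i u) ≤ seminorm hp' hr u) ∧
      seminorm hp hr (u - ∑ i, natural V₁ V₂ (e i) (B i u)) < ε := by
  classical
  have hop : IsOpen {z | seminorm hp' hr (u - z) < ε / 3} :=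
    isOpen_lt ((continuous_seminorm hp' hr).comp (continuous_const.sub continuous_id))
      continuous_const
  obtain ⟨z, hz⟩ := denseRange_incl.exists_mem_open hop ⟨u, by simpa using hε⟩
  change seminorm hp' hr (u - incl V₁ V₂ z) < ε / 3 at hz
  obtain ⟨s, hs⟩ : ∃ s : Finset (V₁ × V₂), z = ∑ i ∈ s, ProjTensor.mk V₁ V₂ i.1 i.2 :=
    TensorProduct.exists_finset (M := V₁) (N := V₂) z
  set M : ℝ := ∑ i ∈ s, r i.2
  have hM : 0 ≤ M := Finset.sum_nonneg fun i _ => apply_nonneg _ _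
  obtain ⟨ι, _, f, e, he, hf, hs'⟩ := h (s.image Prod.fst) (ε / (3 * (M + 1))) (by positivity)
  choose B hB using fun i => exists_slice_left (V₁ := V₁) (V₂ := V₂) (f i)
  -- The slice bound holds for every continuous seminorm on `V₂` with the same functionals; only the
  -- approximation error refers to the given `r`.
  refine ⟨ι, _, f, e, B, he, hB, fun r hr => sum_slice_le hp' hr hf hB u, ?_⟩
  have h1 : seminorm hp hr (∑ i, natural V₁ V₂ (e i) (B i (u - incl V₁ V₂ z))) < ε / 3 :=
    ((seminorm_sum_natural_le hp hr he _).trans (sum_slice_le hp' hr hf hB _)).trans_lt hz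
  have h2 : seminorm hp hr (incl V₁ V₂ z - ∑ i, natural V₁ V₂ (e i) (B i (incl V₁ V₂ z))) ≤
      ε / 3 := by
    have hinc : incl V₁ V₂ z = ∑ j ∈ s, natural V₁ V₂ j.1 j.2 := by
      rw [hs, map_sum]
      rfl
    have h3 : incl V₁ V₂ z - ∑ i, natural V₁ V₂ (e i) (B i (incl V₁ V₂ z)) =
        ∑ j ∈ s, natural V₁ V₂ (j.1 - ∑ i, f i j.1 • e i) j.2 := by
      simp only [hinc, map_sum, hB, map_sub, map_smul, LinearMap.sub_apply, LinearMap.sum_apply,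
        LinearMap.smul_apply, Finset.sum_sub_distrib]
      rw [Finset.sum_comm]
    rw [h3]
    calc _ ≤ ∑ j ∈ s, seminorm hp hr (natural V₁ V₂ (j.1 - ∑ i, f i j.1 • e i) j.2) :=
          Seminorm.map_sum_le _ s _
      _ ≤ ∑ j ∈ s, ε / (3 * (M + 1)) * r j.2 := Finset.sum_le_sum fun j hj =>
          (seminorm_natural_le _ _ _ _).trans (mul_le_mul_of_nonneg_right
            (hs' _ (Finset.mem_image_of_mem _ hj)).le (apply_nonneg _ _))
      _ = ε / (3 * (M + 1)) * M := (Finset.mul_sum _ _ _).symm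
      _ ≤ ε / 3 := by
        rw [div_mul_eq_mul_div, div_le_div_iff₀ (by positivity) (by positivity)]
        nlinarith
  -- With `E` the finite-rank operator and `z` algebraic, `u - E u = (u - z) + (z - E z) - E (u -
  -- z)`. Each part costs `ε / 3`; `M + 1` above keeps a divisor positive.
  have h4 : u - ∑ i, natural V₁ V₂ (e i) (B i u) = (u - incl V₁ V₂ z) +
      (incl V₁ V₂ z - ∑ i, natural V₁ V₂ (e i) (B i (incl V₁ V₂ z))) -
      ∑ i, natural V₁ V₂ (e i) (B i (u - incl V₁ V₂ z)) := by
    simp only [map_sub, Finset.sum_sub_distrib]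
    abel
  rw [h4]
  refine (map_sub_le_add _ _ _).trans_lt ?_
  refine (add_le_add (map_add_le_add _ _ _) le_rfl).trans_lt ?_
  calc _ < ε / 3 + ε / 3 + ε / 3 := add_lt_add_of_le_of_lt (add_le_add
      ((seminorm_mono hp hr hp' hr hpp le_rfl _).trans hz.le) h2) h1
    _ = ε := by ring

/-- The iteration is run with `Q u = ∑ c k * P k u`, the weights being chosen so that `Q < 1` on
`S`. For the approximants `∑ eᵢ ⊗ wᵢ` one has `∑ᵢ q k (wᵢ) ≤ P k u` for all `k` at once, so `∑ᵢ ∑ₖ c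
k * q k (wᵢ) ≤ Q u`. The inner sum bounds the factor by which `wᵢ` must be scaled down to lie in the
single bounded set `{y | ∀ k, c k * q k y ≤ 1}`. -/
theorem bismallBornology_eq_of_isEllOneApproximable [ContinuousSMul ℂ V₁]
    [ContinuousSMul ℂ V₂] [LocallyConvexSpace ℝ V₂] [T2Space V₂] [CompleteSpace V₂]
    (hp : WithSeminorms fun _ : ℕ => p) (hq : WithSeminorms q) (hqm : Monotone q)
    (h : IsEllOneApproximable p p) :
    bismallBornology V₁ V₂ = boundedBornology (CompletedProjTensor V₁ V₂) := by
  have hpm : Monotone fun _ : ℕ => p := monotone_const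
  refine (bismallBornology_subset hp hq hpm hqm).antisymm fun S hS => ?_
  have hP := withSeminorms hp hq hpm hqm
  have hm := monotone_seminorm hp hq hpm hqm
  have := hP.continuousSMul
  have hpc := hp.continuous_seminorm 0
  set P : ℕ → Seminorm ℂ (CompletedProjTensor V₁ V₂) := fun k =>
    seminorm (hp.continuous_seminorm k) (hq.continuous_seminorm k)
  choose C hC hSC using hP.isVonNBounded_iff_seminorm_bounded.1 hS
  obtain ⟨c, hc, hcs, hc1⟩ := exists_pos_weights fun k => (hC k).le
  have hB₁ : {x | p x ≤ 1} ∈ boundedBornology V₁ :=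
    hp.isVonNBounded_iff_seminorm_bounded.2 fun _ => ⟨2, two_pos, fun x hx =>
      lt_of_le_of_lt hx one_lt_two⟩
  have hB₂ : {y | ∀ k, c k * q k y ≤ 1} ∈ boundedBornology V₂ :=
    hq.isVonNBounded_iff_seminorm_bounded.2 fun k => ⟨(c k)⁻¹ + 1, by have := hc k; positivity,
      fun y hy => by
        have h1 := hy k
        rw [mul_comm, ← le_div_iff₀ (hc k), one_div] at h1
        linarith⟩
  refine mem_bismallBornology hp hq hpm hqm hB₁ hB₂ (r := 4) (by positivity)
    fun T hT hTc hsub u hu => ?_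
  have hle : ∀ u : CompletedProjTensor V₁ V₂, ∀ k, 0 ≤ c k * P k u := fun u k =>
    mul_nonneg (hc k).le (apply_nonneg _ _)
  refine hTc.mem_of_approx (D := {u | Summable fun k => c k * P k u})
    (Q := fun u => ∑' k, c k * P k u) hT (fun v hv hvQ => ?_) (fun u hu a ha ε hε => ?_) ?_ ?_
  · refine hP.tendsto_zero_iff.2 fun k => ?_
    have h0 : Tendsto (fun n : ℕ => (c k)⁻¹ * (1 / 2 : ℝ) ^ n) atTop (𝓝 ((c k)⁻¹ * 0)) :=
      (tendsto_pow_atTop_nhds_zero_of_lt_one (by norm_num) (by norm_num)).const_mul _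
    rw [mul_zero] at h0
    refine squeeze_zero (fun n => apply_nonneg _ _) (fun n => ?_) h0
    rw [le_inv_mul_iff₀ (hc k)]
    exact ((hv n).le_tsum k fun j _ => hle _ j).trans (hvQ n).le
  · -- choose a finite part of the weights that carries `Q u` up to `ε / 4`
    obtain ⟨K, hK⟩ : ∃ K, ∑' k, c (k + K) * P (k + K) u < ε / 4 :=
      ((tendsto_sum_nat_add fun k => c k * P k u).eventually (gt_mem_nhds (by positivity))).exists
    set A : ℝ := ∑ k ∈ Finset.range K, c k
    have hA : 0 ≤ A := Finset.sum_nonneg fun k _ => (hc k).le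
    obtain ⟨ι, _, -, e, B, he, -, hw, hKε⟩ := exists_approx hpc hpc le_rfl
      (hq.continuous_seminorm K) h u (ε := ε / (2 * (A + 1))) (by positivity)
    set w : ι → V₂ := fun i => B i u
    set E := ∑ i, natural V₁ V₂ (e i) (w i)
    -- The approximation is good only for `P K`, but it is contractive for every `P k`; the tail of
    -- the weighted sum at most doubles.
    have hPE : ∀ k, P k (u - E) ≤ 2 * P k u := fun k => by
      have := (seminorm_sum_natural_le hpc (hq.continuous_seminorm k) he w).trans 
        (hw (q k) (hq.continuous_seminorm k))
      calc P k (u - E) ≤ P k u + P k E := map_sub_le_add _ _ _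
        _ ≤ P k u + P k u := by gcongr
        _ = 2 * P k u := by ring
    have hle2 : ∀ k, c k * P k (u - E) ≤ 2 * (c k * P k u) := fun k => by
      calc _ ≤ c k * (2 * P k u) := mul_le_mul_of_nonneg_left (hPE k) (hc k).le
        _ = _ := by ring
    have hsE : Summable fun k => c k * P k (u - E) :=
      Summable.of_nonneg_of_le (hle _) hle2 (hu.mul_left 2)
    refine ⟨E, ?_, hsE, ?_⟩
    · -- membership in `a • T`
      have hTne : T.Nonempty := ⟨_, hsub ⟨0, by simp, 0, by simp, rfl⟩⟩
      set Q : ℝ := ∑' k, c k * P k u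
      set m : ℝ := (Fintype.card ι : ℝ)
      -- The slack `a - Q` is spread over the indices, so that every dilation factor is positive and
      -- their total still does not exceed `a`.
      set δ : ℝ := (a - Q) / (m + 1)
      have hδ : 0 < δ := div_pos (sub_pos.2 ha) (by positivity)
      have hws : ∀ i, Summable fun k => c k * q k (w i) := fun i =>
        Summable.of_nonneg_of_le (fun k => mul_nonneg (hc k).le (apply_nonneg _ _))
          (fun k => mul_le_mul_of_nonneg_left ((Finset.single_le_sum
            (fun j _ => apply_nonneg (q k) (w j)) (Finset.mem_univ i)).trans (hw (q k) (hq.continuous_seminorm k))) (hc k).le) hu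
      have hwnn : ∀ i, 0 ≤ ∑' k, c k * q k (w i) := fun i =>
        tsum_nonneg fun k => mul_nonneg (hc k).le (apply_nonneg _ _)
      have hsum := hTc.isDisk.sum_mem_smul hTne Finset.univ
        (l := fun i => (∑' k, c k * q k (w i)) + δ) (v := fun i => natural V₁ V₂ (e i) (w i))
        (fun i _ => add_nonneg (hwnn i) hδ.le) fun i _ => by
          have hpos : 0 < (∑' k, c k * q k (w i)) + δ := add_pos_of_nonneg_of_pos (hwnn i) hδ
          set t := (∑' k, c k * q k (w i)) + δ
          have htc : (t : ℂ) ≠ 0 := by exact_mod_cast hpos.ne'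
          refine ⟨natural V₁ V₂ (e i) ((t : ℂ)⁻¹ • w i), hsub ⟨_, he i, _, fun k => ?_, rfl⟩, ?_⟩
          · rw [map_smul_eq_mul, norm_inv, Complex.norm_real, Real.norm_of_nonneg hpos.le,
              mul_left_comm, inv_mul_le_iff₀ hpos, mul_one]
            exact ((hws i).le_tsum k fun j _ => mul_nonneg (hc j).le (apply_nonneg _ _)).trans
              (le_add_of_nonneg_right hδ.le)
          · simp only [← Complex.coe_smul, map_smul]
            rw [smul_inv_smul₀ htc]
      refine hTc.isDisk.smul_mono (Finset.sum_nonneg fun i _ => add_nonneg (hwnn i) hδ.le) ?_ hsum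
      rw [Finset.sum_add_distrib, Finset.sum_const, Finset.card_univ, nsmul_eq_mul,
        ← Summable.tsum_finsetSum fun i _ => hws i]
      have h1 : ∑' k, ∑ i, c k * q k (w i) ≤ Q := by
        refine Summable.tsum_le_tsum (fun k => ?_) (summable_sum fun i _ => hws i) hu
        rw [← Finset.mul_sum]
        exact mul_le_mul_of_nonneg_left (hw (q k) (hq.continuous_seminorm k)) (hc k).le
      have h2 : m * δ ≤ a - Q := by
        rw [mul_div_assoc', div_le_iff₀ (by positivity)]
        have : 0 < a - Q := sub_pos.2 ha
        nlinarith
      linarith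
    · -- the remaining error
      rw [← hsE.sum_add_tsum_nat_add K]
      have h1 : ∑ k ∈ Finset.range K, c k * P k (u - E) ≤ A * P K (u - E) := by
        rw [Finset.sum_mul]
        exact Finset.sum_le_sum fun k hk => mul_le_mul_of_nonneg_left
          (hm (Finset.mem_range.1 hk).le _) (hc k).le
      have h2 : A * P K (u - E) ≤ ε / 2 := by
        calc _ ≤ A * (ε / (2 * (A + 1))) := mul_le_mul_of_nonneg_left hKε.le hA
          _ ≤ ε / 2 := by
            rw [mul_div_assoc', div_le_div_iff₀ (by positivity) (by positivity)]
            nlinarith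
      have h3 : ∑' k, c (k + K) * P (k + K) (u - E) ≤ 2 * ∑' k, c (k + K) * P (k + K) u := by
        rw [← tsum_mul_left]
        exact Summable.tsum_le_tsum (fun k => hle2 _) ((summable_nat_add_iff K).2 hsE)
          (((summable_nat_add_iff K).2 hu).mul_left 2)
      linarith
  · exact Summable.of_nonneg_of_le (hle u)
      (fun k => mul_le_mul_of_nonneg_left (hSC k u hu).le (hc k).le) hcs
  · exact (Summable.tsum_le_tsum
      (fun k => mul_le_mul_of_nonneg_left (hSC k u hu).le (hc k).le) (Summable.of_nonneg_of_le (hle u)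
      (fun k => mul_le_mul_of_nonneg_left (hSC k u hu).le (hc k).le) hcs) hcs).trans_lt hc1

end

end CompletedProjTensor

/-! ### `L¹` spaces -/

section Lebesgue

variable {M : Type*} [MeasurableSpace M] {μ : Measure M}

theorem exists_setIntegralCLM (A : Set M) :
    ∃ f : Lp ℂ 1 μ →L[ℂ] ℂ, ∀ x, f x = ∫ a in A, x a ∂μ := by
  refine ⟨LinearMap.mkContinuous
    { toFun := fun x => ∫ a in A, x a ∂μ
      map_add' := fun x y => ?_
      map_smul' := fun c x => ?_ } 1 fun x => ?_, fun x => rfl⟩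
  · rw [← integral_add (L1.integrable_coeFn x).integrableOn (L1.integrable_coeFn y).integrableOn]
    exact integral_congr_ae (ae_restrict_of_ae (Lp.coeFn_add x y))
  · rw [RingHom.id_apply, ← integral_smul]
    exact integral_congr_ae (ae_restrict_of_ae (Lp.coeFn_smul c x))
  · rw [one_mul, L1.norm_eq_integral_norm]
    exact (norm_integral_le_integral_norm _).trans (setIntegral_le_integral
      (L1.integrable_coeFn x).norm (Eventually.of_forall fun a => norm_nonneg _))

theorem sum_norm_setIntegral_le {ι : Type*} [Fintype ι] {A : ι → Set M}
    (hA : ∀ i, MeasurableSet (A i)) (hd : Pairwise (Function.onFun Disjoint A)) (x : Lp ℂ 1 μ) :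
    ∑ i, ‖∫ a in A i, x a ∂μ‖ ≤ ‖x‖ := by
  have hx := (L1.integrable_coeFn x).norm
  calc ∑ i, ‖∫ a in A i, x a ∂μ‖ ≤ ∑ i, ∫ a in A i, ‖x a‖ ∂μ :=
        Finset.sum_le_sum fun i _ => norm_integral_le_integral_norm _
    _ = ∫ a in ⋃ i, A i, ‖x a‖ ∂μ := (integral_iUnion_fintype hA hd fun i => hx.integrableOn).symm
    _ ≤ ∫ a, ‖x a‖ ∂μ := setIntegral_le_integral hx (Eventually.of_forall fun a => norm_nonneg _)
    _ = ‖x‖ := (L1.norm_eq_integral_norm x).symm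

/-- Finitely many `L¹` functions are approximated by linear combinations of the indicators of
common disjoint sets. -/
theorem exists_disjoint_approx {n : ℕ} (x : Fin n → Lp ℂ 1 μ) {ε : ℝ} (hε : 0 < ε) :
    ∃ (ι : Type) (_ : Fintype ι) (A : ι → Set M) (hA : ∀ i, MeasurableSet (A i))
      (hμ : ∀ i, μ (A i) ≠ ⊤) (c : ι → Fin n → ℂ), Pairwise (Function.onFun Disjoint A) ∧
      ∀ j, ‖x j - ∑ i, c i j • indicatorConstLp 1 (hA i) (hμ i) (1 : ℂ)‖ < ε := by
  classical
  -- The `n` functions form one vector-valued function. A single simple function approximates them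
  -- all, and its nonzero values have disjoint fibres of finite measure.
  have hmem : MemLp (fun a j => x j a) 1 μ := memLp_pi_iff.2 fun j => Lp.memLp (x j)
  obtain ⟨G, hG, hGm⟩ := hmem.exists_simpleFunc_eLpNorm_sub_lt ENNReal.one_ne_top
    (ENNReal.ofReal_pos.2 hε).ne'
  have hA : ∀ i : ↥(G.range.filter (· ≠ 0)), MeasurableSet (G ⁻¹' {i.1}) := fun i =>
    G.measurableSet_fiber _
  have hμ : ∀ i : ↥(G.range.filter (· ≠ 0)), μ (G ⁻¹' {i.1}) ≠ ⊤ := fun i =>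
    (SimpleFunc.measure_preimage_lt_top_of_memLp one_ne_zero ENNReal.one_ne_top G hGm _
      (Finset.mem_filter.1 i.2).2).ne
  refine ⟨↥(G.range.filter (· ≠ 0)), inferInstance, fun i => G ⁻¹' {i.1}, hA, hμ, fun i => i.1,
    fun i j hij => ?_, fun j => ?_⟩
  · exact Disjoint.preimage _ (disjoint_singleton.2 fun h => hij (Subtype.ext h))
  · have hsum : ⇑(∑ i : ↥(G.range.filter (· ≠ 0)), i.1 j •
        indicatorConstLp 1 (hA i) (hμ i) (1 : ℂ)) =ᵐ[μ] fun a => G a j := by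
      have h1 : ∀ᵐ a ∂μ, ∀ i : ↥(G.range.filter (· ≠ 0)),
          (i.1 j • indicatorConstLp 1 (hA i) (hμ i) (1 : ℂ) : Lp ℂ 1 μ) a =
            i.1 j * (G ⁻¹' {i.1}).indicator (fun _ => 1) a := ae_all_iff.2 fun i => by
        filter_upwards [Lp.coeFn_smul (i.1 j) (indicatorConstLp 1 (hA i) (hμ i) (1 : ℂ)),
          indicatorConstLp_coeFn (p := 1) (hs := hA i) (hμs := hμ i) (c := (1 : ℂ))] with a h2 h3
        rw [h2, Pi.smul_apply, h3, smul_eq_mul]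
      filter_upwards [Lp.coeFn_finsetSum Finset.univ fun i : ↥(G.range.filter (· ≠ 0)) =>
        i.1 j • indicatorConstLp 1 (hA i) (hμ i) (1 : ℂ), h1] with a h2 h3
      rw [h2, Finset.sum_apply]
      simp only [h3]
      rw [Finset.sum_coe_sort (G.range.filter (· ≠ 0))
        fun i => i j * (G ⁻¹' {i}).indicator (fun _ => (1 : ℂ)) a, Finset.sum_eq_single (G a)]
      · simp
      · intro b _ hb
        rw [indicator_of_notMem (by simpa using hb.symm), mul_zero]
      · intro h
        simp only [Finset.mem_filter, SimpleFunc.mem_range_self, true_and, ne_eq, not_not] at h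
        simp [h]
    rw [Lp.norm_def]
    refine (ENNReal.toReal_lt_of_lt_ofReal (lt_of_le_of_lt ?_ hG))
    refine eLpNorm_mono_ae ?_
    filter_upwards [hsum, Lp.coeFn_sub (x j) (∑ i : ↥(G.range.filter (· ≠ 0)), i.1 j •
        indicatorConstLp 1 (hA i) (hμ i) (1 : ℂ))] with a h1 h2
    rw [h2, Pi.sub_apply, h1]
    exact norm_le_pi_norm ((fun a j => x j a) a - G a) j

/-- The operator is the averaging `x ↦ ∑ᵢ (∫_{Aᵢ} x) 1_{Aᵢ} / μ(Aᵢ)`. It is contractive, factors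
through `ℓ¹`, and fixes the indicators of the sets `Aᵢ`. -/
theorem isEllOneApproximable_lp {V : Type*} [AddCommGroup V] [Module ℂ V] [TopologicalSpace V]
    (φ : V ≃L[ℂ] Lp ℂ 1 μ) :
    IsEllOneApproximable ((normSeminorm ℂ (Lp ℂ 1 μ)).comp φ.toLinearEquiv.toLinearMap)
      ((normSeminorm ℂ (Lp ℂ 1 μ)).comp φ.toLinearEquiv.toLinearMap) := by
  intro s ε hε
  obtain ⟨ι, _, A, hA, hμ, c, hd, hc⟩ := exists_disjoint_approx (μ := μ)
    (fun j => φ (s.equivFin.symm j)) (half_pos hε)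
  choose f hf using fun i => exists_setIntegralCLM (μ := μ) (A i)
  set e : ι → Lp ℂ 1 μ := fun i =>
    ((μ.real (A i))⁻¹ : ℂ) • indicatorConstLp 1 (hA i) (hμ i) (1 : ℂ)
  have hn : ∀ i, ‖indicatorConstLp 1 (hA i) (hμ i) (1 : ℂ)‖ = μ.real (A i) := fun i => by
    rw [norm_indicatorConstLp one_ne_zero ENNReal.one_ne_top]
    simp
  have he : ∀ i, ‖e i‖ ≤ 1 := fun i => by
    simp only [e]
    rw [norm_smul, hn, norm_inv, Complex.norm_real, Real.norm_of_nonneg measureReal_nonneg]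
    exact inv_mul_le_one
  have hfs : ∀ x : Lp ℂ 1 μ, ∑ i, ‖f i x‖ ≤ ‖x‖ := fun x => by
    simpa only [hf] using sum_norm_setIntegral_le hA hd x
  have hE : ∀ x : Lp ℂ 1 μ, ‖∑ i, f i x • e i‖ ≤ ‖x‖ := fun x =>
    (norm_sum_le _ _).trans ((Finset.sum_le_sum fun i _ => by
      rw [norm_smul]
      exact mul_le_of_le_one_right (norm_nonneg _) (he i)).trans (hfs x))
  have hfi : ∀ i, ∑ k, f k (indicatorConstLp 1 (hA i) (hμ i) (1 : ℂ)) • e k =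
      indicatorConstLp 1 (hA i) (hμ i) (1 : ℂ) := fun i => by
    rw [Finset.sum_eq_single i]
    · rw [hf, setIntegral_indicatorConstLp (hA i), inter_self]
      simp only [e]
      -- On a null set the indicator vanishes in `L¹`, so the convention `0⁻¹ = 0` does no harm.
      rcases eq_or_ne (μ.real (A i)) 0 with h0 | h0
      · rw [h0, zero_smul, zero_smul]
        exact (norm_eq_zero.1 ((hn i).trans h0)).symm
      · rw [Complex.real_smul, mul_one]
        exact smul_inv_smul₀ (by exact_mod_cast h0) _
    · intro k _ hk
      rw [hf, setIntegral_indicatorConstLp (hA k), (hd hk.symm).inter_eq]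
      simp
    · simp
  refine ⟨ι, _, fun i => (f i).comp φ.toContinuousLinearMap, fun i => φ.symm (e i),
    fun i => ?_, fun x => hfs (φ x), fun x hx => ?_⟩
  · simpa [Seminorm.comp_apply] using he i
  · have h := hc (s.equivFin ⟨x, hx⟩)
    rw [Equiv.symm_apply_apply] at h
    set g := ∑ i, c i (s.equivFin ⟨x, hx⟩) • indicatorConstLp 1 (hA i) (hμ i) (1 : ℂ)
    have hg : ∑ k, f k g • e k = g := by
      simp only [g, map_sum, map_smul, Finset.sum_smul]
      rw [Finset.sum_comm]
      refine Finset.sum_congr rfl fun i _ => ?_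
      conv_rhs => rw [← hfi i, Finset.smul_sum]
      simp only [smul_assoc]
    -- The operator fixes `g`, so the error involves only `φ x - g`, which is counted twice; hence
    -- `ε / 2` at the start.
    have h1 : φ (x - ∑ i, f i (φ x) • φ.symm (e i)) =
        (φ x - g) - ∑ i, f i (φ x - g) • e i := by
      simp only [map_sub, map_sum, map_smul, sub_smul, Finset.sum_sub_distrib, hg,
        ContinuousLinearEquiv.apply_symm_apply]
      abel
    change ‖φ (x - ∑ i, f i (φ x) • φ.symm (e i))‖ < ε
    rw [h1]
    have := norm_sub_le (φ x - g) (∑ i, f i (φ x - g) • e i)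
    have := hE (φ x - g)
    linarith

theorem withSeminorms_lp {V : Type*} [AddCommGroup V] [Module ℂ V] [TopologicalSpace V]
    (φ : V ≃L[ℂ] Lp ℂ 1 μ) :
    WithSeminorms fun _ : ℕ => (normSeminorm ℂ (Lp ℂ 1 μ)).comp φ.toLinearEquiv.toLinearMap :=
  WithSeminorms.const_nat (φ.toHomeomorph.isInducing.withSeminorms
    (f := φ.toLinearEquiv.toLinearMap) (norm_withSeminorms ℂ (Lp ℂ 1 μ)))

end Lebesgue

namespace CompletedProjTensor

theorem bismallBornology_eq_of_lp {V₁ V₂ : Type*} [AddCommGroup V₁] [Module ℂ V₁] [UniformSpace V₁]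
    [IsUniformAddGroup V₁] [ContinuousSMul ℂ V₁] [LocallyConvexSpace ℝ V₁]
    [TopologicalSpace.MetrizableSpace V₁] [CompleteSpace V₁] [AddCommGroup V₂] [Module ℂ V₂]
    [UniformSpace V₂] [IsUniformAddGroup V₂] [ContinuousSMul ℂ V₂] [LocallyConvexSpace ℝ V₂]
    [TopologicalSpace.MetrizableSpace V₂] [CompleteSpace V₂] {M : Type*} [MeasurableSpace M]
    {μ : Measure M} (h : Nonempty (V₁ ≃L[ℂ] Lp ℂ 1 μ) ∨ Nonempty (V₂ ≃L[ℂ] Lp ℂ 1 μ)) :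
    bismallBornology V₁ V₂ = boundedBornology (CompletedProjTensor V₁ V₂) := by
  rcases h with ⟨⟨φ⟩⟩ | ⟨⟨φ⟩⟩
  · obtain ⟨q, hqm, hq⟩ := exists_monotone_withSeminorms (X := V₂)
    exact bismallBornology_eq_of_isEllOneApproximable (withSeminorms_lp φ) hq hqm
      (isEllOneApproximable_lp φ)
  · obtain ⟨q, hqm, hq⟩ := exists_monotone_withSeminorms (X := V₁)
    exact bismallBornology_eq_of_swap hq (withSeminorms_lp φ) hqm monotone_const
      (bismallBornology_eq_of_isEllOneApproximable (withSeminorms_lp φ) hq hqm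
        (isEllOneApproximable_lp φ))

end CompletedProjTensor

/-! ### Nuclear spaces -/

theorem WithSeminorms.exists_le {X : Type*} [AddCommGroup X] [Module ℂ X] [TopologicalSpace X]
    {P : ℕ → Seminorm ℂ X} (hP : WithSeminorms P) (hm : Monotone P) {q : Seminorm ℂ X}
    (hq : Continuous q) : ∃ k, ∃ C : ℝ, 0 < C ∧ ∀ x, q x ≤ C * P k x := by
  obtain ⟨s, C, hC, h⟩ := Seminorm.bound_of_continuous hP q hq
  refine ⟨s.sup id, C, by positivity, fun x => (h x).trans ?_⟩
  exact mul_le_mul_of_nonneg_left ((Finset.sup_le fun i hi =>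
    hm (Finset.le_sup (f := id) hi) : s.sup P ≤ P (s.sup id)) x) C.2

/-! ### Reconstruction from square-summable coefficients -/

section Reconstruction

variable {V ι : Type*} [AddCommGroup V] [Module ℂ V] [UniformSpace V] [IsUniformAddGroup V]
  [ContinuousSMul ℂ V]

/-- If square-summable coefficients control the topology of a complete space `V`, then vectors are
reconstructed from their coefficients by a continuous operator on `ℓ²`. -/
theorem exists_reconstruction [DecidableEq ι] [T2Space V] [CompleteSpace V] {P : ℕ → Seminorm ℂ V}
    (hP : WithSeminorms P) (J : ι → V →ₗ[ℂ] ℂ) (M : ℕ → ℝ)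
    (h : ∀ k x, Summable (fun i => ‖J i x‖ ^ 2) → P k x ≤ M k * √(∑' i, ‖J i x‖ ^ 2)) :
    ∃ Z : lp (fun _ : ι => ℂ) 2 →L[ℂ] V, ∀ x, Summable (fun i => ‖J i x‖ ^ 2) →
      HasSum (fun i => J i x • Z (lp.single 2 i 1)) x := by
  have hmem : ∀ x, Memℓp (fun i => J i x) 2 ↔ Summable fun i => ‖J i x‖ ^ 2 := fun x => by
    rw [memℓp_gen_iff (by norm_num)]
    simp
  -- `D` is the space of vectors with coefficients in `ℓ²`; the hypothesis says that `j : D → ℓ²`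
  -- has a continuous inverse on its range.
  let D : Submodule ℂ V :=
    { carrier := {x | Memℓp (fun i => J i x) 2}
      zero_mem' := by simpa using! zero_memℓp (E := fun _ : ι => ℂ) (p := 2)
      add_mem' := fun {x y} hx hy => by simpa using! hx.add hy
      smul_mem' := fun c x hx => by simpa using! hx.const_smul c }
  let j : D →ₗ[ℂ] lp (fun _ : ι => ℂ) 2 :=
    { toFun := fun x => ⟨fun i => J i x, x.2⟩
      map_add' := fun x y => by
        ext i
        exact map_add (J i) _ _
      map_smul' := fun c x => by
        ext i
        exact map_smul (J i) _ _ }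
  have hj : ∀ k (x : D), P k x ≤ M k * ‖j x‖ := fun k x => by
    refine (h k x ((hmem _).1 x.2)).trans_eq ?_
    rw [lp.norm_eq_tsum_rpow (by norm_num), Real.sqrt_eq_rpow]
    simp [j]
  have hinj : Function.Injective j := (injective_iff_map_eq_zero j).2 fun x hx => by
    by_contra hne
    obtain ⟨k, hk⟩ := hP.separating_of_T1 x.1 fun h0 => hne (Subtype.ext h0)
    exact hk (le_antisymm (by simpa [hx] using hj k x) (apply_nonneg _ _))
  let W := LinearMap.range j
  let φ : D ≃ₗ[ℂ] W := LinearEquiv.ofInjective j hinj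
  have hc : Continuous (D.subtype ∘ₗ φ.symm.toLinearMap) := by
    refine hP.continuous_normedSpace_dom W _ fun k => ⟨‖M k‖₊, fun w => ?_⟩
    obtain ⟨x, rfl⟩ := φ.surjective w
    have hx : (D.subtype ∘ₗ φ.symm.toLinearMap) (φ x) = x := by simp
    rw [Seminorm.comp_apply, hx]
    exact (hj k x).trans (mul_le_mul_of_nonneg_right (Real.le_norm_self _) (norm_nonneg _))
  let L : W →L[ℂ] V := ⟨D.subtype ∘ₗ φ.symm.toLinearMap, hc⟩
  have hL : ∀ x : D, L ⟨j x, x, rfl⟩ = x := fun x => by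
    have : φ.symm ⟨j x, x, rfl⟩ = x := φ.symm_apply_apply x
    change ((φ.symm ⟨j x, x, rfl⟩ : D) : V) = x
    rw [this]
  -- Completeness of `V` extends the inverse to the closure of the range. The orthogonal projection,
  -- which is the reason for working in `ℓ²`, extends it to the whole space.
  let U := W.topologicalClosure
  have hU : CompleteSpace U := W.isClosed_topologicalClosure.completeSpace_coe
  let e : W →L[ℂ] U := ⟨Submodule.inclusion W.le_topologicalClosure,
    continuous_inclusion W.le_topologicalClosure⟩
  have he : DenseRange e := denseRange_inclusion_iff W.le_topologicalClosure |>.2 Subset.rfl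
  have he' : IsUniformInducing e :=
    (AddMonoidHomClass.isometry_of_norm e fun _ => rfl).isUniformInducing
  refine ⟨(L.extend e).comp U.orthogonalProjectionOnto, fun x hx => ?_⟩
  set a := j ⟨x, (hmem x).2 hx⟩
  have ha : U.orthogonalProjectionOnto a = e ⟨a, _, rfl⟩ :=
    U.orthogonalProjectionOnto_mem_subspace_eq_self (e ⟨a, _, rfl⟩)
  have hs := (lp.hasSum_single ENNReal.ofNat_ne_top a).mapL
    ((L.extend e).comp U.orthogonalProjectionOnto)
  rw [ContinuousLinearMap.comp_apply, ha, ContinuousLinearMap.extend_eq _ he he', hL] at hs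
  convert hs using 2 with i
  rw [← map_smul, ← lp.single_smul, smul_eq_mul, mul_one]
  rfl

/-- Absolute summability of the images of a family of coefficients in `ℓ²`, uniformly over
functionals bounded by a fixed seminorm. -/
theorem exists_sum_norm_le [DecidableEq ι] (Z : lp (fun _ : ι => ℂ) 2 →L[ℂ] V) {q : Seminorm ℂ V}
    (hq : Continuous q) {σ : ι → ℝ} (hσ : ∀ i, 0 ≤ σ i) (hσ2 : Summable fun i => σ i ^ 2) :
    ∃ K : ℝ, 0 ≤ K ∧ ∀ f : V →L[ℂ] ℂ, (∀ x, ‖f x‖ ≤ q x) → ∀ s : Finset ι,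
      ∑ i ∈ s, σ i * ‖f (Z (lp.single 2 i 1))‖ ≤ K := by
  obtain ⟨N, hN, hNb⟩ := (q.comp Z.toLinearMap).bound_of_continuous_normedSpace
    (hq.comp Z.continuous)
  refine ⟨N * √(∑' i, σ i ^ 2), by positivity, fun f hf s => ?_⟩
  set w : ι → ℂ := fun i => f (Z (lp.single 2 i 1))
  -- The phases make all terms of `f (Z a)` nonnegative, so the desired sum is a value of `f ∘ Z` at
  -- a vector of norm at most `√(∑ σ²)`.
  set θ : ι → ℂ := fun i => σ i * ((starRingEnd ℂ) (w i) / ‖w i‖)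
  have hθ : ∀ i, ‖θ i‖ ≤ σ i := fun i => by
    simp only [θ]
    rw [norm_mul, norm_div, Complex.norm_conj, Complex.norm_real, Complex.norm_real, norm_norm,
      Real.norm_of_nonneg (hσ i)]
    exact mul_le_of_le_one_right (hσ i) (div_self_le_one _)
  set a : lp (fun _ : ι => ℂ) 2 := ∑ i ∈ s, lp.single 2 i (θ i)
  have hfa : f (Z a) = ((∑ i ∈ s, σ i * ‖w i‖ : ℝ) : ℂ) := by
    simp only [a, map_sum]
    push_cast
    refine Finset.sum_congr rfl fun i _ => ?_
    have : lp.single 2 i (θ i) = θ i • lp.single (E := fun _ : ι => ℂ) 2 i (1 : ℂ) := by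
      rw [← lp.single_smul, smul_eq_mul, mul_one]
    rw [this, map_smul, map_smul, smul_eq_mul]
    change θ i * w i = _
    simp only [θ]
    rw [mul_assoc, div_mul_eq_mul_div, Complex.conj_mul']
    rcases eq_or_ne (‖w i‖ : ℂ) 0 with h0 | h0
    · simp [h0]
    · field_simp
  have ha : ‖a‖ ≤ √(∑' i, σ i ^ 2) := by
    refine Real.le_sqrt_of_sq_le ?_
    have := lp.norm_sum_single (E := fun _ : ι => ℂ) (p := 2) (by norm_num) θ s
    simp only [ENNReal.toReal_ofNat, Real.rpow_ofNat] at this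
    rw [this]
    exact (Finset.sum_le_sum fun i _ => pow_le_pow_left₀ (norm_nonneg _) (hθ i) 2).trans
      (hσ2.sum_le_tsum s fun i _ => sq_nonneg _)
  have h1 : ‖f (Z a)‖ = ∑ i ∈ s, σ i * ‖w i‖ := by
    rw [hfa, Complex.norm_real, Real.norm_of_nonneg
      (Finset.sum_nonneg fun i _ => mul_nonneg (hσ i) (norm_nonneg _))]
  rw [← h1]
  exact ((hf _).trans (hNb a)).trans (mul_le_mul_of_nonneg_left ha hN.le)

end Reconstruction

/-! ### Expansions in nuclear Fréchet spaces -/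

section Nuclear

variable {V : Type*} [AddCommGroup V] [Module ℂ V]

theorem LinearMap.continuous_of_norm_le_seminorm [TopologicalSpace V] [IsTopologicalAddGroup V]
    {f : V →ₗ[ℂ] ℂ} {q : Seminorm ℂ V} (hq : Continuous q) (h : ∀ x, ‖f x‖ ≤ q x) :
    Continuous f := by
  refine continuous_of_continuousAt_zero f ?_
  rw [ContinuousAt, map_zero, tendsto_zero_iff_norm_tendsto_zero]
  exact squeeze_zero (fun x => norm_nonneg _) h (map_zero q ▸ hq.tendsto 0)

theorem IsNuclearSpace.exists_functionals [TopologicalSpace V] [IsTopologicalAddGroup V]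
    (hV : IsNuclearSpace V) {p : Seminorm ℂ V} (hp : Continuous p) :
    ∃ q : Seminorm ℂ V, Continuous q ∧ ∃ (f : ℕ → V →L[ℂ] ℂ) (y : ℕ → V) (a : ℕ → ℝ),
      (∀ n, 0 < a n) ∧ Summable a ∧ (∀ n x, ‖f n x‖ ≤ q x) ∧ (∀ n, p (y n) ≤ a n) ∧
      ∀ x, Tendsto (fun N => p (x - ∑ n ∈ Finset.range N, f n x • y n)) atTop (𝓝 0) := by
  obtain ⟨q, hq, f, y, hf, hy, hlim⟩ := hV p hp
  -- Adding `2⁻ⁿ` makes the weights positive, so that they can be inverted.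
  refine ⟨q, hq, fun n => ⟨f n, LinearMap.continuous_of_norm_le_seminorm hq (hf n)⟩, y,
    fun n => p (y n) + (1 / 2) ^ n, fun n => add_pos_of_nonneg_of_pos (apply_nonneg _ _)
      (by positivity), hy.add summable_geometric_two, hf, fun n => ?_, hlim⟩
  exact le_add_of_nonneg_right (by positivity)

theorem le_tsum_of_tendsto [TopologicalSpace V] {p q : Seminorm ℂ V} {f : ℕ → V →L[ℂ] ℂ}
    {y : ℕ → V} {a : ℕ → ℝ}
    (ha : ∀ n, 0 < a n) (has : Summable a) (hf : ∀ n x, ‖f n x‖ ≤ q x) (hy : ∀ n, p (y n) ≤ a n)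
    {x : V} (hlim : Tendsto (fun N => p (x - ∑ n ∈ Finset.range N, f n x • y n)) atTop (𝓝 0)) :
    Summable (fun n => a n * ‖f n x‖) ∧ p x ≤ ∑' n, a n * ‖f n x‖ := by
  have hs : Summable fun n => a n * ‖f n x‖ :=
    Summable.of_nonneg_of_le (fun n => mul_nonneg (ha n).le (norm_nonneg _))
      (fun n => mul_le_mul_of_nonneg_left (hf n x) (ha n).le) (has.mul_right (q x))
  refine ⟨hs, ?_⟩
  have h1 := hlim.add_const (∑' n, a n * ‖f n x‖)
  rw [zero_add] at h1
  refine ge_of_tendsto' h1 fun N => ?_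
  have h2 : p (∑ n ∈ Finset.range N, f n x • y n) ≤ ∑' n, a n * ‖f n x‖ := by
    refine (Seminorm.map_sum_le _ _ _).trans ((Finset.sum_le_sum fun n _ => ?_).trans
      (hs.sum_le_tsum _ fun n _ => mul_nonneg (ha n).le (norm_nonneg _)))
    rw [map_smul_eq_mul, mul_comm]
    exact mul_le_mul_of_nonneg_right (hy n) (norm_nonneg _)
  have h3 := map_add_le_add p (x - ∑ n ∈ Finset.range N, f n x • y n)
    (∑ n ∈ Finset.range N, f n x • y n)
  rw [sub_add_cancel] at h3
  linarith

/-- Partial sums of the nuclear expansion factor through `ℓ¹` once the weight `a n` is moved from `y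
n` to `f n`; then `∑ a n * ‖f n x‖ ≤ (∑ a n) * q x`. Adding `p` only secures `p ≤ p'`. -/
theorem IsNuclearSpace.exists_isEllOneApproximable [TopologicalSpace V] [IsTopologicalAddGroup V]
    (hV : IsNuclearSpace V) {p : Seminorm ℂ V} (hp : Continuous p) :
    ∃ p' : Seminorm ℂ V, Continuous p' ∧ p ≤ p' ∧ IsEllOneApproximable p p' := by
  obtain ⟨q, hq, f, y, a, ha, has, hf, hy, hlim⟩ := hV.exists_functionals hp
  set A : NNReal := ⟨∑' n, a n, tsum_nonneg fun n => (ha n).le⟩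
  refine ⟨A • q + p, ?_, fun x => ?_, fun s ε hε => ?_⟩
  · exact (continuous_const.mul hq).add hp
  · exact le_add_of_nonneg_left (apply_nonneg (A • q) x)
  · have hev : ∀ᶠ N in atTop, ∀ x ∈ s, p (x - ∑ n ∈ Finset.range N, f n x • y n) < ε :=
      (Finset.eventually_all s).2 fun x _ => (hlim x).eventually (gt_mem_nhds hε)
    obtain ⟨N, hN⟩ := hev.exists
    refine ⟨Fin N, inferInstance, fun n => (a n : ℂ) • f n, fun n => (a n : ℂ)⁻¹ • y n,
      fun n => ?_, fun x => ?_, fun x hx => ?_⟩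
    · rw [map_smul_eq_mul, norm_inv, Complex.norm_real, Real.norm_of_nonneg (ha n).le,
        inv_mul_le_iff₀ (ha n), mul_one]
      exact hy n
    · calc ∑ n : Fin N, ‖((a n : ℂ) • f n) x‖ ≤ ∑ n : Fin N, a n * q x :=
            Finset.sum_le_sum fun n _ => by
              rw [smul_apply, norm_smul, Complex.norm_real,
                Real.norm_of_nonneg (ha n).le]
              exact mul_le_mul_of_nonneg_left (hf n x) (ha n).le
        _ = (∑ n ∈ Finset.range N, a n) * q x := by
          rw [Finset.sum_mul, Finset.sum_range fun n => a n * q x]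
        _ ≤ (∑' n, a n) * q x := mul_le_mul_of_nonneg_right
          (has.sum_le_tsum _ fun n _ => (ha n).le) (apply_nonneg _ _)
        _ ≤ (∑' n, a n) * q x + p x := le_add_of_nonneg_right (apply_nonneg _ _)
    · have := hN x hx
      rw [Finset.sum_range] at this
      convert this using 4 with n
      have hn : (a n : ℂ) ≠ 0 := by exact_mod_cast (ha n).ne'
      rw [smul_apply, smul_smul, smul_eq_mul, mul_comm (a n : ℂ),
        mul_inv_cancel_right₀ hn]

/-- A Cauchy–Schwarz inequality with summable weights. -/
theorem tsum_mul_le_sqrt {a b : ℕ → ℝ} (ha : ∀ n, 0 ≤ a n) (has : Summable a) (hb : ∀ n, 0 ≤ b n)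
    {B : ℝ} (hB : ∀ N, ∑ n ∈ Finset.range N, a n * b n ^ 2 ≤ B) :
    ∑' n, a n * b n ≤ √((∑' n, a n) * B) := by
  refine Real.tsum_le_of_sum_range_le (fun n => mul_nonneg (ha n) (hb n)) fun N =>
    Real.le_sqrt_of_sq_le ?_
  have h1 : ∀ n, a n * b n = √(a n) * (√(a n) * b n) := fun n => by
    rw [← mul_assoc, Real.mul_self_sqrt (ha n)]
  have h2 : ∀ n, (√(a n) * b n) ^ 2 = a n * b n ^ 2 := fun n => by
    rw [mul_pow, Real.sq_sqrt (ha n)]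
  rw [Finset.sum_congr rfl fun n _ => h1 n]
  refine (Finset.sum_mul_sq_le_sq_mul_sq _ _ _).trans ?_
  rw [Finset.sum_congr rfl fun n _ => h2 n, Finset.sum_congr rfl fun n _ => Real.sq_sqrt (ha n)]
  exact mul_le_mul (has.sum_le_tsum _ fun n _ => ha n) (hB N)
    (Finset.sum_nonneg fun n _ => mul_nonneg (ha n) (sq_nonneg _)) (tsum_nonneg ha)

/-- Square-summable weights on `ℕ × ℕ` dominated by given summable rows. -/
theorem exists_square_summable_weights {a : ℕ → ℕ → ℝ} (ha : ∀ k n, 0 < a k n)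
    (has : ∀ k, Summable (a k)) (c : ℕ → ℝ) :
    ∃ (δ : ℕ → ℝ) (t : ℕ × ℕ → ℝ), (∀ k, 0 < δ k) ∧ (∀ j, 0 < t j) ∧
      (∀ j, t j ^ 2 = δ j.1 * a j.1 j.2) ∧ Summable fun j : ℕ × ℕ => (t j * c j.1) ^ 2 := by
  have hA : ∀ k, 0 ≤ c k ^ 2 * ∑' n, a k n := fun k =>
    mul_nonneg (sq_nonneg _) (tsum_nonneg fun n => (ha k n).le)
  obtain ⟨δ, hδ, hδs, -⟩ := exists_pos_weights hA
  have ht2 : ∀ j : ℕ × ℕ, √(δ j.1 * a j.1 j.2) ^ 2 = δ j.1 * a j.1 j.2 := fun j =>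
    Real.sq_sqrt (mul_pos (hδ _) (ha _ _)).le
  refine ⟨δ, fun j => √(δ j.1 * a j.1 j.2), hδ, fun j => Real.sqrt_pos.2 (mul_pos (hδ _) (ha _ _)),
    ht2, ?_⟩
  have h1 : (fun j : ℕ × ℕ => (√(δ j.1 * a j.1 j.2) * c j.1) ^ 2) =
      fun j => δ j.1 * c j.1 ^ 2 * a j.1 j.2 := by
    ext j
    rw [mul_pow, ht2]
    ring
  have h2 : 0 ≤ fun j : ℕ × ℕ => δ j.1 * c j.1 ^ 2 * a j.1 j.2 := fun j =>
    mul_nonneg (mul_nonneg (hδ j.1).le (sq_nonneg (c j.1))) (ha j.1 j.2).le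
  have h3 : (fun k => ∑' n, δ k * c k ^ 2 * a k n) = fun k => δ k * (c k ^ 2 * ∑' n, a k n) := by
    ext k
    rw [tsum_mul_left, mul_assoc]
  rw [h1, summable_prod_of_nonneg h2]
  exact ⟨fun k => (has k).mul_left (δ k * c k ^ 2), h3 ▸ hδs⟩

/-- The sum over `j` is moved inside the expansion of `p`, where the bound `K` is uniform in the
functional. -/
theorem summable_mul_seminorm {ι : Type*} {σ : ι → ℝ} (hσ : ∀ j, 0 ≤ σ j) {p : Seminorm ℂ V}
    {z : ι → V} {f : ℕ → V → ℂ} {a : ℕ → ℝ} (ha : ∀ n, 0 ≤ a n) (has : Summable a)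
    (hle : ∀ x, Summable (fun n => a n * ‖f n x‖) ∧ p x ≤ ∑' n, a n * ‖f n x‖) {K : ℝ}
    (hK : ∀ n (s : Finset ι), ∑ j ∈ s, σ j * ‖f n (z j)‖ ≤ K) :
    Summable fun j => σ j * p (z j) := by
  refine summable_of_sum_le (c := (∑' n, a n) * K)
    (fun j => mul_nonneg (hσ j) (apply_nonneg _ _)) fun s => ?_
  have hs : ∀ j ∈ s, Summable fun n => σ j * (a n * ‖f n (z j)‖) := fun j _ =>
    (hle (z j)).1.mul_left _
  calc ∑ j ∈ s, σ j * p (z j) ≤ ∑ j ∈ s, ∑' n, σ j * (a n * ‖f n (z j)‖) :=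
        Finset.sum_le_sum fun j _ => by
          rw [tsum_mul_left]
          exact mul_le_mul_of_nonneg_left (hle (z j)).2 (hσ j)
    _ = ∑' n, ∑ j ∈ s, σ j * (a n * ‖f n (z j)‖) := (Summable.tsum_finsetSum hs).symm
    _ ≤ ∑' n, a n * K := by
      refine Summable.tsum_le_tsum (fun n => ?_) (summable_sum hs) (has.mul_right K)
      simp only [mul_left_comm (σ _) (a n), ← Finset.mul_sum]
      exact mul_le_mul_of_nonneg_left (hK n s) (ha n)
    _ = (∑' n, a n) * K := tsum_mul_right

/-- A nuclear Fréchet space has reconstruction formulas `x = ∑ⱼ Jⱼ(x) zⱼ` with prescribed decay. -/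
theorem IsNuclearSpace.exists_coefficients [UniformSpace V] [IsUniformAddGroup V]
    [ContinuousSMul ℂ V] [T2Space V] [CompleteSpace V] (hV : IsNuclearSpace V)
    {P : ℕ → Seminorm ℂ V} (hP : WithSeminorms P) :
    ∃ q : ℕ → Seminorm ℂ V, (∀ k, Continuous (q k)) ∧ ∀ c : ℕ → ℝ, (∀ k, 0 < c k) →
      ∃ (m : ℕ → ℕ) (J : ℕ → V →L[ℂ] ℂ) (z : ℕ → V) (σ : ℕ → ℝ), (∀ j, 0 < σ j) ∧
        Summable (fun j => σ j ^ 2) ∧ (∀ j x, c (m j) * ‖J j x‖ ≤ σ j * q (m j) x) ∧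
        (∀ k, Summable fun j => σ j * P k (z j)) ∧
        ∀ x, Summable (fun j => ‖J j x‖ ^ 2) → HasSum (fun j => J j x • z j) x := by
  choose q hq f y a ha has hf hy hlim using fun k => hV.exists_functionals (hP.continuous_seminorm k)
  have hle := fun k x => le_tsum_of_tendsto (ha k) (has k) (hf k) (hy k) (hlim k x)
  -- The seminorms `q` are fixed before `c`, since in the application `c` depends on constants that
  -- compare `q` with `P`.
  refine ⟨q, hq, fun c hc => ?_⟩
  obtain ⟨δ, t, hδ, htpos, ht2, hσ2⟩ := exists_square_summable_weights ha has c
  have hσpos : ∀ j : ℕ × ℕ, 0 < t j * c j.1 := fun j => mul_pos (htpos j) (hc j.1)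
  obtain ⟨J, hJ⟩ : ∃ J : ℕ × ℕ → V →L[ℂ] ℂ, ∀ j x, ‖J j x‖ = t j * ‖f j.1 j.2 x‖ :=
    ⟨fun j => (t j : ℂ) • f j.1 j.2, fun j x => by
      rw [smul_apply, norm_smul, Complex.norm_real, Real.norm_of_nonneg (htpos j).le]⟩
  -- Cauchy–Schwarz with weights `a k`: as `t² = δ * a`, the sum `∑ₙ a k n * ‖f k n x‖²` is at most
  -- `(δ k)⁻¹` times the square of the `ℓ²` norm of the coefficients.
  have hbound : ∀ k x, Summable (fun j => ‖J j x‖ ^ 2) →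
      P k x ≤ √((∑' n, a k n) * (δ k)⁻¹) * √(∑' j, ‖J j x‖ ^ 2) := fun k x hx => by
    have hA : 0 ≤ ∑' n, a k n := tsum_nonneg fun n => (ha k n).le
    rw [← Real.sqrt_mul (mul_nonneg hA (inv_pos.2 (hδ k)).le), mul_assoc]
    refine (hle k x).2.trans (tsum_mul_le_sqrt (fun n => (ha k n).le) (has k)
      (fun n => norm_nonneg _) fun N => ?_)
    rw [← div_eq_inv_mul, le_div_iff₀ (hδ k), Finset.sum_mul]
    have h2 : ∀ n, a k n * ‖f k n x‖ ^ 2 * δ k = ‖J (k, n) x‖ ^ 2 := fun n => by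
      rw [hJ, mul_pow, ht2]
      ring
    rw [Finset.sum_congr rfl fun n _ => h2 n]
    have := hx.sum_le_tsum ((Finset.range N).map (Function.Embedding.sectR k ℕ))
      fun j _ => sq_nonneg _
    rwa [Finset.sum_map] at this
  obtain ⟨Z, hZ⟩ := exists_reconstruction hP (fun j => (J j).toLinearMap) _ hbound
  have hz : ∀ k, Summable fun j : ℕ × ℕ => t j * c j.1 * P k (Z (lp.single 2 j 1)) := fun k => by
    obtain ⟨K, hK, hKf⟩ := exists_sum_norm_le Z (hq k) (fun j => (hσpos j).le) hσ2
    exact summable_mul_seminorm (fun j => (hσpos j).le) (fun n => (ha k n).le) (has k)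
      (fun x => hle k x) fun n s => hKf _ (hf k n) s
  obtain ⟨e⟩ : Nonempty (ℕ ≃ ℕ × ℕ) := ⟨Nat.pairEquiv.symm⟩
  refine ⟨fun i => (e i).1, fun i => J (e i), fun i => Z (lp.single 2 (e i) 1),
    fun i => t (e i) * c (e i).1, fun i => hσpos _, ?_, fun i x => ?_, fun k => ?_,
    fun x hx => ?_⟩
  · exact hσ2.comp_injective e.injective
  · rw [hJ, ← mul_assoc, mul_comm (c _)]
    exact mul_le_mul_of_nonneg_left (hf _ _ _) (hσpos _).le
  · exact (hz k).comp_injective e.injective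
  · exact e.hasSum_iff.2 (hZ x (e.summable_iff.1 hx))

end Nuclear

/-- Countably many summable sequences are dominated, up to constants, by one summable sequence. -/
theorem exists_dominating_summable {x : ℕ → ℕ → ℝ} (hx : ∀ k j, 0 ≤ x k j)
    (hs : ∀ k, Summable (x k)) : ∃ l : ℕ → ℝ, (∀ j, 0 < l j) ∧ Summable l ∧
      ∀ k, ∃ M : ℝ, 0 < M ∧ ∀ j, x k j ≤ M * l j := by
  obtain ⟨d, hd, hds, -⟩ := exists_pos_weights fun k => tsum_nonneg (hx k)
  have hF : Summable fun i : ℕ × ℕ => d i.1 * x i.1 i.2 := by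
    have h0 : 0 ≤ fun i : ℕ × ℕ => d i.1 * x i.1 i.2 := fun i => mul_nonneg (hd i.1).le (hx i.1 i.2)
    rw [summable_prod_of_nonneg h0]
    refine ⟨fun k => (hs k).mul_left (d k), ?_⟩
    simpa only [tsum_mul_left] using hds
  have hG := hF.prod_symm
  have hnn : ∀ j k, 0 ≤ d k * x k j := fun j k => mul_nonneg (hd k).le (hx k j)
  refine ⟨fun j => ∑' k, d k * x k j + (1 / 2) ^ j, fun j =>
    add_pos_of_nonneg_of_pos (tsum_nonneg (hnn j)) (by positivity),
    hG.prod.add summable_geometric_two, fun k => ⟨(d k)⁻¹, inv_pos.2 (hd k), fun j => ?_⟩⟩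
  rw [le_inv_mul_iff₀ (hd k)]
  exact ((hG.prod_factor j).le_tsum k fun i _ => hnn j i).trans
    (le_add_of_nonneg_right (by positivity))

namespace CompletedProjTensor

/-! ### Lifting bounded sets with a nuclear factor -/

section Nuclear

variable {V₁ V₂ : Type*} [AddCommGroup V₁] [Module ℂ V₁] [UniformSpace V₁] [IsUniformAddGroup V₁]
  [AddCommGroup V₂] [Module ℂ V₂] [UniformSpace V₂] [IsUniformAddGroup V₂]
  {p : ℕ → Seminorm ℂ V₁} {q : ℕ → Seminorm ℂ V₂}

theorem slice_le {p : Seminorm ℂ V₁} {q : Seminorm ℂ V₂} (hp : Continuous p) (hq : Continuous q)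
    {f : V₁ →L[ℂ] ℂ} {a : ℝ} (ha : 0 < a) (hf : ∀ x, ‖f x‖ ≤ a * p x)
    {B : CompletedProjTensor V₁ V₂ →L[ℂ] V₂} (hB : ∀ x y, B (natural V₁ V₂ x y) = f x • y)
    (u : CompletedProjTensor V₁ V₂) : q (B u) ≤ a * seminorm hp hq u := by
  rw [← inv_mul_le_iff₀ ha]
  let b : NNReal := ⟨a⁻¹, (inv_pos.2 ha).le⟩
  have hc : Continuous ⇑(b • q.comp B.toLinearMap) :=
    (continuous_const (y := a⁻¹)).mul (hq.comp B.continuous)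
  refine le_seminorm hp hq hc (fun x y => ?_) u
  change a⁻¹ * q (B (natural V₁ V₂ x y)) ≤ _
  rw [inv_mul_le_iff₀ ha, hB, map_smul_eq_mul, ← mul_assoc]
  exact mul_le_mul_of_nonneg_right (hf x) (apply_nonneg _ _)

variable [ContinuousSMul ℂ V₁] [LocallyConvexSpace ℝ V₁] [T2Space V₁] [CompleteSpace V₁]
  [ContinuousSMul ℂ V₂] [LocallyConvexSpace ℝ V₂] [T2Space V₂] [CompleteSpace V₂]

/-- If `V₁` is nuclear, then the slices by functionals on `V₁` separate the points of the
completed projective tensor product. -/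
theorem eq_zero_of_forall_slice_left (hV : IsNuclearSpace V₁) (hp : WithSeminorms p)
    (hq : WithSeminorms q) (hpm : Monotone p) (hqm : Monotone q) {u : CompletedProjTensor V₁ V₂}
    (hu : ∀ (f : V₁ →L[ℂ] ℂ) (B : CompletedProjTensor V₁ V₂ →L[ℂ] V₂),
      (∀ x y, B (natural V₁ V₂ x y) = f x • y) → B u = 0) : u = 0 := by
  by_contra hne
  obtain ⟨k, hk⟩ := (withSeminorms hp hq hpm hqm).separating_of_T1 u hne
  obtain ⟨p', hp', hpp, h⟩ := hV.exists_isEllOneApproximable (hp.continuous_seminorm k)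
  -- The accuracy is the seminorm of `u` itself, whereas the approximant is built from slices and
  -- vanishes.
  obtain ⟨ι, _, f, e, B, -, hB, -, hlt⟩ := exists_approx (hp.continuous_seminorm k) hp' hpp
    (hq.continuous_seminorm k) h u (lt_of_le_of_ne (apply_nonneg _ _) (Ne.symm hk))
  simp [hu _ _ (hB _)] at hlt

/-- If `V₁` is nuclear, then the slices by functionals on `V₂` separate the points of the
completed projective tensor product. -/
theorem eq_zero_of_forall_slice_right (hV : IsNuclearSpace V₁) (hp : WithSeminorms p)
    (hq : WithSeminorms q) (hpm : Monotone p) (hqm : Monotone q) {u : CompletedProjTensor V₁ V₂}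
    (hu : ∀ (g : V₂ →L[ℂ] ℂ) (G : CompletedProjTensor V₁ V₂ →L[ℂ] V₁),
      (∀ x y, G (natural V₁ V₂ x y) = g y • x) → G u = 0) : u = 0 := by
  refine eq_zero_of_forall_slice_left hV hp hq hpm hqm fun f B hB => ?_
  by_contra hne
  obtain ⟨g, hg⟩ := RCLike.geometric_hahn_banach_point_point (𝕜 := ℂ) hne
  obtain ⟨G, hG⟩ := exists_slice_right (V₁ := V₁) g
  -- Slicing in both factors commutes: both maps send `x ⊗ y` to `f x * g y`.
  have h : f.comp G = g.comp B := map_ext fun x y => by simp [hB, hG, mul_comm]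
  have h0 : g (B u) = f (G u) := (DFunLike.congr_fun h u).symm
  rw [h0, hu g G hG, map_zero, map_zero] at hg
  simp at hg

/-- With `Bⱼ` the slice by `Jⱼ`, one expects `u = ∑ zⱼ ⊗ Bⱼ u`. The decay of `Jⱼ` is adapted to `S`
so that all `σⱼ⁻¹ Bⱼ u` lie in one bounded set, while `σⱼ zⱼ` is a summable `lⱼ` times a bounded
sequence. The series then converges in every competing disk, and its sum is identified with `u` by
slicing with functionals on `V₂`. -/
theorem bismallBornology_eq_of_isNuclearSpace (hV : IsNuclearSpace V₁) (hp : WithSeminorms p)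
    (hq : WithSeminorms q) (hpm : Monotone p) (hqm : Monotone q) :
    bismallBornology V₁ V₂ = boundedBornology (CompletedProjTensor V₁ V₂) := by
  refine (bismallBornology_subset hp hq hpm hqm).antisymm fun S hS => ?_
  have hP := withSeminorms hp hq hpm hqm
  have hm := monotone_seminorm hp hq hpm hqm
  have := hP.continuousSMul
  have hreal := continuousSMul_real (CompletedProjTensor V₁ V₂)
  -- Constants at least `1` give `C (max k l) ≤ C k * C l`, which separates the bounds for the two
  -- factors.
  obtain ⟨C, hC1, hC⟩ : ∃ C : ℕ → ℝ, (∀ k, 1 ≤ C k) ∧ ∀ k, ∀ u ∈ S,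
      seminorm (hp.continuous_seminorm k) (hq.continuous_seminorm k) u ≤ C k := by
    choose C _ hC using hP.isVonNBounded_iff_seminorm_bounded.1 hS
    exact ⟨fun k => max 1 (C k), fun k => le_max_left _ _,
      fun k u hu => (hC k u hu).le.trans (le_max_right _ _)⟩
  have hC0 : ∀ k, 0 < C k := fun k => one_pos.trans_le (hC1 k)
  obtain ⟨n, hn, hcoef⟩ := hV.exists_coefficients hp
  choose κ D hD hκ using fun k => hp.exists_le hpm (hn k)
  obtain ⟨m, J, z, σ, hσ, hσ2, hJ, hz, hsum⟩ := hcoef (fun k => D k * C (κ k))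
    fun k => mul_pos (hD k) (hC0 _)
  choose B hB using fun j => exists_slice_left (V₁ := V₁) (V₂ := V₂) (J j)
  have hJ' : ∀ j x, ‖J j x‖ ≤ σ j / C (κ (m j)) * p (κ (m j)) x := fun j x => by
    have h1 : D (m j) * C (κ (m j)) * ‖J j x‖ ≤ σ j * (D (m j) * p (κ (m j)) x) :=
      (hJ j x).trans (mul_le_mul_of_nonneg_left (hκ _ x) (hσ j).le)
    rw [div_mul_eq_mul_div, le_div_iff₀ (hC0 _)]
    refine le_of_mul_le_mul_left ?_ (hD (m j))
    linarith
  have hBu : ∀ j l, ∀ u ∈ S, q l (B j u) ≤ σ j * C l := fun j l u hu => by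
    have h1 := slice_le (hp.continuous_seminorm (κ (m j))) (hq.continuous_seminorm l)
      (div_pos (hσ j) (hC0 _)) (hJ' j) (hB j) u
    have h2 : seminorm (hp.continuous_seminorm (κ (m j))) (hq.continuous_seminorm l) u ≤
        C (κ (m j)) * C l := by
      refine (seminorm_mono _ _ (hp.continuous_seminorm (max (κ (m j)) l))
        (hq.continuous_seminorm (max (κ (m j)) l)) (hpm (le_max_left _ _))
        (hqm (le_max_right _ _)) u).trans ((hC _ u hu).trans ?_)
      rcases max_choice (κ (m j)) l with h | h <;> rw [h]
      · exact le_mul_of_one_le_right (hC0 _).le (hC1 _)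
      · exact le_mul_of_one_le_left (hC0 _).le (hC1 _)
    refine h1.trans ((mul_le_mul_of_nonneg_left h2 (div_pos (hσ j) (hC0 _)).le).trans_eq ?_)
    rw [← mul_assoc, div_mul_cancel₀ _ (hC0 _).ne']
  obtain ⟨l, hl, hls, hlM⟩ := exists_dominating_summable
    (fun k j => mul_nonneg (hσ j).le (apply_nonneg (p k) (z j))) hz
  choose M hM hlM using hlM
  have hB₁ : range (fun j => ((σ j / l j : ℝ) : ℂ) • z j) ∈ boundedBornology V₁ :=
    hp.isVonNBounded_iff_seminorm_bounded.2 fun k => ⟨M k + 1, by linarith [hM k], by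
      rintro _ ⟨j, rfl⟩
      rw [map_smul_eq_mul, Complex.norm_real, Real.norm_of_nonneg (div_pos (hσ j) (hl j)).le,
        div_mul_eq_mul_div, div_lt_iff₀ (hl j)]
      have := hlM k j
      have := hl j
      linarith⟩
  have hB₂ : {y | ∀ k, q k y ≤ C k} ∈ boundedBornology V₂ :=
    hq.isVonNBounded_iff_seminorm_bounded.2 fun k => ⟨C k + 1, by linarith [hC0 k],
      fun y hy => (hy k).trans_lt (lt_add_one _)⟩
  -- The added `1` makes the normalized coefficients `Λ⁻¹ * l j` sum to less than `1`.
  set Λ : ℝ := ∑' j, l j + 1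
  have hΛ : 0 < Λ := add_pos_of_nonneg_of_pos (tsum_nonneg fun j => (hl j).le) one_pos
  refine mem_bismallBornology hp hq hpm hqm hB₁ hB₂ hΛ fun T hT hTc hsub u hu => ?_
  have hmemT : ∀ j, natural V₁ V₂ (z j) (B j u) ∈ l j • T := fun j => by
    have hσc : (σ j : ℂ) ≠ 0 := by exact_mod_cast (hσ j).ne'
    have hlc : (l j : ℂ) ≠ 0 := by exact_mod_cast (hl j).ne'
    refine ⟨natural V₁ V₂ (((σ j / l j : ℝ) : ℂ) • z j) ((σ j : ℂ)⁻¹ • B j u),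
      hsub ⟨_, mem_range_self j, _, fun k => ?_, rfl⟩, ?_⟩
    · rw [map_smul_eq_mul, norm_inv, Complex.norm_real, Real.norm_of_nonneg (hσ j).le,
        inv_mul_le_iff₀ (hσ j)]
      exact hBu j k u hu
    · simp only [← Complex.coe_smul, map_smul, LinearMap.smul_apply, smul_smul]
      push_cast
      rw [show (l j : ℂ) * ((σ j : ℂ)⁻¹ * (σ j / l j)) = 1 by field_simp, one_smul]
  obtain ⟨X, hX, hlim⟩ := hTc.exists_gaugeTendsto_sum (l := fun j => Λ⁻¹ * l j)
    (fun j => mul_nonneg (inv_pos.2 hΛ).le (hl j).le) (hls.mul_left _)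
    (by
      rw [tsum_mul_left, inv_mul_lt_iff₀ hΛ, mul_one]
      exact lt_add_one _)
    (v := fun j => Λ⁻¹ • natural V₁ V₂ (z j) (B j u)) fun j => by
      rw [mul_smul]
      exact smul_mem_smul_set (hmemT j)
  have hlim' : Tendsto (fun N => ∑ j ∈ Finset.range N, natural V₁ V₂ (z j) (B j u)) atTop
      (𝓝 (Λ • X)) := by
    have := (hlim.tendsto hT).const_smul Λ
    simpa only [Finset.smul_sum, smul_inv_smul₀ hΛ.ne'] using this
  refine ⟨X, hX, sub_eq_zero.1 (eq_zero_of_forall_slice_right hV hp hq hpm hqm fun g G hG => ?_)⟩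
  rw [map_sub, sub_eq_zero]
  have hJG : ∀ j, J j (G u) = g (B j u) := fun j => by
    have h : (J j).comp G = g.comp (B j) := map_ext fun x y => by simp [hB, hG, mul_comm]
    exact DFunLike.congr_fun h u
  obtain ⟨k, K, hK, hgK⟩ := hq.exists_le hqm (q := (normSeminorm ℂ ℂ).comp g.toLinearMap)
    (continuous_norm.comp g.continuous)
  -- The reconstruction formula applies to `G u` because `‖Jⱼ (G u)‖ = ‖g (Bⱼ u)‖` is at most a
  -- constant times `σⱼ`.
  have hsq : Summable fun j => ‖J j (G u)‖ ^ 2 := by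
    refine Summable.of_nonneg_of_le (fun j => sq_nonneg _) (fun j => ?_)
      (hσ2.mul_left ((K * C k) ^ 2))
    rw [← mul_pow, hJG]
    refine pow_le_pow_left₀ (norm_nonneg _) ((hgK (B j u)).trans ?_) 2
    rw [mul_assoc, mul_comm (C k)]
    exact mul_le_mul_of_nonneg_left (hBu j k u hu) hK.le
  refine tendsto_nhds_unique ((G.continuous.tendsto _).comp hlim') ?_
  refine (hsum _ hsq).tendsto_sum_nat.congr fun N => ?_
  simp [hG, hJG]

end Nuclear

end CompletedProjTensor

end

theorem CompletedProjTensor.bismallBornology_eq_of_isNuclearSpace_or {V₁ V₂ : Type*} [AddCommGroup V₁]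
    [Module ℂ V₁] [UniformSpace V₁]
    [IsUniformAddGroup V₁] [ContinuousSMul ℂ V₁] [LocallyConvexSpace ℝ V₁]
    [TopologicalSpace.MetrizableSpace V₁] [CompleteSpace V₁] [AddCommGroup V₂] [Module ℂ V₂]
    [UniformSpace V₂] [IsUniformAddGroup V₂] [ContinuousSMul ℂ V₂] [LocallyConvexSpace ℝ V₂]
    [TopologicalSpace.MetrizableSpace V₂] [CompleteSpace V₂]
    (h : IsNuclearSpace V₁ ∨ IsNuclearSpace V₂) :
    bismallBornology V₁ V₂ = boundedBornology (CompletedProjTensor V₁ V₂) := by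
  obtain ⟨p, hpm, hp⟩ := exists_monotone_withSeminorms (X := V₁)
  obtain ⟨q, hqm, hq⟩ := exists_monotone_withSeminorms (X := V₂)
  rcases h with h | h
  · exact bismallBornology_eq_of_isNuclearSpace h hp hq hpm hqm
  · exact bismallBornology_eq_of_swap hp hq hpm hqm
      (bismallBornology_eq_of_isNuclearSpace h hq hp hqm hpm)

/-! ### The main theorem -/

theorem mainTheorem10
    (V₁ : Type u₁) [AddCommGroup V₁] [Module ℂ V₁] [UniformSpace V₁] [IsUniformAddGroup V₁]
    [ContinuousSMul ℂ V₁] [LocallyConvexSpace ℝ V₁] [TopologicalSpace.MetrizableSpace V₁]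
    [CompleteSpace V₁]
    (V₂ : Type u₂) [AddCommGroup V₂] [Module ℂ V₂] [UniformSpace V₂] [IsUniformAddGroup V₂]
    [ContinuousSMul ℂ V₂] [LocallyConvexSpace ℝ V₂] [TopologicalSpace.MetrizableSpace V₂]
    [CompleteSpace V₂] :
    -- the completed projective tensor product with the precompact bornology is a completed
    -- bornological tensor product of the factors with their precompact bornologies
    IsCompletedTensorProduct.{u₁, u₂, max u₁ u₂, w}
      (precompactBornology V₁) (precompactBornology V₂)
      (precompactBornology (CompletedProjTensor V₁ V₂)) (CompletedProjTensor.natural V₁ V₂) ∧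
    -- so the natural map induces a bornological isomorphism from any such tensor product
    (∀ (T : Type (max u₁ u₂)) [AddCommGroup T] [Module ℂ T] (𝔗 : Set (Set T))
      (b : V₁ →ₗ[ℂ] V₂ →ₗ[ℂ] T),
      IsCompletedTensorProduct.{u₁, u₂, max u₁ u₂, max u₁ u₂}
        (precompactBornology V₁) (precompactBornology V₂) 𝔗 b →
      ∃ e : T ≃ₗ[ℂ] CompletedProjTensor V₁ V₂,
        IsBornologicalIso 𝔗 (precompactBornology (CompletedProjTensor V₁ V₂)) e ∧
          ∀ x y, e (b x y) = CompletedProjTensor.natural V₁ V₂ x y) ∧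
    -- the same for the bounded bornologies on the factors
    IsCompletedTensorProduct.{u₁, u₂, max u₁ u₂, w}
      (boundedBornology V₁) (boundedBornology V₂)
      (CompletedProjTensor.bismallBornology V₁ V₂) (CompletedProjTensor.natural V₁ V₂) ∧
    (∀ (T : Type (max u₁ u₂)) [AddCommGroup T] [Module ℂ T] (𝔗 : Set (Set T))
      (b : V₁ →ₗ[ℂ] V₂ →ₗ[ℂ] T),
      IsCompletedTensorProduct.{u₁, u₂, max u₁ u₂, max u₁ u₂}
        (boundedBornology V₁) (boundedBornology V₂) 𝔗 b →
      ∃ e : T ≃ₗ[ℂ] CompletedProjTensor V₁ V₂,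
        IsBornologicalIso 𝔗 (CompletedProjTensor.bismallBornology V₁ V₂) e ∧
          ∀ x y, e (b x y) = CompletedProjTensor.natural V₁ V₂ x y) ∧
    -- both factors are Banach spaces
    (IsSeminormable V₁ → IsSeminormable V₂ →
      CompletedProjTensor.bismallBornology V₁ V₂ =
        boundedBornology (CompletedProjTensor V₁ V₂)) ∧
    -- one factor is an `L¹` space of a Borel measure on a locally compact space
    (∀ (M : Type u₃) [TopologicalSpace M] [LocallyCompactSpace M] [MeasurableSpace M]
      [BorelSpace M] (μ : Measure M),
      (Nonempty (V₁ ≃L[ℂ] Lp ℂ 1 μ) ∨ Nonempty (V₂ ≃L[ℂ] Lp ℂ 1 μ)) →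
      CompletedProjTensor.bismallBornology V₁ V₂ =
        boundedBornology (CompletedProjTensor V₁ V₂)) ∧
    -- one factor is nuclear
    (IsNuclearSpace V₁ ∨ IsNuclearSpace V₂ →
      CompletedProjTensor.bismallBornology V₁ V₂ =
        boundedBornology (CompletedProjTensor V₁ V₂)) :=
  ⟨CompletedProjTensor.isCompletedTensorProduct_precompact V₁ V₂,
    fun _ _ _ _ _ hT =>
      (CompletedProjTensor.isCompletedTensorProduct_precompact V₁ V₂).exists_iso hT,
    CompletedProjTensor.isCompletedTensorProduct_bounded V₁ V₂,
    fun _ _ _ _ _ hT =>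
      (CompletedProjTensor.isCompletedTensorProduct_bounded V₁ V₂).exists_iso hT,
    CompletedProjTensor.bismallBornology_eq_of_isSeminormable,
    fun _ _ _ _ _ _ h => CompletedProjTensor.bismallBornology_eq_of_lp h,
    CompletedProjTensor.bismallBornology_eq_of_isNuclearSpace_or⟩
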